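/- **Theorem (Free construction, symmetric representable case).** *Multicategories.* A multigraph has nodes and, for all nodes $a_1,\dots,a_n,b$ ($n\ge 0$), a set of multiarrows $a_1,\dots,a_n\to b$. A *symmetric representable multicategory* is a multicategory (identities $\mathrm{id}_a:a\to a$ and associative, unital composition $f\circ\langle g_1,\dots,g_n\rangle$) together with: a right action of permutations, $f:a_1,\dots,a_n\to b\ \mapsto\ f\cdot\sigma:a_{\sigma(1)},\dots,a_{\sigma(n)}\to b$, satisfying the usual equivariance axioms with respect to composition; and, for every list $c_1,\dots,c_k$ of objects ($k\ge 0$), an object $(c_1\otimes\cdots\otimes c_k)$ and a multiarrow $\mathsf{re}_{\vec c}:c_1,\dots,c_k\to (c_1\otimes\cdots\otimes c_k)$ such that for all lists $\gamma,\delta$ and objects $b$, precomposition with $\langle \mathrm{id}_\gamma,\mathsf{re}_{\vec c},\mathrm{id}_\delta\rangle$ is a bijection from the multiarrows $\gamma,(c_1\otimes\cdots\otimes c_k),\delta\to b$ to the multiarrows $\gamma,c_1,\dots,c_k,\delta\to b$. A *symmetric representable functor* preserves identities, composition, the permutation action, the objects $(c_1\otimes\cdots\otimes c_k)$ and the multiarrows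 $\mathsf{re}_{\vec c}$ strictly. *Signatures.* A representable signature $\mathcal R$ is a set of atoms together with a multigraph whose nodes are the types $a::=o\mid (a_1\otimes\cdots\otimes a_k)$, $o$ an atom, $k\ge 0$. A map of representable signatures from $\mathcal R$ to a symmetric representable multicategory $\mathsf S$ is a morphism of multigraphs $i$ from $\mathcal R$ to the underlying multigraph of $\mathsf S$ with $i(a_1\otimes\cdots\otimes a_k)=(i(a_1)\otimes\cdots\otimes i(a_k))$. *Terms and types.* Terms over $\mathcal R$, up to renaming of bound variables, are $$s,t::=x\mid\langle s_1,\dots,s_k\rangle\mid s[x_1^{a_1},\dots,x_k^{a_k}:=t]\mid f(s_1,\dots,s_k),$$ where $f$ is a multiarrow of $\mathcal R$ and $s[\vec x:=t]$ binds $\vec x$ in $s$. A $(n_1,\dots,n_k)$-shuffle is a bijection $\sigma:[n_1]+\cdots+[n_k]\cong[n_1+\cdots+n_k]$ monotone on each summand; $(\gamma_1,\dots,\gamma_k)\cdot\sigma$ denotes the interleaving of lists in which the $j$-th entry of $\gamma_i$ stands at position $\sigma(i,j)$. Typing judgments are generated by the following rules, in which contexts that are merged have disjoint variables and $\sigma$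 is any shuffle of the merged contexts: * $x:a\vdash x:a$; * if $\gamma_i\vdash s_i:a_i$ for $1\le i\le k$, then $(\gamma_1,\dots,\gamma_k)\cdot\sigma\vdash\langle s_1,\dots,s_k\rangle:(a_1\otimes\cdots\otimes a_k)$; * if $\gamma_i\vdash s_i:a_i$ for $1\le i\le k$ and $f\in\mathcal R(a_1,\dots,a_k;b)$, then $(\gamma_1,\dots,\gamma_k)\cdot\sigma\vdash f(s_1,\dots,s_k):b$; * if $\gamma\vdash t:(a_1\otimes\cdots\otimes a_k)$ and $\delta,x_1:a_1,\dots,x_k:a_k,\delta'\vdash s:b$, then $(\delta,\gamma,\delta')\cdot\sigma\vdash s[x_1^{a_1},\dots,x_k^{a_k}:=t]:b$. *Equivalence.* Let $\mathtt C$ range over one-hole contexts, $\mathtt L::=[\cdot]\mid\mathtt L[\vec x:=t]$, and let $\mathtt E$ range over the one-hole contexts in which the hole is not the whole right-hand side $t$ of an explicit substitution $s[\vec x:=t]$. Let $\sim$ be the equivalence relation on typed terms of the same context and type generated by * $\mathtt C\big[s[x_1^{a_1},\dots,x_k^{a_k}:=\mathtt L[\langle t_1,\dots,t_k\rangle]]\big]\to_\beta\mathtt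 C\big[\mathtt L[s\{t_1,\dots,t_k/x_1,\dots,x_k\}]\big]$; * $\mathtt E[s]\to_\eta\mathtt E\big[\langle x_1,\dots,x_k\rangle[x_1^{a_1},\dots,x_k^{a_k}:=s]\big]$, for $\vec x$ fresh, $s$ of type $(a_1\otimes\cdots\otimes a_k)$ and not of the form $\mathtt L[\langle t_1,\dots,t_m\rangle]$; * the structural congruence generated by $\mathtt C[s[\vec x:=t]]\equiv\mathtt C[s][\vec x:=t]$, where $\mathtt C$ binds no variable of $t$ and $\vec x$ are not free in $\mathtt C$. *Claim.* Let $\mathcal R$ be a representable signature. Consider the multigraph $\mathsf{F}(\mathcal R)$ whose nodes are the types of $\mathcal R$ and whose multiarrows $a_1,\dots,a_n\to b$ are the classes modulo $\sim$ of the terms $s$ with $x_1:a_1,\dots,x_n:a_n\vdash s:b$ (up to renaming of the $x_i$). Then: 1. $\mathsf F(\mathcal R)$ is a symmetric representable multicategory, with identities the classes of the variables, composition $[s]\circ\langle[t_1],\dots,[t_n]\rangle=[s\{t_1,\dots,t_n/x_1,\dots,x_n\}]$ (the $t_i$ having pairwise disjoint variables), action of a permutation given by permuting the typing context of the same term, tensor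 products the types $(a_1\otimes\cdots\otimes a_k)$, and $\mathsf{re}_{\vec a}=[\langle x_1,\dots,x_k\rangle]$; all these operations are well defined on classes. 2. Let $\eta_{\mathcal R}$ be the morphism of multigraphs from $\mathcal R$ to $\mathsf F(\mathcal R)$ that is the identity on types and sends $f$ to $[f(x_1,\dots,x_n)]$. For every symmetric representable multicategory $\mathsf S$ and every map of representable signatures $i$ from $\mathcal R$ to $\mathsf S$ there is a unique symmetric representable functor $i^\ast:\mathsf F(\mathcal R)\to\mathsf S$ such that $i^\ast\circ\eta_{\mathcal R}=i$ as morphisms of multigraphs. -/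

import Mathlib

universe u v w z

namespace RepCalc

/-! ## Multigraphs and multicategories

A list `a₁, …, aₙ` of nodes is a function `Fin n → Node`. -/

/-- A multigraph: nodes, and multiarrows `a₁, …, aₙ → b`. -/
structure Multigraph where
  Node : Type u
  Hom : {n : ℕ} → (Fin n → Node) → Node → Type v

/-- A multiarrow together with its source and target. -/
structure Multigraph.Arr (G : Multigraph.{u, v}) where
  arity : ℕ
  src : Fin arity → G.Node
  tgt : G.Node
  hom : G.Hom src tgt

/-- The multiarrow `f`, remembering its source and target. An equation `G.arr f = G.arr g` says
that `f` and `g` have the same source and target and are the same multiarrow; it is used where the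
two sources are equal lists that are written differently. -/
def Multigraph.arr (G : Multigraph.{u, v}) {n : ℕ} {a : Fin n → G.Node} {b : G.Node}
    (f : G.Hom a b) : G.Arr :=
  ⟨n, a, b, f⟩

/-- Concatenation `γ₁, …, γₙ` of lists. -/
def concat {α : Type*} {n : ℕ} {m : Fin n → ℕ} (γ : (i : Fin n) → Fin (m i) → α) :
    Fin (∑ i, m i) → α :=
  fun p => γ (finSigmaFinEquiv.symm p).1 (finSigmaFinEquiv.symm p).2

/-- The bijection of positions in concatenated lists that permutes the blocks by `σ` and acts by
`τ i` inside the `i`-th block. -/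
def blockEquiv {n n' : ℕ} {m : Fin n → ℕ} {m' : Fin n' → ℕ} (σ : Fin n' ≃ Fin n)
    (τ : (i : Fin n') → Fin (m' i) ≃ Fin (m (σ i))) : Fin (∑ i, m' i) ≃ Fin (∑ i, m i) :=
  finSigmaFinEquiv.symm.trans ((Equiv.sigmaCongr σ τ).trans finSigmaFinEquiv)

/-- The structure of a multicategory on a multigraph. -/
structure MulticatStr (G : Multigraph.{u, v}) where
  id : (a : G.Node) → G.Hom (fun _ : Fin 1 => a) a
  comp : {n : ℕ} → {a : Fin n → G.Node} → {b : G.Node} → {m : Fin n → ℕ} →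
    {γ : (i : Fin n) → Fin (m i) → G.Node} →
    G.Hom a b → ((i : Fin n) → G.Hom (γ i) (a i)) → G.Hom (concat γ) b
  id_comp : ∀ {n : ℕ} {a : Fin n → G.Node} {b : G.Node} (f : G.Hom a b),
    G.arr (comp (γ := fun _ : Fin 1 => a) (id b) (fun _ => f)) = G.arr f
  comp_id : ∀ {n : ℕ} {a : Fin n → G.Node} {b : G.Node} (f : G.Hom a b),
    G.arr (comp f (fun i => id (a i))) = G.arr f
  assoc : ∀ {n : ℕ} {a : Fin n → G.Node} {b : G.Node} {m : Fin n → ℕ}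
    {γ : (i : Fin n) → Fin (m i) → G.Node} {l : (i : Fin n) → Fin (m i) → ℕ}
    {δ : (i : Fin n) → (j : Fin (m i)) → Fin (l i j) → G.Node}
    (f : G.Hom a b) (g : (i : Fin n) → G.Hom (γ i) (a i))
    (h : (i : Fin n) → (j : Fin (m i)) → G.Hom (δ i j) (γ i j)),
    G.arr (comp (comp f g)
        (fun p => h (finSigmaFinEquiv.symm p).1 (finSigmaFinEquiv.symm p).2)) =
      G.arr (comp f (fun i => comp (g i) (h i)))

/-- A symmetric structure on a multicategory: a right action of permutations on the sources of
multiarrows, `f : a₁, …, aₙ → b` giving `f · σ : a_{σ(1)}, …, a_{σ(n)} → b`, compatible with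
composition. Permutations are written as bijections `σ : [m] ≅ [n]` (so that `m = n`). -/
structure SymStr {G : Multigraph.{u, v}} (C : MulticatStr G) where
  act : {m n : ℕ} → {a : Fin n → G.Node} → {b : G.Node} → (σ : Fin m ≃ Fin n) →
    G.Hom a b → G.Hom (a ∘ σ) b
  act_refl : ∀ {n : ℕ} {a : Fin n → G.Node} {b : G.Node} (f : G.Hom a b),
    act (Equiv.refl (Fin n)) f = f
  act_act : ∀ {l m n : ℕ} {a : Fin n → G.Node} {b : G.Node} (σ : Fin m ≃ Fin n)
    (τ : Fin l ≃ Fin m) (f : G.Hom a b), act τ (act σ f) = act (τ.trans σ) f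
  act_comp : ∀ {n n' : ℕ} {a : Fin n → G.Node} {b : G.Node} {m : Fin n → ℕ} {m' : Fin n' → ℕ}
    {γ : (i : Fin n) → Fin (m i) → G.Node} (f : G.Hom a b)
    (g : (i : Fin n) → G.Hom (γ i) (a i)) (σ : Fin n' ≃ Fin n)
    (τ : (i : Fin n') → Fin (m' i) ≃ Fin (m (σ i))),
    G.arr (C.comp (act σ f) (fun i => act (τ i) (g (σ i)))) =
      G.arr (act (blockEquiv σ τ) (C.comp f g))

/-- A representable structure on a multicategory: objects `(c₁ ⊗ ⋯ ⊗ cₖ)` and multiarrows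
`re : c₁, …, cₖ → (c₁ ⊗ ⋯ ⊗ cₖ)` such that composing with `re` at any one position `p` of the
source (and with identities `g i` at the other positions) is a bijection
`Hom(γ, (c₁ ⊗ ⋯ ⊗ cₖ), δ; b) → Hom(γ, c₁, …, cₖ, δ; b)`; naturality in `b`, `γ`, `δ` is then an
instance of associativity. In `bijective`, `a` is the list `γ, (c₁ ⊗ ⋯ ⊗ cₖ), δ`, with the tensor
product at position `p`. -/
structure RepStr {G : Multigraph.{u, v}} (C : MulticatStr G) where
  tensor : {k : ℕ} → (Fin k → G.Node) → G.Node
  re : {k : ℕ} → (c : Fin k → G.Node) → G.Hom c (tensor c)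
  bijective : ∀ {n : ℕ} (a : Fin n → G.Node) (b : G.Node) (p : Fin n) {k : ℕ}
    (c : Fin k → G.Node) {m : Fin n → ℕ} {γ : (i : Fin n) → Fin (m i) → G.Node}
    (g : (i : Fin n) → G.Hom (γ i) (a i)),
    G.arr (g p) = G.arr (re c) → (∀ i, i ≠ p → G.arr (g i) = G.arr (C.id (a i))) →
    Function.Bijective (fun f : G.Hom a b => C.comp f g)

/-- The structure of a symmetric representable multicategory on a multigraph. -/
structure SymRepStr (G : Multigraph.{u, v}) extends MulticatStr G where
  sym : SymStr toMulticatStr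
  rep : RepStr toMulticatStr

/-- Morphisms of multigraphs. -/
structure GraphHom (G : Multigraph.{u, v}) (H : Multigraph.{w, z}) where
  obj : G.Node → H.Node
  map : {n : ℕ} → {a : Fin n → G.Node} → {b : G.Node} → G.Hom a b → H.Hom (obj ∘ a) (obj b)

/-- The composite `F ∘ E` of morphisms of multigraphs. -/
def GraphHom.comp {G : Multigraph} {H : Multigraph} {K : Multigraph}
    (F : GraphHom H K) (E : GraphHom G H) : GraphHom G K where
  obj := F.obj ∘ E.obj
  map f := F.map (E.map f)

/-- Symmetric representable functors: functors of multicategories that preserve the action of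
permutations, the tensor products and the multiarrows `re` on the nose. -/
structure SymRepFunctor {G : Multigraph.{u, v}} {H : Multigraph.{w, z}}
    (S : SymRepStr G) (T : SymRepStr H) extends GraphHom G H where
  map_id : ∀ a : G.Node, map (S.id a) = T.id (obj a)
  map_comp : ∀ {n : ℕ} {a : Fin n → G.Node} {b : G.Node} {m : Fin n → ℕ}
    {γ : (i : Fin n) → Fin (m i) → G.Node} (f : G.Hom a b)
    (g : (i : Fin n) → G.Hom (γ i) (a i)),
    map (S.comp f g) = T.comp (map f) (fun i => map (g i))
  map_act : ∀ {m n : ℕ} {a : Fin n → G.Node} {b : G.Node} (σ : Fin m ≃ Fin n) (f : G.Hom a b),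
    map (S.sym.act σ f) = T.sym.act σ (map f)
  obj_tensor : ∀ {k : ℕ} (c : Fin k → G.Node), obj (S.rep.tensor c) = T.rep.tensor (obj ∘ c)
  map_re : ∀ {k : ℕ} (c : Fin k → G.Node),
    H.arr (map (S.rep.re c)) = H.arr (T.rep.re (obj ∘ c))

/-! ## Representable signatures -/

/-- Types over a set of atoms: `a ::= o | (a₁ ⊗ ⋯ ⊗ aₖ)`, with `k ≥ 0`. -/
inductive Ty (Atom : Type u) : Type u
  | atom (o : Atom) : Ty Atom
  | tensor {k : ℕ} (a : Fin k → Ty Atom) : Ty Atom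

/-- A representable signature: a set of atoms and a multigraph whose nodes are the types. -/
structure Signature where
  Atom : Type u
  Hom : {n : ℕ} → (Fin n → Ty Atom) → Ty Atom → Type v

/-- The underlying multigraph of a signature. -/
def Signature.graph (R : Signature.{u, v}) : Multigraph.{u, v} where
  Node := Ty R.Atom
  Hom := R.Hom

/-- Maps of representable signatures from `R` to (the signature underlying) a symmetric
representable multicategory: morphisms of multigraphs that preserve tensor products of types. -/
structure SignatureMap (R : Signature.{u, v}) {H : Multigraph.{w, z}} (T : SymRepStr H)
    extends GraphHom R.graph H where
  obj_tensor : ∀ {k : ℕ} (a : Fin k → Ty R.Atom), obj (Ty.tensor a) = T.rep.tensor (obj ∘ a)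

/-! ## Terms

Terms up to renaming of bound variables are represented with de Bruijn indices: `Tm R n` is the
set of terms whose free variables are among `x₀, …, xₙ₋₁`. A binder of `k` variables passes from
the scope `n` to the scope `n + k`, where the first `n` variables are the old ones and the last
`k` variables are the bound ones. -/

/-- Resource terms: variables, lists `⟨s₁, …, sₖ⟩`, explicit substitutions
`s[x₁^{a₁}, …, xₖ^{aₖ} := t]` (binding `x₁, …, xₖ` in `s`), and `f(s₁, …, sₖ)` for a multiarrow
`f` of the signature. -/
inductive Tm (R : Signature.{u, v}) : ℕ → Type (max u v)
  | var {n : ℕ} (i : Fin n) : Tm R n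
  | list {n k : ℕ} (s : Fin k → Tm R n) : Tm R n
  | sub {n k : ℕ} (a : Fin k → Ty R.Atom) (s : Tm R (n + k)) (t : Tm R n) : Tm R n
  | app {n k : ℕ} {a : Fin k → Ty R.Atom} {b : Ty R.Atom} (f : R.Hom a b)
      (s : Fin k → Tm R n) : Tm R n

/-- Extension of a renaming under a binder of `k` variables. -/
def liftRen {n m : ℕ} (k : ℕ) (ρ : Fin n → Fin m) : Fin (n + k) → Fin (m + k) :=
  Fin.append (fun i => Fin.castAdd k (ρ i)) (fun j => Fin.natAdd m j)

namespace Tm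

variable {R : Signature.{u, v}}

/-- Renaming of free variables. -/
def rename {n m : ℕ} : Tm R n → (Fin n → Fin m) → Tm R m
  | var i, ρ => var (ρ i)
  | list s, ρ => list (fun i => (s i).rename ρ)
  | sub (k := k) a s t, ρ => sub a (s.rename (liftRen k ρ)) (t.rename ρ)
  | app f s, ρ => app f (fun i => (s i).rename ρ)

/-- Extension of a substitution under a binder of `k` variables. -/
def liftSubst {n m : ℕ} (k : ℕ) (θ : Fin n → Tm R m) : Fin (n + k) → Tm R (m + k) :=
  Fin.append (fun i => (θ i).rename (Fin.castAdd k)) (fun j => var (Fin.natAdd m j))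

/-- Capture-avoiding simultaneous substitution of `θ i` for the free variable `xᵢ`. -/
def subst {n m : ℕ} : Tm R n → (Fin n → Tm R m) → Tm R m
  | var i, θ => θ i
  | list s, θ => list (fun i => (s i).subst θ)
  | sub (k := k) a s t, θ => sub a (s.subst (liftSubst k θ)) (t.subst θ)
  | app f s, θ => app f (fun i => (s i).subst θ)

end Tm

/-! ## Typing -/

/-- A `(m₁, …, mₖ)`-shuffle: a bijection `[m₁] + ⋯ + [mₖ] ≅ [N]` (so `N = m₁ + ⋯ + mₖ`) which is
monotone on every summand. -/
def IsShuffle {k N : ℕ} {m : Fin k → ℕ} (σ : (Σ i : Fin k, Fin (m i)) ≃ Fin N) : Prop :=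
  ∀ i : Fin k, Monotone (fun j : Fin (m i) => σ ⟨i, j⟩)

/-- A typing context `y₁ : a₁, …, yₘ : aₘ` whose variables belong to the scope `n`. -/
abbrev Ctx (R : Signature.{u, v}) (n m : ℕ) := Fin m → Fin n × Ty R.Atom

/-- No variable occurs in two of the contexts `γ₁, …, γₖ`. -/
def DisjointCtx {R : Signature.{u, v}} {n k : ℕ} {m : Fin k → ℕ}
    (γ : (i : Fin k) → Ctx R n (m i)) : Prop :=
  ∀ i i', i ≠ i' → ∀ j j', (γ i j).1 ≠ (γ i' j').1

/-- `Δ` is the shuffle `(γ₁, …, γₖ) · σ` of the contexts `γ₁, …, γₖ`: the `j`-th entry of `γᵢ`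
is placed at the position `σ(i, j)`. -/
def ShuffledBy {R : Signature.{u, v}} {n k N : ℕ} {m : Fin k → ℕ}
    (γ : (i : Fin k) → Ctx R n (m i)) (σ : (Σ i : Fin k, Fin (m i)) ≃ Fin N)
    (Δ : Ctx R n N) : Prop :=
  IsShuffle σ ∧ ∀ i j, Δ (σ ⟨i, j⟩) = γ i j

/-- The context `δ, x₁ : a₁, …, xₖ : aₖ, δ'` under a binder of `x₁, …, xₖ`. -/
def bindCtx {R : Signature.{u, v}} {n p q k : ℕ} (δ : Ctx R n p) (a : Fin k → Ty R.Atom)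
    (δ' : Ctx R n q) : Ctx R (n + k) (p + k + q) :=
  Fin.append
    (Fin.append (fun i => (Fin.castAdd k (δ i).1, (δ i).2)) (fun j => (Fin.natAdd n j, a j)))
    (fun i => (Fin.castAdd k (δ' i).1, (δ' i).2))

/-- The symmetric representable type system: contexts are merged along shuffles. In the rule
`sub`, the merged contexts are `γ 0 = δ`, `γ 1` (the context of `t`) and `γ 2 = δ'`. -/
inductive Typed {R : Signature.{u, v}} :
    {n N : ℕ} → Ctx R n N → Tm R n → Ty R.Atom → Prop
  | var {n : ℕ} (x : Fin n) (a : Ty R.Atom) (Δ : Ctx R n 1) :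
      Δ 0 = (x, a) → Typed Δ (Tm.var x) a
  | list {n N k : ℕ} {m : Fin k → ℕ} (γ : (i : Fin k) → Ctx R n (m i))
      (σ : (Σ i : Fin k, Fin (m i)) ≃ Fin N) (Δ : Ctx R n N)
      (s : Fin k → Tm R n) (a : Fin k → Ty R.Atom) :
      (∀ i, Typed (γ i) (s i) (a i)) → DisjointCtx γ → ShuffledBy γ σ Δ →
      Typed Δ (Tm.list s) (Ty.tensor a)
  | sub {n N k : ℕ} {m : Fin 3 → ℕ} (γ : (i : Fin 3) → Ctx R n (m i))
      (σ : (Σ i : Fin 3, Fin (m i)) ≃ Fin N) (Δ : Ctx R n N)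
      (a : Fin k → Ty R.Atom) (s : Tm R (n + k)) (t : Tm R n) (b : Ty R.Atom) :
      Typed (γ 1) t (Ty.tensor a) → Typed (bindCtx (γ 0) a (γ 2)) s b →
      DisjointCtx γ → ShuffledBy γ σ Δ → Typed Δ (Tm.sub a s t) b
  | app {n N k : ℕ} {m : Fin k → ℕ} (γ : (i : Fin k) → Ctx R n (m i))
      (σ : (Σ i : Fin k, Fin (m i)) ≃ Fin N) (Δ : Ctx R n N)
      (s : Fin k → Tm R n) (a : Fin k → Ty R.Atom) (b : Ty R.Atom) (f : R.Hom a b) :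
      (∀ i, Typed (γ i) (s i) (a i)) → DisjointCtx γ → ShuffledBy γ σ Δ →
      Typed Δ (Tm.app f s) b

/-! ## Contexts with one hole -/

/-- Contexts with one hole, `C ::= [·] | ⟨s₁, …, C, …, sₖ⟩ | C[x⃗ := t] | s[x⃗ := C] |
f(s₁, …, C, …, sₖ)`, of scope `n`, whose hole is in the scope `m` (which consists of the `n`
variables and those that `C` binds at its hole). In `list` and `app`, the `i`-th entry of `s` is
ignored, and replaced by the context. -/
inductive HoleCtx (R : Signature.{u, v}) : ℕ → ℕ → Type (max u v)
  | hole {n : ℕ} : HoleCtx R n n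
  | list {n m k : ℕ} (s : Fin k → Tm R n) (i : Fin k) (C : HoleCtx R n m) : HoleCtx R n m
  | subL {n m k : ℕ} (a : Fin k → Ty R.Atom) (C : HoleCtx R (n + k) m) (t : Tm R n) :
      HoleCtx R n m
  | subR {n m k : ℕ} (a : Fin k → Ty R.Atom) (s : Tm R (n + k)) (C : HoleCtx R n m) :
      HoleCtx R n m
  | app {n m k : ℕ} {a : Fin k → Ty R.Atom} {b : Ty R.Atom} (f : R.Hom a b)
      (s : Fin k → Tm R n) (i : Fin k) (C : HoleCtx R n m) : HoleCtx R n m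

namespace HoleCtx

variable {R : Signature.{u, v}}

/-- The term `C[s]`. -/
def plug {n m : ℕ} : HoleCtx R n m → Tm R m → Tm R n
  | hole, s => s
  | list r i C, s => Tm.list (Function.update r i (C.plug s))
  | subL a C t, s => Tm.sub a (C.plug s) t
  | subR a r C, s => Tm.sub a r (C.plug s)
  | app f r i C, s => Tm.app f (Function.update r i (C.plug s))

/-- The inclusion of the variables of the scope of `C` into the scope of its hole. -/
def inc {n m : ℕ} : HoleCtx R n m → Fin n → Fin m
  | hole, x => x
  | list _ _ C, x => C.inc x
  | subL (k := k) _ C _, x => C.inc (Fin.castAdd k x)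
  | subR _ _ C, x => C.inc x
  | app _ _ _ C, x => C.inc x

/-- Exchange of two blocks of bound variables. -/
def exchange (n l k : ℕ) : Fin (n + l + k) → Fin (n + k + l) :=
  Fin.append
    (Fin.append (fun i => Fin.castAdd l (Fin.castAdd k i)) (fun j => Fin.natAdd (n + k) j))
    (fun j => Fin.castAdd l (Fin.natAdd n j))

/-- The term `C[s]` for a term `s` that has, besides the variables of the scope of the hole, `k`
further free variables `x₁, …, xₖ`, which do not occur in `C` and remain free in `C[s]`. -/
def plugFresh {n m : ℕ} (k : ℕ) : HoleCtx R n m → Tm R (m + k) → Tm R (n + k)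
  | hole, s => s
  | list r i C, s =>
      Tm.list (Function.update (fun j => (r j).rename (Fin.castAdd k)) i (C.plugFresh k s))
  | subL (k := l) a C t, s =>
      Tm.sub a ((C.plugFresh k s).rename (exchange n l k)) (t.rename (Fin.castAdd k))
  | subR (k := l) a r C, s =>
      Tm.sub a (r.rename (liftRen l (Fin.castAdd k))) (C.plugFresh k s)
  | app f r i C, s =>
      Tm.app f (Function.update (fun j => (r j).rename (Fin.castAdd k)) i (C.plugFresh k s))

/-- `C` is the hole. -/
def IsHole {n m : ℕ} : HoleCtx R n m → Prop
  | hole => True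
  | _ => False

/-- Substitution contexts `L ::= [·] | L[x⃗ := t]`. -/
def IsSubstCtx {n m : ℕ} : HoleCtx R n m → Prop
  | hole => True
  | subL _ C _ => C.IsSubstCtx
  | _ => False

/-- Contexts for the `η`-reduction: `E ::= [·] | ⟨s₁, …, E, …, sₖ⟩ | E[x⃗ := s] |
s[x⃗ := E] (E ≠ [·]) | f(s₁, …, E, …, sₖ)`. -/
def IsEtaCtx {n m : ℕ} : HoleCtx R n m → Prop
  | hole => True
  | list _ _ C => C.IsEtaCtx
  | subL _ C _ => C.IsEtaCtx
  | subR _ _ C => C.IsEtaCtx ∧ ¬ C.IsHole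
  | app _ _ _ C => C.IsEtaCtx

end HoleCtx

/-! ## Reduction and structural equivalence -/

/-- The set `LT` of the terms `L[⟨t₁, …, tₖ⟩]`, with `L` a substitution context. -/
def IsLT {R : Signature.{u, v}} {n : ℕ} (s : Tm R n) : Prop :=
  ∃ (m k : ℕ) (L : HoleCtx R n m) (t : Fin k → Tm R m), L.IsSubstCtx ∧ s = L.plug (Tm.list t)

/-- Root steps of `β`: `s[x₁, …, xₖ := L[⟨t₁, …, tₖ⟩]] → L[s{t₁, …, tₖ / x₁, …, xₖ}]`. -/
inductive BetaRoot {R : Signature.{u, v}} : {n : ℕ} → Tm R n → Tm R n → Prop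
  | mk {n m k : ℕ} (a : Fin k → Ty R.Atom) (s : Tm R (n + k)) (L : HoleCtx R n m)
      (t : Fin k → Tm R m) : L.IsSubstCtx →
      BetaRoot (Tm.sub a s (L.plug (Tm.list t)))
        (L.plug (s.subst (Fin.append (fun x => Tm.var (L.inc x)) t)))

/-- Root steps of `η`: `s → ⟨x₁, …, xₖ⟩[x₁^{a₁}, …, xₖ^{aₖ} := s]`, for `s` of type
`(a₁ ⊗ ⋯ ⊗ aₖ)` and not in `LT`. -/
inductive EtaRoot {R : Signature.{u, v}} : {n : ℕ} → Tm R n → Tm R n → Prop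
  | mk {n N k : ℕ} (γ : Ctx R n N) (a : Fin k → Ty R.Atom) (s : Tm R n) :
      Typed γ s (Ty.tensor a) → ¬ IsLT s →
      EtaRoot s (Tm.sub a (Tm.list (fun j => Tm.var (Fin.natAdd n j))) s)

/-- One step of `β`- or `η`-reduction, or one use, inside any term, of the structural rule
`C[s[x⃗ := t]] ≡ C[s][x⃗ := t]`, where `C` does not bind variables of `t` (which is thus a term in
the scope of `C`) and `x⃗` are not free in `C`. -/
inductive Step {R : Signature.{u, v}} : {n : ℕ} → Tm R n → Tm R n → Prop
  | beta {n m : ℕ} (C : HoleCtx R n m) (s s' : Tm R m) :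
      BetaRoot s s' → Step (C.plug s) (C.plug s')
  | eta {n m : ℕ} (E : HoleCtx R n m) (s s' : Tm R m) :
      E.IsEtaCtx → EtaRoot s s' → Step (E.plug s) (E.plug s')
  | struct {n m l k : ℕ} (D : HoleCtx R n m) (C : HoleCtx R m l) (a : Fin k → Ty R.Atom)
      (s : Tm R (l + k)) (t : Tm R m) :
      Step (D.plug (C.plug (Tm.sub a s (t.rename C.inc))))
        (D.plug (Tm.sub a (C.plugFresh k s) t))

/-! ## The multigraph of terms modulo equivalence -/

/-- The terms `s` with `x₁ : a₁, …, xₙ : aₙ ⊢ s : b`. The names of the variables of the context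
do not matter, and are taken to be the variables of the scope `n`, in their order. -/
def Terms (R : Signature.{u, v}) {n : ℕ} (a : Fin n → Ty R.Atom) (b : Ty R.Atom) :=
  {s : Tm R n // Typed (fun i => (i, a i)) s b}

/-- The multigraph with the types as nodes and, as multiarrows `a₁, …, aₙ → b`, the terms of type
`b` in the context `a₁, …, aₙ`, modulo the equivalence relation generated by reduction and
structural equivalence. -/
def freeGraph (R : Signature.{u, v}) : Multigraph.{u, max u v} where
  Node := Ty R.Atom
  Hom a b := Quot (fun s s' : Terms R a b => Step s.1 s'.1)

/-- The class of a typed term. -/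
def cls {R : Signature.{u, v}} {n : ℕ} {a : Fin n → Ty R.Atom} {b : Ty R.Atom} (s : Tm R n)
    (h : Typed (fun i => (i, a i)) s b) : (freeGraph R).Hom a b :=
  Quot.mk _ ⟨s, h⟩

theorem shuffledBy_singletons {R : Signature.{u, v}} {n : ℕ} (a : Fin n → Ty R.Atom) :
    ShuffledBy (m := fun _ : Fin n => 1) (fun i _ => (i, a i))
      (Equiv.sigmaUnique (Fin n) fun _ => Fin 1) (fun i => (i, a i)) :=
  ⟨fun _ _ _ _ => le_refl _, fun _ _ => rfl⟩

theorem disjointCtx_singletons {R : Signature.{u, v}} {n : ℕ} (a : Fin n → Ty R.Atom) :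
    DisjointCtx (R := R) (m := fun _ : Fin n => 1) (fun i _ => (i, a i)) :=
  fun _ _ h _ _ => h

theorem typed_var {R : Signature.{u, v}} (a : Ty R.Atom) :
    Typed (R := R) (fun i : Fin 1 => (i, a)) (Tm.var 0) a :=
  Typed.var 0 a _ rfl

theorem typed_list_var {R : Signature.{u, v}} {n : ℕ} (a : Fin n → Ty R.Atom) :
    Typed (R := R) (fun i => (i, a i)) (Tm.list Tm.var) (Ty.tensor a) :=
  Typed.list _ _ _ _ _ (fun i => Typed.var i (a i) _ rfl) (disjointCtx_singletons a)
    (shuffledBy_singletons a)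

theorem typed_app_var {R : Signature.{u, v}} {n : ℕ} {a : Fin n → Ty R.Atom} {b : Ty R.Atom}
    (f : R.Hom a b) : Typed (R := R) (fun i => (i, a i)) (Tm.app f Tm.var) b :=
  Typed.app _ _ _ _ _ _ f (fun i => Typed.var i (a i) _ rfl) (disjointCtx_singletons a)
    (shuffledBy_singletons a)

/-- The inclusion `η` of a signature: the identity on types, and `f ↦ [f(x₁, …, xₙ)]`. -/
def unit (R : Signature.{u, v}) : GraphHom R.graph (freeGraph R) where
  obj a := a
  map f := cls (Tm.app f Tm.var) (typed_app_var f)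

end RepCalc

open RepCalc

/-!
The terms modulo reduction and structural equivalence form a symmetric representable multicategory,
and this multicategory is free on the signature.

The first part replaces contexts, shuffles and one-hole contexts by notions that are stable under
substitution. The typing judgment `HasTy A s b` refers to an environment `A` for all variables of
the scope and asks that bound variables occur exactly once; by `typed_iff`, a term is typed in the
context of all variables exactly if it is so typed and every variable of the scope occurs once.
The equivalence is replaced by the congruence `Conv`, which has two rules: `beta` for a literal
list, and `expand`, which says that
`s{t/z} = s{⟨x₁, …, xₖ⟩/z}[x₁, …, xₖ := t]` if `s` is linear in `z`. On the one hand `η` and the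
structural rules follow from `beta` and `expand` (`Step.conv`). On the other hand `expand` follows
from them, because substituting for a variable that occurs once is filling the hole of a context
(`Joined.expand`). Hence classes of terms coincide exactly if the terms are convertible
(`cls_eq_iff`). As `Conv` is compatible with substitution, composition and the action of
permutations are well defined on classes. The axioms reduce to identities between substitutions,
and the bijection required of `re` is `expand` for injectivity and `beta` for surjectivity
(`freeComp_bijective`).

For the universal property, terms are interpreted in a symmetric representable multicategory `T`
by multiarrows whose inputs are named by variables, up to permutations of the inputs (`NArr`). Such
multiarrows compose along names, and this composition is associative and unital, so that the
interpretation needs no shuffles. An explicit substitution `s[x⃗ := t]` is interpreted through the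
value `Ψ`, with one input `z` of tensor type, for which `Ψ ∘ re` is the value of `s`; it exists and
is unique because composition with `re` is bijective. Therefore every typed term has a value, a
linear one has exactly one (`Interp.exists_of_hasTy`, `Interp.unique`), the substitution lemma holds
(`Interp.subst`), and convertible terms have the same value (`Interp.of_conv`). This gives the
functor (`freeFunctor`).

For uniqueness, terms are interpreted in the multicategory of terms itself. There the value of a
term is its own class (`Interp.represents`), and any functor `F` carries interpretations to
interpretations (`Interp.map`). So the image under `F` of the class of a term is the value of the
term under the restriction of `F` to the signature, and `F` is determined by this restriction.
-/

namespace RepCalc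

/-! ### Renaming and substitution -/

section Substitution

variable {R : Signature.{u, v}}

@[simp] theorem liftRen_castAdd {n m k : ℕ} (ρ : Fin n → Fin m) (x : Fin n) :
    liftRen k ρ (Fin.castAdd k x) = Fin.castAdd k (ρ x) := by
  simp [liftRen]

@[simp] theorem liftRen_natAdd {n m k : ℕ} (ρ : Fin n → Fin m) (j : Fin k) :
    liftRen k ρ (Fin.natAdd n j) = Fin.natAdd m j := by
  simp [liftRen]

@[simp] theorem castAdd_ne_natAdd {n k : ℕ} (x : Fin n) (j : Fin k) :
    Fin.castAdd k x ≠ Fin.natAdd n j := by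
  intro h
  have := congrArg Fin.val h
  simp at this
  omega

@[simp] theorem natAdd_ne_castAdd {n k : ℕ} (x : Fin n) (j : Fin k) :
    Fin.natAdd n j ≠ Fin.castAdd k x := (castAdd_ne_natAdd x j).symm

theorem funext_append {n k : ℕ} {α : Type*} {f g : Fin (n + k) → α}
    (hl : ∀ x, f (Fin.castAdd k x) = g (Fin.castAdd k x))
    (hr : ∀ j, f (Fin.natAdd n j) = g (Fin.natAdd n j)) : f = g :=
  funext fun x => Fin.addCases hl hr x

namespace Tm

@[simp] theorem liftSubst_castAdd {n m k : ℕ} (θ : Fin n → Tm R m) (x : Fin n) :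
    liftSubst k θ (Fin.castAdd k x) = (θ x).rename (Fin.castAdd k) := by
  simp [liftSubst]

@[simp] theorem liftSubst_natAdd {n m k : ℕ} (θ : Fin n → Tm R m) (j : Fin k) :
    liftSubst k θ (Fin.natAdd n j) = var (Fin.natAdd m j) := by
  simp [liftSubst]

theorem rename_rename {n m l : ℕ} (s : Tm R n) (ρ : Fin n → Fin m) (ρ' : Fin m → Fin l) :
    (s.rename ρ).rename ρ' = s.rename (ρ' ∘ ρ) := by
  induction s generalizing m l with
  | var i => rfl
  | list s ih => simp [rename, ih]
  | sub a s t ihs iht =>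
    simp only [rename, ihs, iht]
    congr 2
    apply funext_append <;> simp
  | app f s ih => simp [rename, ih]

theorem rename_eq_subst {n m : ℕ} (s : Tm R n) (ρ : Fin n → Fin m) :
    s.rename ρ = s.subst (fun x => var (ρ x)) := by
  induction s generalizing m with
  | var i => rfl
  | list s ih => simp [rename, subst, ih]
  | sub a s t ihs iht =>
    simp only [rename, subst, ihs, iht]
    congr 2
    apply funext_append <;> simp [rename]
  | app f s ih => simp [rename, subst, ih]

@[simp] theorem subst_var {n : ℕ} (s : Tm R n) : s.subst var = s := by
  induction s with
  | var i => rfl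
  | list s ih => simp [subst, ih]
  | @sub n k a s t ihs iht =>
    have : liftSubst k (var : Fin n → Tm R n) = var := by
      apply funext_append <;> simp [rename]
    simp [subst, ihs, iht, this]
  | app f s ih => simp [subst, ih]

@[simp] theorem rename_id {n : ℕ} (s : Tm R n) : s.rename (fun x => x) = s := by
  rw [rename_eq_subst]; exact subst_var s

theorem subst_rename {n m l : ℕ} (s : Tm R n) (ρ : Fin n → Fin m) (θ : Fin m → Tm R l) :
    (s.rename ρ).subst θ = s.subst (fun x => θ (ρ x)) := by
  induction s generalizing m l with
  | var i => rfl
  | list s ih => simp [rename, subst, ih]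
  | sub a s t ihs iht =>
    simp only [rename, subst, ihs, iht]
    congr 2
    apply funext_append <;> simp
  | app f s ih => simp [rename, subst, ih]

theorem rename_subst {n m l : ℕ} (s : Tm R n) (θ : Fin n → Tm R m) (ρ : Fin m → Fin l) :
    (s.subst θ).rename ρ = s.subst (fun x => (θ x).rename ρ) := by
  induction s generalizing m l with
  | var i => rfl
  | list s ih => simp [rename, subst, ih]
  | sub a s t ihs iht =>
    simp only [rename, subst, ihs, iht]
    congr 2
    apply funext_append
    · intro x
      simp only [liftSubst_castAdd, rename_rename]
      congr 1
      funext y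
      simp
    · simp [rename]
  | app f s ih => simp [rename, subst, ih]

theorem subst_subst {n m l : ℕ} (s : Tm R n) (θ : Fin n → Tm R m) (θ' : Fin m → Tm R l) :
    (s.subst θ).subst θ' = s.subst (fun x => (θ x).subst θ') := by
  induction s generalizing m l with
  | var i => rfl
  | list s ih => simp [subst, ih]
  | sub a s t ihs iht =>
    simp only [subst, ihs, iht]
    congr 2
    apply funext_append
    · intro x
      simp [subst_rename, rename_subst]
    · simp [subst]
  | app f s ih => simp [subst, ih]

/-! ### Occurrences of variables -/

/-- The number of free occurrences of the variable `x` in a term. -/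
def occ {n : ℕ} : Tm R n → Fin n → ℕ
  | var i, x => if i = x then 1 else 0
  | list s, x => ∑ i, (s i).occ x
  | sub (k := k) _ s t, x => s.occ (Fin.castAdd k x) + t.occ x
  | app _ s, x => ∑ i, (s i).occ x

theorem occ_rename {n m : ℕ} (s : Tm R n) (ρ : Fin n → Fin m) (y : Fin m) :
    (s.rename ρ).occ y = ∑ x, if ρ x = y then s.occ x else 0 := by
  induction s generalizing m with
  | var i => simp only [rename, occ]; rw [Finset.sum_eq_single i] <;> aesop
  | list s ih =>
    simp only [rename, occ, ih]
    rw [Finset.sum_comm]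
    refine Finset.sum_congr rfl fun x _ => ?_
    split_ifs <;> simp
  | sub a s t ihs iht =>
    simp only [rename, occ, ihs, iht, Fin.sum_univ_add]
    simp [← Finset.sum_add_distrib]
    refine Finset.sum_congr rfl fun x _ => ?_
    split_ifs <;> simp
  | app f s ih =>
    simp only [rename, occ, ih]
    rw [Finset.sum_comm]
    refine Finset.sum_congr rfl fun x _ => ?_
    split_ifs <;> simp

theorem occ_rename_of_injective {n m : ℕ} (s : Tm R n) {ρ : Fin n → Fin m}
    (hρ : Function.Injective ρ) (x : Fin n) : (s.rename ρ).occ (ρ x) = s.occ x := by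
  simp [occ_rename, hρ.eq_iff]

theorem occ_rename_of_notMem {n m : ℕ} (s : Tm R n) {ρ : Fin n → Fin m} {y : Fin m}
    (hy : ∀ x, ρ x ≠ y) : (s.rename ρ).occ y = 0 := by
  simp [occ_rename, hy]

@[simp] theorem occ_rename_castAdd {n k : ℕ} (s : Tm R n) (x : Fin n) :
    (s.rename (Fin.castAdd k)).occ (Fin.castAdd k x) = s.occ x :=
  occ_rename_of_injective s (Fin.castAdd_injective n k) x

@[simp] theorem occ_rename_castAdd_natAdd {n k : ℕ} (s : Tm R n) (j : Fin k) :
    (s.rename (Fin.castAdd k)).occ (Fin.natAdd n j) = 0 :=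
  occ_rename_of_notMem s fun _ => castAdd_ne_natAdd _ _

@[simp] theorem occ_rename_liftRen_natAdd {n m k : ℕ} (s : Tm R (n + k)) (ρ : Fin n → Fin m)
    (j : Fin k) : (s.rename (liftRen k ρ)).occ (Fin.natAdd m j) = s.occ (Fin.natAdd n j) := by
  simp [occ_rename, Fin.sum_univ_add]

theorem occ_subst {n m : ℕ} (s : Tm R n) (θ : Fin n → Tm R m) (y : Fin m) :
    (s.subst θ).occ y = ∑ x, s.occ x * (θ x).occ y := by
  induction s generalizing m with
  | var i => simp [subst, occ]
  | list s ih =>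
    simp only [subst, occ, ih]
    rw [Finset.sum_comm]
    simp [Finset.sum_mul]
  | sub a s t ihs iht =>
    simp only [subst, occ, ihs, iht, Fin.sum_univ_add]
    simp [occ, ← Finset.sum_add_distrib, add_mul]
  | app f s ih =>
    simp only [subst, occ, ih]
    rw [Finset.sum_comm]
    simp [Finset.sum_mul]

@[simp] theorem occ_subst_liftSubst_natAdd {n m k : ℕ} (s : Tm R (n + k)) (θ : Fin n → Tm R m)
    (j : Fin k) : (s.subst (liftSubst k θ)).occ (Fin.natAdd m j) = s.occ (Fin.natAdd n j) := by
  simp [occ_subst, Fin.sum_univ_add, occ]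

/-- Substitution only depends on the terms substituted for variables that occur. -/
theorem subst_congr {n m : ℕ} (s : Tm R n) {θ θ' : Fin n → Tm R m}
    (h : ∀ x, s.occ x ≠ 0 → θ x = θ' x) : s.subst θ = s.subst θ' := by
  induction s generalizing m with
  | var i => exact h i (by simp [occ])
  | list s ih =>
    simp only [subst]
    congr 1
    funext i
    refine ih i fun x hx => h x fun h0 => hx ?_
    exact Finset.sum_eq_zero_iff.1 h0 i (Finset.mem_univ i)
  | sub a s t ihs iht =>
    simp only [subst]
    congr 1
    · apply ihs
      refine Fin.addCases (fun x hx => ?_) (fun j _ => ?_)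
      · simp only [liftSubst_castAdd]
        rw [h x (by simp only [occ]; omega)]
      · simp
    · exact iht fun x hx => h x (by simp only [occ]; omega)
  | app f s ih =>
    simp only [subst]
    congr 1
    funext i
    refine ih i fun x hx => h x fun h0 => hx ?_
    exact Finset.sum_eq_zero_iff.1 h0 i (Finset.mem_univ i)

/-! ### Substitution in the last variables -/

theorem subst_append_rename_castAdd {n m k : ℕ} (s : Tm R n) (θ : Fin n → Tm R m)
    (t : Fin k → Tm R m) :
    (s.rename (Fin.castAdd k)).subst (Fin.append θ t) = s.subst θ := by
  rw [subst_rename]; simp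

theorem subst_liftSubst_append {n m k l : ℕ} (s : Tm R (n + k)) (θ : Fin n → Tm R m)
    (θ' : Fin m → Tm R l) (t : Fin k → Tm R l) :
    (s.subst (liftSubst k θ)).subst (Fin.append θ' t) =
      s.subst (Fin.append (fun x => (θ x).subst θ') t) := by
  rw [subst_subst]
  congr 1
  apply funext_append
  · intro x; simp [subst_append_rename_castAdd]
  · intro j; simp [subst]

theorem subst_append_subst {n m k l : ℕ} (s : Tm R (n + k)) (θ : Fin n → Tm R m)
    (t : Fin k → Tm R m) (θ' : Fin m → Tm R l) :
    (s.subst (Fin.append θ t)).subst θ' =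
      s.subst (Fin.append (fun x => (θ x).subst θ') (fun j => (t j).subst θ')) := by
  rw [subst_subst]
  congr 1
  apply funext_append <;> simp

end Tm

/-! ### Typing with a total environment -/

/-- Linear typing with respect to an environment `A` that gives a type to every variable of the
scope. A bound variable has to occur exactly once; free variables may occur any number of times. -/
inductive HasTy : {n : ℕ} → (Fin n → Ty R.Atom) → Tm R n → Ty R.Atom → Prop
  | var {n : ℕ} (A : Fin n → Ty R.Atom) (x : Fin n) : HasTy A (Tm.var x) (A x)
  | list {n k : ℕ} (A : Fin n → Ty R.Atom) (s : Fin k → Tm R n) (a : Fin k → Ty R.Atom) :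
      (∀ i, HasTy A (s i) (a i)) → HasTy A (Tm.list s) (Ty.tensor a)
  | sub {n k : ℕ} (A : Fin n → Ty R.Atom) (a : Fin k → Ty R.Atom) (s : Tm R (n + k))
      (t : Tm R n) (b : Ty R.Atom) :
      HasTy (Fin.append A a) s b → (∀ j, s.occ (Fin.natAdd n j) = 1) → HasTy A t (Ty.tensor a) →
      HasTy A (Tm.sub a s t) b
  | app {n k : ℕ} (A : Fin n → Ty R.Atom) (a : Fin k → Ty R.Atom) (b : Ty R.Atom)
      (f : R.Hom a b) (s : Fin k → Tm R n) :
      (∀ i, HasTy A (s i) (a i)) → HasTy A (Tm.app f s) b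

theorem HasTy.var' {n : ℕ} {A : Fin n → Ty R.Atom} {x : Fin n} {a : Ty R.Atom} (h : A x = a) :
    HasTy A (Tm.var x) a := h ▸ HasTy.var A x

theorem HasTy.unique {n : ℕ} {A : Fin n → Ty R.Atom} {s : Tm R n} {b b' : Ty R.Atom}
    (h : HasTy A s b) (h' : HasTy A s b') : b = b' := by
  induction h generalizing b' with
  | var A x => cases h'; rfl
  | list A s a _ ih =>
    cases h' with
    | list _ _ a' h' =>
      congr 1
      funext i
      exact ih i (h' i)
  | sub A a s t b _ _ _ ihs _ =>
    cases h' with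
    | sub _ _ _ _ _ hs _ _ => exact ihs hs
  | app A a b f s _ _ => cases h'; rfl

theorem HasTy.rename {n m : ℕ} {A : Fin n → Ty R.Atom} {s : Tm R n} {b : Ty R.Atom}
    (h : HasTy A s b) (ρ : Fin n → Fin m) {B : Fin m → Ty R.Atom} (hB : ∀ x, B (ρ x) = A x) :
    HasTy B (s.rename ρ) b := by
  induction h generalizing m with
  | var A x => exact HasTy.var' (hB x)
  | list A s a _ ih => exact HasTy.list _ _ _ fun i => ih i ρ hB
  | sub A a s t b _ ho _ ihs iht =>
    refine HasTy.sub _ _ _ _ _ (ihs _ (Fin.addCases ?_ ?_)) (by simpa using ho) (iht ρ hB) <;>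
      simp [hB]
  | app A a b f s _ ih => exact HasTy.app _ _ _ _ _ fun i => ih i ρ hB

theorem HasTy.weaken {n k : ℕ} {A : Fin n → Ty R.Atom} {s : Tm R n} {b : Ty R.Atom}
    (h : HasTy A s b) (a : Fin k → Ty R.Atom) :
    HasTy (Fin.append A a) (s.rename (Fin.castAdd k)) b :=
  h.rename _ (by simp)

theorem HasTy.liftSubst {n m k : ℕ} {A : Fin n → Ty R.Atom} {B : Fin m → Ty R.Atom}
    {θ : Fin n → Tm R m} (hθ : ∀ x, HasTy B (θ x) (A x)) (a : Fin k → Ty R.Atom) :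
    ∀ x, HasTy (Fin.append B a) (Tm.liftSubst k θ x) (Fin.append A a x) :=
  Fin.addCases (fun x => by simpa using (hθ x).weaken a)
    (fun j => by simpa using HasTy.var' (by simp))

theorem HasTy.subst {n m : ℕ} {A : Fin n → Ty R.Atom} {s : Tm R n} {b : Ty R.Atom}
    (h : HasTy A s b) {θ : Fin n → Tm R m} {B : Fin m → Ty R.Atom}
    (hθ : ∀ x, HasTy B (θ x) (A x)) : HasTy B (s.subst θ) b := by
  induction h generalizing m with
  | var A x => exact hθ x
  | list A s a _ ih => exact HasTy.list _ _ _ fun i => ih i hθ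
  | sub A a s t b _ ho _ ihs iht =>
    exact HasTy.sub _ _ _ _ _ (ihs (HasTy.liftSubst hθ a)) (by simpa using ho) (iht hθ)
  | app A a b f s _ ih => exact HasTy.app _ _ _ _ _ fun i => ih i hθ

theorem HasTy.append {n m k : ℕ} {A : Fin n → Ty R.Atom} {a : Fin k → Ty R.Atom}
    {B : Fin m → Ty R.Atom} {θ : Fin n → Tm R m} {t : Fin k → Tm R m}
    (hθ : ∀ x, HasTy B (θ x) (A x)) (ht : ∀ j, HasTy B (t j) (a j)) :
    ∀ x, HasTy B (Fin.append θ t x) (Fin.append A a x) :=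
  Fin.addCases (by simpa using hθ) (by simpa using ht)

/-- The list `⟨x₁, …, xₖ⟩` of the last `k` variables has a tensor type. -/
theorem HasTy.list_natAdd {n k : ℕ} (A : Fin n → Ty R.Atom) (a : Fin k → Ty R.Atom) :
    HasTy (Fin.append A a) (Tm.list fun j => Tm.var (Fin.natAdd n j)) (Ty.tensor a) :=
  HasTy.list _ _ _ fun _ => HasTy.var' (by simp)

end Substitution

/-! ### Typed convertibility -/

section Conversion

variable {R : Signature.{u, v}}

theorem Tm.occ_subst_append_var {n k : ℕ} (s : Tm R (n + k)) (t : Fin k → Tm R n) (y : Fin n) :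
    (s.subst (Fin.append Tm.var t)).occ y =
      s.occ (Fin.castAdd k y) + ∑ j, s.occ (Fin.natAdd n j) * (t j).occ y := by
  simp [Tm.occ_subst, Fin.sum_univ_add, Tm.occ]

/-- The substitution of the list `⟨x₁, …, xₖ⟩` of `k` new variables for the last variable. -/
def unpack {R : Signature.{u, v}} (n k : ℕ) : Fin (n + 1) → Tm R (n + k) :=
  Fin.append (fun x => Tm.var (Fin.castAdd k x))
    (fun _ => Tm.list fun j => Tm.var (Fin.natAdd n j))

@[simp] theorem unpack_castAdd (n k : ℕ) (x : Fin n) :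
    unpack (R := R) n k (Fin.castAdd 1 x) = Tm.var (Fin.castAdd k x) := by
  simp [unpack]

@[simp] theorem unpack_natAdd (n k : ℕ) (j : Fin 1) :
    unpack (R := R) n k (Fin.natAdd n j) = Tm.list fun j => Tm.var (Fin.natAdd n j) := by
  simp [unpack]

/-- Convertibility of typed terms. Besides the congruence rules there are `beta`, for explicit
substitutions of a literal list, and `expand`, which says that a term linear in a variable `z` of
tensor type is determined by its value at `z = ⟨x₁, …, xₖ⟩`. Together they yield `η` and all the
structural rules. -/
inductive Conv : {n : ℕ} → (Fin n → Ty R.Atom) → Ty R.Atom → Tm R n → Tm R n → Prop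
  | refl {n : ℕ} {A : Fin n → Ty R.Atom} {b : Ty R.Atom} {s : Tm R n} :
      HasTy A s b → Conv A b s s
  | symm {n : ℕ} {A : Fin n → Ty R.Atom} {b : Ty R.Atom} {s s' : Tm R n} :
      Conv A b s s' → Conv A b s' s
  | trans {n : ℕ} {A : Fin n → Ty R.Atom} {b : Ty R.Atom} {s s' s'' : Tm R n} :
      Conv A b s s' → Conv A b s' s'' → Conv A b s s''
  | list {n k : ℕ} {A : Fin n → Ty R.Atom} {a : Fin k → Ty R.Atom} {s s' : Fin k → Tm R n} :
      (∀ i, Conv A (a i) (s i) (s' i)) → Conv A (Ty.tensor a) (Tm.list s) (Tm.list s')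
  | app {n k : ℕ} {A : Fin n → Ty R.Atom} {a : Fin k → Ty R.Atom} {b : Ty R.Atom}
      {s s' : Fin k → Tm R n} (f : R.Hom a b) :
      (∀ i, Conv A (a i) (s i) (s' i)) → Conv A b (Tm.app f s) (Tm.app f s')
  | sub {n k : ℕ} {A : Fin n → Ty R.Atom} {a : Fin k → Ty R.Atom} {b : Ty R.Atom}
      {s s' : Tm R (n + k)} {t t' : Tm R n} :
      Conv (Fin.append A a) b s s' → (∀ j, s.occ (Fin.natAdd n j) = 1) →
      Conv A (Ty.tensor a) t t' → Conv A b (Tm.sub a s t) (Tm.sub a s' t')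
  | beta {n k : ℕ} {A : Fin n → Ty R.Atom} {a : Fin k → Ty R.Atom} {b : Ty R.Atom}
      {s : Tm R (n + k)} {t : Fin k → Tm R n} :
      HasTy (Fin.append A a) s b → (∀ j, s.occ (Fin.natAdd n j) = 1) →
      (∀ i, HasTy A (t i) (a i)) →
      Conv A b (Tm.sub a s (Tm.list t)) (s.subst (Fin.append Tm.var t))
  | expand {n k : ℕ} {A : Fin n → Ty R.Atom} {a : Fin k → Ty R.Atom} {b : Ty R.Atom}
      {s : Tm R (n + 1)} {t : Tm R n} :
      HasTy (Fin.append A fun _ : Fin 1 => Ty.tensor a) s b → s.occ (Fin.natAdd n 0) = 1 →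
      HasTy A t (Ty.tensor a) →
      Conv A b (s.subst (Fin.append Tm.var fun _ => t)) (Tm.sub a (s.subst (unpack n k)) t)

theorem HasTy.unpack {n k : ℕ} (A : Fin n → Ty R.Atom) (a : Fin k → Ty R.Atom) :
    ∀ x, HasTy (Fin.append A a) (RepCalc.unpack n k x)
      (Fin.append A (fun _ : Fin 1 => Ty.tensor a) x) :=
  HasTy.append (fun _ => HasTy.var' (by simp)) fun _ => HasTy.list_natAdd A a

theorem occ_subst_unpack_natAdd {n k : ℕ} (s : Tm R (n + 1)) (j : Fin k) :
    (s.subst (unpack n k)).occ (Fin.natAdd n j) = s.occ (Fin.natAdd n 0) := by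
  simp [Tm.occ_subst, Fin.sum_univ_add, Tm.occ]

theorem occ_subst_unpack_castAdd {n k : ℕ} (s : Tm R (n + 1)) (x : Fin n) :
    (s.subst (unpack n k)).occ (Fin.castAdd k x) = s.occ (Fin.castAdd 1 x) := by
  simp [Tm.occ_subst, Fin.sum_univ_add, Tm.occ]

/-- Convertible terms have the same type and the same number of occurrences of every variable; the
latter makes linearity of bound variables stable under conversion. -/
theorem Conv.spec {n : ℕ} {A : Fin n → Ty R.Atom} {b : Ty R.Atom} {s s' : Tm R n}
    (h : Conv A b s s') : HasTy A s b ∧ HasTy A s' b ∧ s.occ = s'.occ := by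
  induction h with
  | refl h => exact ⟨h, h, rfl⟩
  | symm _ ih => exact ⟨ih.2.1, ih.1, ih.2.2.symm⟩
  | trans _ _ ih ih' => exact ⟨ih.1, ih'.2.1, ih.2.2.trans ih'.2.2⟩
  | list _ ih =>
    refine ⟨HasTy.list _ _ _ fun i => (ih i).1, HasTy.list _ _ _ fun i => (ih i).2.1, ?_⟩
    funext x
    simp [Tm.occ, fun i => (ih i).2.2]
  | app f _ ih =>
    refine ⟨HasTy.app _ _ _ _ _ fun i => (ih i).1, HasTy.app _ _ _ _ _ fun i => (ih i).2.1, ?_⟩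
    funext x
    simp [Tm.occ, fun i => (ih i).2.2]
  | sub _ ho _ ihs iht =>
    refine ⟨HasTy.sub _ _ _ _ _ ihs.1 ho iht.1,
      HasTy.sub _ _ _ _ _ ihs.2.1 (by simpa [← ihs.2.2] using ho) iht.2.1, ?_⟩
    funext x
    simp [Tm.occ, ihs.2.2, iht.2.2]
  | beta hs ho ht =>
    refine ⟨HasTy.sub _ _ _ _ _ hs ho (HasTy.list _ _ _ ht),
      hs.subst (HasTy.append (HasTy.var _) ht), ?_⟩
    funext x
    simp [Tm.occ_subst_append_var, Tm.occ, ho]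
  | expand hs ho ht =>
    refine ⟨hs.subst (HasTy.append (HasTy.var _) fun _ => ht),
      HasTy.sub _ _ _ _ _ (hs.subst (HasTy.unpack _ _)) ?_ ht, ?_⟩
    · intro j; rw [occ_subst_unpack_natAdd, ho]
    · funext x
      simp [Tm.occ_subst_append_var, Tm.occ, ho, occ_subst_unpack_castAdd]

theorem Conv.left {n : ℕ} {A : Fin n → Ty R.Atom} {b : Ty R.Atom} {s s' : Tm R n}
    (h : Conv A b s s') : HasTy A s b := h.spec.1

theorem Conv.right {n : ℕ} {A : Fin n → Ty R.Atom} {b : Ty R.Atom} {s s' : Tm R n}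
    (h : Conv A b s s') : HasTy A s' b := h.spec.2.1

theorem Conv.occ_eq {n : ℕ} {A : Fin n → Ty R.Atom} {b : Ty R.Atom} {s s' : Tm R n}
    (h : Conv A b s s') : s.occ = s'.occ := h.spec.2.2

theorem Conv.subst {n m : ℕ} {A : Fin n → Ty R.Atom} {b : Ty R.Atom} {s s' : Tm R n}
    (h : Conv A b s s') {B : Fin m → Ty R.Atom} {θ : Fin n → Tm R m}
    (hθ : ∀ x, HasTy B (θ x) (A x)) : Conv B b (s.subst θ) (s'.subst θ) := by
  induction h generalizing m with
  | refl h => exact Conv.refl (h.subst hθ)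
  | symm _ ih => exact (ih hθ).symm
  | trans _ _ ih ih' => exact (ih hθ).trans (ih' hθ)
  | list _ ih => exact Conv.list fun i => ih i hθ
  | app f _ ih => exact Conv.app f fun i => ih i hθ
  | sub _ ho _ ihs iht =>
    exact Conv.sub (ihs (HasTy.liftSubst hθ _)) (by simpa using ho) (iht hθ)
  | @beta n k A a b s t hs ho ht =>
    have := Conv.beta (hs.subst (HasTy.liftSubst hθ a)) (by simpa using ho)
      fun i => (ht i).subst hθ
    rw [Tm.subst_liftSubst_append] at this
    rw [Tm.subst_append_subst]
    simpa [Tm.subst] using this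
  | @expand n k A a b s t hs ho ht =>
    have := Conv.expand (hs.subst (HasTy.liftSubst hθ _)) (by simpa using ho) (ht.subst hθ)
    rw [Tm.subst_liftSubst_append] at this
    rw [Tm.subst_append_subst]
    convert this using 1
    · simp [Tm.subst]
    · simp only [Tm.subst]
      congr 1
      rw [unpack, Tm.subst_append_subst, unpack, Tm.subst_liftSubst_append]
      congr 1
      apply funext_append <;> simp [Tm.subst, Tm.rename_eq_subst]

theorem HasTy.subst_conv {n m : ℕ} {A : Fin n → Ty R.Atom} {b : Ty R.Atom} {s : Tm R n}
    (h : HasTy A s b) {B : Fin m → Ty R.Atom} {θ θ' : Fin n → Tm R m}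
    (hθ : ∀ x, Conv B (A x) (θ x) (θ' x)) : Conv B b (s.subst θ) (s.subst θ') := by
  induction h generalizing m with
  | var A x => exact hθ x
  | list A s a _ ih => exact Conv.list fun i => ih i hθ
  | app A a b f s _ ih => exact Conv.app f fun i => ih i hθ
  | @sub n k A a s t b hs ho ht ihs iht =>
    refine Conv.sub (ihs (Fin.addCases (fun x => ?_) fun j => ?_)) (by simpa using ho) (iht hθ)
    · simp only [Tm.liftSubst_castAdd, Tm.rename_eq_subst, Fin.append_left]
      exact (hθ x).subst fun y => HasTy.var' (by simp)
    · simp only [Tm.liftSubst_natAdd, Fin.append_right]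
      exact Conv.refl (HasTy.var' (by simp))

theorem Conv.subst_conv {n m : ℕ} {A : Fin n → Ty R.Atom} {b : Ty R.Atom} {s s' : Tm R n}
    (h : Conv A b s s') {B : Fin m → Ty R.Atom} {θ θ' : Fin n → Tm R m}
    (hθ : ∀ x, Conv B (A x) (θ x) (θ' x)) : Conv B b (s.subst θ) (s'.subst θ') :=
  (h.subst fun x => (hθ x).left).trans (h.right.subst_conv hθ)

theorem Conv.rename {n m : ℕ} {A : Fin n → Ty R.Atom} {b : Ty R.Atom} {s s' : Tm R n}
    (h : Conv A b s s') (ρ : Fin n → Fin m) {B : Fin m → Ty R.Atom}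
    (hB : ∀ x, B (ρ x) = A x) : Conv B b (s.rename ρ) (s'.rename ρ) := by
  rw [Tm.rename_eq_subst, Tm.rename_eq_subst]
  exact h.subst fun x => HasTy.var' (hB x)

/-! ### Structural rules for one layer -/

/-- The `η`-rule. -/
theorem Conv.eta {n k : ℕ} {A : Fin n → Ty R.Atom} {a : Fin k → Ty R.Atom} {t : Tm R n}
    (ht : HasTy A t (Ty.tensor a)) :
    Conv A (Ty.tensor a) t (Tm.sub a (Tm.list fun j => Tm.var (Fin.natAdd n j)) t) := by
  have := Conv.expand (s := Tm.var (Fin.natAdd n 0)) (b := Ty.tensor a)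
    (HasTy.var' (by simp)) (by simp [Tm.occ]) ht
  simpa [Tm.subst] using this

/-- To move an explicit substitution outwards, it suffices to find a term `P` that is linear in a
new variable `z`, has the value `l` for `z = t`, and whose value for `z = ⟨x₁, …, xₖ⟩` is
convertible to the body `r`. -/
theorem Conv.sub_of_expand {n k : ℕ} {A : Fin n → Ty R.Atom} {a : Fin k → Ty R.Atom}
    {b : Ty R.Atom} {l t : Tm R n} {r : Tm R (n + k)} (P : Tm R (n + 1))
    (hP : HasTy (Fin.append A fun _ : Fin 1 => Ty.tensor a) P b)
    (ho : P.occ (Fin.natAdd n 0) = 1) (ht : HasTy A t (Ty.tensor a))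
    (hl : P.subst (Fin.append Tm.var fun _ => t) = l)
    (hr : Conv (Fin.append A a) b (P.subst (unpack n k)) r) :
    Conv A b l (Tm.sub a r t) := by
  have := Conv.expand hP ho ht
  rw [hl] at this
  refine this.trans (Conv.sub hr ?_ (Conv.refl ht))
  intro j; rw [occ_subst_unpack_natAdd, ho]

/-- The renaming that inserts one variable below `k` bound variables. -/
abbrev ins (n k : ℕ) : Fin (n + k) → Fin (n + 1 + k) := liftRen k (Fin.castAdd 1)

theorem HasTy.rename_ins {n k : ℕ} {A : Fin n → Ty R.Atom} {a : Fin k → Ty R.Atom}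
    {s : Tm R (n + k)} {b : Ty R.Atom} (hs : HasTy (Fin.append A a) s b)
    {l : ℕ} (c : Fin l → Ty R.Atom) :
    HasTy (Fin.append (Fin.append A c) a) (s.rename (liftRen k (Fin.castAdd l))) b :=
  hs.rename _ (Fin.addCases (by simp) (by simp))

/-- The term `s[x⃗ := z]`, for a new variable `z`. -/
def subVar {n k : ℕ} (a : Fin k → Ty R.Atom) (s : Tm R (n + k)) : Tm R (n + 1) :=
  Tm.sub a (s.rename (ins n k)) (Tm.var (Fin.natAdd n 0))

theorem HasTy.subVar {n k : ℕ} {A : Fin n → Ty R.Atom} {a : Fin k → Ty R.Atom}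
    {s : Tm R (n + k)} {b : Ty R.Atom} (hs : HasTy (Fin.append A a) s b)
    (ho : ∀ j, s.occ (Fin.natAdd n j) = 1) :
    HasTy (Fin.append A fun _ : Fin 1 => Ty.tensor a) (RepCalc.subVar a s) b :=
  HasTy.sub _ _ _ _ _ (hs.rename_ins _) (by simpa using ho) (HasTy.var' (by simp))

theorem subVar_subst {n k : ℕ} (a : Fin k → Ty R.Atom) (s : Tm R (n + k)) (t : Tm R n) :
    (subVar a s).subst (Fin.append Tm.var fun _ => t) = Tm.sub a s t := by
  simp only [subVar, Tm.subst, Tm.subst_rename, Fin.append_right]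
  congr 1
  conv_rhs => rw [← Tm.subst_var s]
  congr 1
  apply funext_append <;> simp [Tm.rename]

/-- The term `s[x⃗ := z]` is a term linear in `z` with value `s` at `z = ⟨x₁, …, xₖ⟩`. It serves to
apply `Conv.sub_of_expand`. -/
theorem subVar_unpack {n k : ℕ} {A : Fin n → Ty R.Atom} {a : Fin k → Ty R.Atom}
    {s : Tm R (n + k)} {b : Ty R.Atom} (hs : HasTy (Fin.append A a) s b)
    (ho : ∀ j, s.occ (Fin.natAdd n j) = 1) :
    Conv (Fin.append A a) b ((subVar a s).subst (unpack n k)) s := by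
  have h1 : (subVar a s).subst (unpack n k) =
      Tm.sub a (s.rename (liftRen k (Fin.castAdd k)))
        (Tm.list fun j => Tm.var (Fin.natAdd n j)) := by
    simp only [subVar, Tm.subst, Tm.subst_rename, unpack_natAdd]
    rw [Tm.rename_eq_subst]
    congr 2
    apply funext_append <;> simp [Tm.rename]
  rw [h1]
  have := Conv.beta (hs.rename_ins a) (t := fun j => Tm.var (Fin.natAdd n j)) (by simpa using ho)
    (fun i => HasTy.var' (by simp))
  convert this using 1
  rw [Tm.subst_rename]
  conv_lhs => rw [← Tm.subst_var s]
  congr 1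
  apply funext_append <;> simp

theorem subVar_occ {n k : ℕ} (a : Fin k → Ty R.Atom) (s : Tm R (n + k)) :
    (subVar a s).occ (Fin.natAdd n 0) = 1 := by
  simp only [subVar, Tm.occ, if_true, Nat.add_eq_right]
  apply Tm.occ_rename_of_notMem
  refine Fin.addCases (by simp [Fin.ext_iff]; omega) (fun j => ?_)
  simp

theorem update_subst {n m k : ℕ} (r : Fin k → Tm R n) (i : Fin k) (s : Tm R n)
    (θ : Fin n → Tm R m) :
    (fun j => (Function.update r i s j).subst θ) =
      Function.update (fun j => (r j).subst θ) i (s.subst θ) := by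
  funext j
  by_cases h : j = i
  · subst h; simp
  · simp [h]

theorem HasTy.update {n k : ℕ} {A : Fin n → Ty R.Atom} {a : Fin k → Ty R.Atom}
    {r : Fin k → Tm R n} {i : Fin k} {s s' : Tm R n}
    (h : ∀ j, HasTy A (Function.update r i s j) (a j)) (hs : HasTy A s' (a i)) :
    ∀ j, HasTy A (Function.update r i s' j) (a j) := by
  intro j
  by_cases hj : j = i
  · subst hj; simpa
  · simpa [hj] using h j

theorem HasTy.update_rename {n m k : ℕ} {A : Fin n → Ty R.Atom} {a : Fin k → Ty R.Atom}
    {r : Fin k → Tm R n} {i : Fin k} {s : Tm R n} {B : Fin m → Ty R.Atom} {s' : Tm R m}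
    (h : ∀ j, HasTy A (Function.update r i s j) (a j)) (ρ : Fin n → Fin m)
    (hB : ∀ x, B (ρ x) = A x) (hs : HasTy B s' (a i)) :
    ∀ j, HasTy B (Function.update (fun j => (r j).rename ρ) i s' j) (a j) := by
  intro j
  by_cases hj : j = i
  · subst hj; simpa
  · simpa [hj] using (h j).rename ρ hB

theorem Conv.update {n k : ℕ} {A : Fin n → Ty R.Atom} {a : Fin k → Ty R.Atom}
    {r : Fin k → Tm R n} {i : Fin k} {s s' : Tm R n}
    (h : ∀ j, HasTy A (Function.update r i s j) (a j)) (hs : Conv A (a i) s s') :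
    ∀ j, Conv A (a j) (Function.update r i s j) (Function.update r i s' j) := by
  intro j
  by_cases hj : j = i
  · subst hj; simpa
  · simpa [hj] using Conv.refl (h j)

theorem sum_occ_update_rename {n m k : ℕ} (r : Fin k → Tm R n) (i : Fin k) (s : Tm R m)
    {ρ : Fin n → Fin m} {y : Fin m} (hy : ∀ x, ρ x ≠ y) :
    ∑ j, (Function.update (fun j => (r j).rename ρ) i s j).occ y = s.occ y := by
  rw [Finset.sum_eq_single i]
  · simp
  · intro j _ hj
    simp [hj, Tm.occ_rename_of_notMem _ hy]
  · simp

theorem rename_castAdd_unpack {n k : ℕ} (s : Tm R n) :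
    (s.rename (Fin.castAdd 1)).subst (unpack n k) = s.rename (Fin.castAdd k) := by
  rw [Tm.subst_rename, Tm.rename_eq_subst]; simp

theorem rename_castAdd_append {n : ℕ} (s : Tm R n) (t : Tm R n) :
    (s.rename (Fin.castAdd 1)).subst (Fin.append Tm.var fun _ => t) = s := by
  rw [Tm.subst_append_rename_castAdd, Tm.subst_var]

theorem Conv.struct_list {n k l : ℕ} {A : Fin n → Ty R.Atom} {a : Fin k → Ty R.Atom}
    {c : Fin l → Ty R.Atom} {r : Fin l → Tm R n} {i : Fin l} {s : Tm R (n + k)} {t : Tm R n}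
    (h : ∀ j, HasTy A (Function.update r i (Tm.sub a s t) j) (c j)) :
    Conv A (Ty.tensor c) (Tm.list (Function.update r i (Tm.sub a s t)))
      (Tm.sub a (Tm.list (Function.update (fun j => (r j).rename (Fin.castAdd k)) i s)) t) := by
  have hi := h i
  rw [Function.update_self] at hi
  cases hi with
  | sub _ _ _ _ _ hs ho ht =>
    have hP := HasTy.update_rename h (Fin.castAdd 1) (by simp) (hs.subVar ho)
    refine Conv.sub_of_expand
      (Tm.list (Function.update (fun j => (r j).rename (Fin.castAdd 1)) i (subVar a s)))
      (HasTy.list _ _ _ hP) ?_ ht ?_ ?_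
    · simp [Tm.occ, sum_occ_update_rename, subVar_occ]
    · simp [Tm.subst, update_subst, rename_castAdd_append, subVar_subst]
    · simp only [Tm.subst]
      simp only [update_subst, rename_castAdd_unpack]
      refine Conv.list (Conv.update ?_ (subVar_unpack hs ho))
      intro j
      have := (hP j).subst (HasTy.unpack A a)
      rw [congrFun (update_subst _ i _ (unpack n k)) j] at this
      simpa only [rename_castAdd_unpack] using this

theorem Conv.struct_app {n k l : ℕ} {A : Fin n → Ty R.Atom} {a : Fin k → Ty R.Atom}
    {c : Fin l → Ty R.Atom} {b : Ty R.Atom} (f : R.Hom c b) {r : Fin l → Tm R n} {i : Fin l}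
    {s : Tm R (n + k)} {t : Tm R n}
    (h : ∀ j, HasTy A (Function.update r i (Tm.sub a s t) j) (c j)) :
    Conv A b (Tm.app f (Function.update r i (Tm.sub a s t)))
      (Tm.sub a (Tm.app f (Function.update (fun j => (r j).rename (Fin.castAdd k)) i s)) t) := by
  have hi := h i
  rw [Function.update_self] at hi
  cases hi with
  | sub _ _ _ _ _ hs ho ht =>
    have hP := HasTy.update_rename h (Fin.castAdd 1) (by simp) (hs.subVar ho)
    refine Conv.sub_of_expand
      (Tm.app f (Function.update (fun j => (r j).rename (Fin.castAdd 1)) i (subVar a s)))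
      (HasTy.app _ _ _ _ _ hP) ?_ ht ?_ ?_
    · simp [Tm.occ, sum_occ_update_rename, subVar_occ]
    · simp [Tm.subst, update_subst, rename_castAdd_append, subVar_subst]
    · simp only [Tm.subst]
      simp only [update_subst, rename_castAdd_unpack]
      refine Conv.app f (Conv.update ?_ (subVar_unpack hs ho))
      intro j
      have := (hP j).subst (HasTy.unpack A a)
      rw [congrFun (update_subst _ i _ (unpack n k)) j] at this
      simpa only [rename_castAdd_unpack] using this

theorem Conv.struct_subR {n k l : ℕ} {A : Fin n → Ty R.Atom} {a : Fin k → Ty R.Atom}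
    {c : Fin l → Ty R.Atom} {b : Ty R.Atom} {r : Tm R (n + l)} {s : Tm R (n + k)} {t : Tm R n}
    (hr : HasTy (Fin.append A c) r b) (hro : ∀ j, r.occ (Fin.natAdd n j) = 1)
    (h : HasTy A (Tm.sub a s t) (Ty.tensor c)) :
    Conv A b (Tm.sub c r (Tm.sub a s t))
      (Tm.sub a (Tm.sub c (r.rename (liftRen l (Fin.castAdd k))) s) t) := by
  cases h with
  | sub _ _ _ _ _ hs ho ht =>
    refine Conv.sub_of_expand (Tm.sub c (r.rename (ins n l)) (subVar a s))
      (HasTy.sub _ _ _ _ _ (hr.rename_ins _) (by simpa using hro) (hs.subVar ho)) ?_ ht ?_ ?_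
    · simp only [Tm.occ, subVar_occ, Nat.add_eq_right]
      apply Tm.occ_rename_of_notMem
      exact Fin.addCases (by simp [Fin.ext_iff]; omega) (by simp)
    · have : (r.rename (ins n l)).subst (Tm.liftSubst l (Fin.append Tm.var fun _ => t)) = r := by
        rw [Tm.subst_rename]
        conv_rhs => rw [← Tm.subst_var r]
        congr 1
        apply funext_append <;> simp [Tm.rename]
      simp [Tm.subst, subVar_subst, this]
    · have : (r.rename (ins n l)).subst (Tm.liftSubst l (unpack n k)) =
          r.rename (liftRen l (Fin.castAdd k)) := by
        rw [Tm.subst_rename, Tm.rename_eq_subst]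
        congr 1
        apply funext_append <;> simp [Tm.rename]
      simp only [Tm.subst, this]
      exact Conv.sub (Conv.refl (hr.rename_ins _)) (by simpa using hro) (subVar_unpack hs ho)

@[simp] theorem exchange_old {n l k : ℕ} (x : Fin n) :
    HoleCtx.exchange n l k (Fin.castAdd k (Fin.castAdd l x)) =
      Fin.castAdd l (Fin.castAdd k x) := by
  simp [HoleCtx.exchange]

@[simp] theorem exchange_left {n l k : ℕ} (x : Fin l) :
    HoleCtx.exchange n l k (Fin.castAdd k (Fin.natAdd n x)) = Fin.natAdd (n + k) x := by
  simp [HoleCtx.exchange]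

@[simp] theorem exchange_right {n l k : ℕ} (x : Fin k) :
    HoleCtx.exchange n l k (Fin.natAdd (n + l) x) = Fin.castAdd l (Fin.natAdd n x) := by
  simp [HoleCtx.exchange]

theorem exchange_exchange {n l k : ℕ} (x : Fin (n + l + k)) :
    HoleCtx.exchange n k l (HoleCtx.exchange n l k x) = x := by
  refine Fin.addCases (fun x => Fin.addCases (fun x => ?_) (fun x => ?_) x) (fun x => ?_) x <;>
    simp

theorem exchange_injective {n l k : ℕ} : Function.Injective (HoleCtx.exchange n l k) :=
  Function.LeftInverse.injective exchange_exchange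

theorem append_exchange {n l k : ℕ} {α : Type*} (A : Fin n → α) (c : Fin l → α)
    (a : Fin k → α) (x : Fin (n + l + k)) :
    Fin.append (Fin.append A a) c (HoleCtx.exchange n l k x) =
      Fin.append (Fin.append A c) a x := by
  refine Fin.addCases (fun x => Fin.addCases (fun x => ?_) (fun x => ?_) x) (fun x => ?_) x <;>
    simp

theorem Conv.struct_subL {n k l : ℕ} {A : Fin n → Ty R.Atom} {a : Fin k → Ty R.Atom}
    {c : Fin l → Ty R.Atom} {b : Ty R.Atom} {s : Tm R (n + l + k)} {t u : Tm R n}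
    (h : HasTy (Fin.append A c) (Tm.sub a s (t.rename (Fin.castAdd l))) b)
    (ho' : ∀ j, (Tm.sub a s (t.rename (Fin.castAdd l))).occ (Fin.natAdd n j) = 1)
    (ht : HasTy A t (Ty.tensor a)) (hu : HasTy A u (Ty.tensor c)) :
    Conv A b (Tm.sub c (Tm.sub a s (t.rename (Fin.castAdd l))) u)
      (Tm.sub a (Tm.sub c (s.rename (HoleCtx.exchange n l k)) (u.rename (Fin.castAdd k))) t) := by
  cases h with
  | sub _ _ _ _ _ hs ho _ =>
    have ho2 : ∀ j, s.occ (Fin.castAdd k (Fin.natAdd n j)) = 1 := by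
      intro j; simpa [Tm.occ] using ho' j
    have hsx : HasTy (Fin.append (Fin.append A a) c) (s.rename (HoleCtx.exchange n l k)) b :=
      hs.rename _ (append_exchange A c a)
    have hso : ∀ j, (s.rename (HoleCtx.exchange n l k)).occ (Fin.natAdd (n + k) j) = 1 := by
      intro j
      rw [← exchange_left, Tm.occ_rename_of_injective _ exchange_injective, ho2]
    have hux : HasTy (Fin.append A a) (u.rename (Fin.castAdd k)) (Ty.tensor c) := hu.weaken a
    -- The term `(s[x⃗ := z])[y⃗ := u]` with a new variable `z`.
    set ρ : Fin (n + l + k) → Fin (n + 1 + l + k) := liftRen k (ins n l)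
    have hP1 : HasTy (Fin.append (Fin.append (Fin.append A fun _ : Fin 1 => Ty.tensor a) c) a)
        (s.rename ρ) b := by
      refine hs.rename _ fun x => ?_
      refine Fin.addCases (fun x => Fin.addCases (fun x => ?_) (fun x => ?_) x)
        (fun x => ?_) x <;> simp [ρ]
    have hP2 : ∀ j, (Tm.sub a (s.rename ρ) (Tm.var (Fin.castAdd l (Fin.natAdd n 0)))).occ
        (Fin.natAdd (n + 1) j) = 1 := by
      intro j
      simp only [Tm.occ, castAdd_ne_natAdd, if_false, add_zero]
      have : Fin.castAdd k (Fin.natAdd (n + 1) j) = ρ (Fin.castAdd k (Fin.natAdd n j)) := by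
        simp [ρ]
      rw [this, Tm.occ_rename_of_injective, ho2]
      intro x y
      refine Fin.addCases (fun x => Fin.addCases (fun x => ?_) (fun x => ?_) x) (fun x => ?_) x <;>
      refine Fin.addCases (fun y => Fin.addCases (fun y => ?_) (fun y => ?_) y) (fun y => ?_) y <;>
      simp [ρ, Fin.ext_iff] <;> omega
    refine Conv.sub_of_expand (Tm.sub c
        (Tm.sub a (s.rename ρ) (Tm.var (Fin.castAdd l (Fin.natAdd n 0))))
        (u.rename (Fin.castAdd 1)))
      (HasTy.sub _ _ _ _ _ (HasTy.sub _ _ _ _ _ hP1 (by simpa [ρ] using ho)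
        (HasTy.var' (by simp))) hP2 (hu.weaken _)) ?_ ht ?_ ?_
    · simp only [Tm.occ, if_true, Tm.occ_rename_castAdd_natAdd, add_zero, Nat.add_eq_right]
      apply Tm.occ_rename_of_notMem
      intro x
      refine Fin.addCases (fun x => Fin.addCases (fun x => ?_) (fun x => ?_) x)
        (fun x => ?_) x <;> simp [ρ, Fin.ext_iff] <;> omega
    · simp only [Tm.subst, rename_castAdd_append, Tm.liftSubst_castAdd, Fin.append_right]
      congr 2
      rw [Tm.subst_rename]
      conv_rhs => rw [← Tm.subst_var s]
      congr 1
      funext x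
      refine Fin.addCases (fun x => Fin.addCases (fun x => ?_) (fun x => ?_) x)
        (fun x => ?_) x <;> simp [ρ, Tm.rename]
    · simp only [Tm.subst, rename_castAdd_unpack, Tm.liftSubst_castAdd, unpack_natAdd, Tm.rename]
      refine Conv.sub ?_ ?_ (Conv.refl hux)
      · rw [Tm.subst_rename]
        have hb : HasTy (Fin.append (Fin.append (Fin.append A a) c) a)
            (s.subst fun x => Tm.liftSubst k (Tm.liftSubst l (unpack n k)) (ρ x)) b := by
          refine hs.subst fun x => ?_
          refine Fin.addCases (fun x => Fin.addCases (fun x => ?_) (fun x => ?_) x)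
            (fun x => ?_) x <;> simp [ρ, Tm.rename] <;> exact HasTy.var' (by simp)
        have := Conv.beta hb (t := fun j => Tm.var (Fin.castAdd l (Fin.natAdd n j))) ?_ ?_
        · convert this using 1
          rw [Tm.rename_eq_subst, Tm.subst_subst]
          congr 1
          funext x
          refine Fin.addCases (fun x => Fin.addCases (fun x => ?_) (fun x => ?_) x)
            (fun x => ?_) x <;> simp [ρ, Tm.rename, Tm.subst]
        · intro j
          rw [← Tm.subst_rename]
          simpa [ρ] using ho j
        · intro i
          exact HasTy.var' (by simp)
      · intro j
        simp only [Tm.occ, castAdd_ne_natAdd, if_false, Finset.sum_const_zero, add_zero]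
        rw [Tm.subst_rename, Tm.occ_subst, Fin.sum_univ_add, Fin.sum_univ_add]
        simp [ρ, Tm.rename, Tm.occ, ho2, ho]

end Conversion

/-! ### Reduction steps are conversions -/

section StepConv

variable {R : Signature.{u, v}}

theorem HasTy.of_rename {n m : ℕ} {s : Tm R n} {ρ : Fin n → Fin m} {B : Fin m → Ty R.Atom}
    {A : Fin n → Ty R.Atom} {b : Ty R.Atom} (h : HasTy B (s.rename ρ) b)
    (hB : ∀ x, B (ρ x) = A x) : HasTy A s b := by
  induction s generalizing m b with
  | var i => cases h; exact HasTy.var' (hB i).symm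
  | list s ih =>
    cases h with
    | list _ _ a h => exact HasTy.list _ _ _ fun i => ih i (h i) hB
  | sub a s t ihs iht =>
    cases h with
    | sub _ _ _ _ _ hs ho ht =>
      exact HasTy.sub _ _ _ _ _ (ihs hs (Fin.addCases (by simp [hB]) (by simp)))
        (by simpa using ho) (iht ht hB)
  | app f s ih =>
    cases h with
    | app _ _ _ _ _ h => exact HasTy.app _ _ _ _ _ fun i => ih i (h i) hB

/-- The term in the hole of a typed term is typed, and can be replaced by a convertible one. -/
theorem HasTy.of_plug {n m : ℕ} (C : HoleCtx R n m) {A : Fin n → Ty R.Atom} {b : Ty R.Atom}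
    {s : Tm R m} (h : HasTy A (C.plug s) b) :
    ∃ (B : Fin m → Ty R.Atom) (b' : Ty R.Atom), (∀ x, B (C.inc x) = A x) ∧ HasTy B s b' ∧
      ∀ s', Conv B b' s s' → Conv A b (C.plug s) (C.plug s') := by
  induction C generalizing b with
  | hole => exact ⟨A, b, fun _ => rfl, h, fun _ h => h⟩
  | list r i C ih =>
    cases h with
    | list _ _ a h =>
      have hi := h i
      rw [Function.update_self] at hi
      obtain ⟨B, b', hB, hs, hc⟩ := ih hi
      exact ⟨B, b', hB, hs, fun s' hs' => Conv.list (Conv.update h (hc s' hs'))⟩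
  | app f r i C ih =>
    cases h with
    | app _ a _ _ _ h =>
      have hi := h i
      rw [Function.update_self] at hi
      obtain ⟨B, b', hB, hs, hc⟩ := ih hi
      exact ⟨B, b', hB, hs, fun s' hs' => Conv.app f (Conv.update h (hc s' hs'))⟩
  | subL a C t ih =>
    cases h with
    | sub _ _ _ _ _ h ho ht =>
      obtain ⟨B, b', hB, hs, hc⟩ := ih h
      exact ⟨B, b', fun x => (hB (Fin.castAdd _ x)).trans (Fin.append_left _ _ x), hs,
        fun s' hs' => Conv.sub (hc s' hs') ho (Conv.refl ht)⟩
  | subR a r C ih =>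
    cases h with
    | sub _ _ _ _ _ h ho ht =>
      obtain ⟨B, b', hB, hs, hc⟩ := ih ht
      exact ⟨B, b', hB, hs, fun s' hs' => Conv.sub (Conv.refl h) ho (hc s' hs')⟩

/-- The structural rule for an arbitrary context, by moving the explicit substitution outwards
through one layer after another. -/
theorem Conv.struct {n m k : ℕ} (C : HoleCtx R n m) {A : Fin n → Ty R.Atom} {b : Ty R.Atom}
    {a : Fin k → Ty R.Atom} {s : Tm R (m + k)} {t : Tm R n}
    (h : HasTy A (C.plug (Tm.sub a s (t.rename C.inc))) b) :
    Conv A b (C.plug (Tm.sub a s (t.rename C.inc))) (Tm.sub a (C.plugFresh k s) t) := by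
  have ht : HasTy A t (Ty.tensor a) := by
    obtain ⟨B, b', hB, hs, -⟩ := HasTy.of_plug C h
    cases hs with
    | sub _ _ _ _ _ _ _ ht => exact ht.of_rename hB
  induction C generalizing b with
  | hole =>
    have : t.rename (HoleCtx.hole (R := R)).inc = t := Tm.rename_id t
    rw [this] at h ⊢
    exact Conv.refl h
  | list r i C ih =>
    cases h with
    | list _ _ c h =>
      have hi := h i
      rw [Function.update_self] at hi
      have hc := ih hi ht
      exact (Conv.list (Conv.update h hc)).trans (Conv.struct_list (HasTy.update h hc.right))
  | app f r i C ih =>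
    cases h with
    | app _ c _ _ _ h =>
      have hi := h i
      rw [Function.update_self] at hi
      have hc := ih hi ht
      exact (Conv.app f (Conv.update h hc)).trans
        (Conv.struct_app f (HasTy.update h hc.right))
  | subL c C u ih =>
    cases h with
    | sub _ _ _ _ _ h ho hu =>
      have e : t.rename (HoleCtx.subL c C u).inc = (t.rename (Fin.castAdd _)).rename C.inc := by
        rw [Tm.rename_rename]; rfl
      rw [e] at h ho ⊢
      have hc := ih h (ht.weaken c)
      refine (Conv.sub hc ho (Conv.refl hu)).trans
        (Conv.struct_subL hc.right (by rwa [← hc.occ_eq]) ht hu)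
  | subR c r C ih =>
    cases h with
    | sub _ _ _ _ _ h ho hu =>
      have hc := ih hu ht
      exact (Conv.sub (Conv.refl h) ho hc).trans (Conv.struct_subR h ho hc.right)

/-- The `β`-rule: the substitution context is first moved outwards by the structural rules. -/
theorem Conv.beta_substCtx {n m k : ℕ} (L : HoleCtx R n m) (hL : L.IsSubstCtx)
    {A : Fin n → Ty R.Atom} {b : Ty R.Atom} {a : Fin k → Ty R.Atom} {s : Tm R (n + k)}
    {t : Fin k → Tm R m} (h : HasTy A (Tm.sub a s (L.plug (Tm.list t))) b) :
    Conv A b (Tm.sub a s (L.plug (Tm.list t)))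
      (L.plug (s.subst (Fin.append (fun x => Tm.var (L.inc x)) t))) := by
  induction L generalizing b with
  | hole =>
    cases h with
    | sub _ _ _ _ _ hs ho ht =>
      cases ht with
      | list _ _ _ ht => exact Conv.beta hs ho ht
  | list => exact hL.elim
  | app => exact hL.elim
  | subR => exact hL.elim
  | subL c L u ih =>
    cases h with
    | sub _ _ _ _ _ hs ho ht =>
      have h1 := Conv.struct_subR hs ho ht
      refine h1.trans ?_
      cases h1.right with
      | sub _ _ _ _ _ hs' ho' hu =>
        have h2 := ih hL hs'
        refine (Conv.sub h2 ho' (Conv.refl hu)).trans ?_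
        have e : (s.rename (liftRen k (Fin.castAdd _))).subst
            (Fin.append (fun x => Tm.var (L.inc x)) t) =
            s.subst (Fin.append (fun x => Tm.var ((HoleCtx.subL c L u).inc x)) t) := by
          rw [Tm.subst_rename]
          congr 1
          apply funext_append
          · intro x; simp [HoleCtx.inc]
          · intro j; simp
        rw [e] at h2 ⊢
        exact Conv.refl (HasTy.sub _ _ _ _ _ h2.right (by rw [← h2.occ_eq]; exact ho') hu)

theorem Step.conv {n : ℕ} {A : Fin n → Ty R.Atom} {b : Ty R.Atom} {s s' : Tm R n}
    (h : Step s s') (hs : HasTy A s b) (hs' : HasTy A s' b) : Conv A b s s' := by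
  cases h with
  | beta C s s' h =>
    obtain ⟨B, b', -, hB, hc⟩ := HasTy.of_plug C hs
    refine hc _ ?_
    cases h with
    | mk a s L t hL => exact Conv.beta_substCtx L hL hB
  | eta E s s' _ h =>
    obtain ⟨B, b', -, hB, hc⟩ := HasTy.of_plug E hs'
    refine (hc _ ?_).symm
    cases h with
    | mk γ a _ _ _ =>
      cases hB with
      | sub _ _ _ _ _ hl _ ht =>
        cases hl.unique (HasTy.list_natAdd B a)
        exact (Conv.eta ht).symm
  | struct D C a s t =>
    obtain ⟨B, b', -, hB, hc⟩ := HasTy.of_plug D hs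
    exact hc _ (Conv.struct C hB)

end StepConv

/-! ### Typing judgments and typing with a total environment -/

section TypedHasTy

variable {R : Signature.{u, v}}

/-- In a typed term, every variable occurs as often as it stands in the context. -/
theorem Typed.hasTy {n N : ℕ} {Δ : Ctx R n N} {s : Tm R n} {b : Ty R.Atom} (h : Typed Δ s b)
    {A : Fin n → Ty R.Atom} (hA : ∀ j, A (Δ j).1 = (Δ j).2) :
    HasTy A s b ∧ ∀ x, s.occ x = ∑ j, if (Δ j).1 = x then 1 else 0 := by
  have key : ∀ {n k N : ℕ} {m : Fin k → ℕ} {γ : (i : Fin k) → Ctx R n (m i)}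
      {σ : (Σ i : Fin k, Fin (m i)) ≃ Fin N} {Δ : Ctx R n N} (_ : ShuffledBy γ σ Δ) (x : Fin n),
      (∑ j, if (Δ j).1 = x then 1 else 0) = ∑ i, ∑ j, if (γ i j).1 = x then 1 else 0 := by
    intro n k N m γ σ Δ h x
    rw [← Equiv.sum_comp σ, Fintype.sum_sigma]
    simp [h.2]
  induction h with
  | var x a Δ h =>
    refine ⟨HasTy.var' (by simpa [h] using hA 0), fun y => ?_⟩
    rw [Fintype.sum_eq_single 0 fun j hj => absurd (Subsingleton.elim j 0) hj]
    simp [Tm.occ, h]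
  | list γ σ Δ s a _ _ hσ ih =>
    have ih' := fun i => ih i (A := A) fun j => by simpa [hσ.2] using hA (σ ⟨i, j⟩)
    refine ⟨HasTy.list _ _ _ fun i => (ih' i).1, fun x => ?_⟩
    rw [key hσ]
    simp only [Tm.occ, fun i => (ih' i).2]
  | app γ σ Δ s a b f _ _ hσ ih =>
    have ih' := fun i => ih i (A := A) fun j => by simpa [hσ.2] using hA (σ ⟨i, j⟩)
    refine ⟨HasTy.app _ _ _ _ _ fun i => (ih' i).1, fun x => ?_⟩
    rw [key hσ]
    simp only [Tm.occ, fun i => (ih' i).2]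
  | sub γ σ Δ a s t b _ _ _ hσ iht ihs =>
    have hA' : ∀ i j, A (γ i j).1 = (γ i j).2 := fun i j => by
      simpa [hσ.2] using hA (σ ⟨i, j⟩)
    obtain ⟨ht, hto⟩ := iht (hA' 1)
    obtain ⟨hs, hso⟩ := ihs (A := Fin.append A a) (by
      refine Fin.addCases (fun x => Fin.addCases (fun x => ?_) (fun x => ?_) x)
        (fun x => ?_) <;> simp [bindCtx, hA'])
    refine ⟨HasTy.sub _ _ _ _ _ hs (fun j => ?_) ht, fun x => ?_⟩
    · rw [hso, Fin.sum_univ_add, Fin.sum_univ_add]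
      simp [bindCtx]
    · rw [key hσ, Fin.sum_univ_three]
      simp only [Tm.occ]
      rw [hso, hto, Fin.sum_univ_add, Fin.sum_univ_add]
      simp [bindCtx]
      ring

/-- Every colouring of a list decomposes it as a shuffle of its monochromatic sublists. -/
theorem exists_shuffle {N k : ℕ} (c : Fin N → Fin k) :
    ∃ (m : Fin k → ℕ) (σ : (Σ i : Fin k, Fin (m i)) ≃ Fin N),
      IsShuffle σ ∧ ∀ i j, c (σ ⟨i, j⟩) = i := by
  let S : Fin k → Finset (Fin N) := fun i => Finset.univ.filter fun p => c p = i
  let f : (Σ i : Fin k, Fin (S i).card) → Fin N := fun q => (S q.1).orderEmbOfFin rfl q.2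
  have hf : ∀ q, c (f q) = q.1 := fun q => by
    exact (Finset.mem_filter.1 ((S q.1).orderEmbOfFin_mem rfl q.2)).2
  have hb : Function.Bijective f := by
    constructor
    · rintro ⟨i, j⟩ ⟨i', j'⟩ h
      have : i = i' := by
        have h1 := hf ⟨i, j⟩
        rw [h, hf] at h1
        exact h1.symm
      subst this
      congr 1
      exact ((S i).orderEmbOfFin rfl).injective h
    · intro p
      have : p ∈ Set.range ((S (c p)).orderEmbOfFin rfl) := by
        rw [Finset.range_orderEmbOfFin]; simp [S]
      obtain ⟨j, hj⟩ := this
      exact ⟨⟨c p, j⟩, hj⟩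
  exact ⟨fun i => (S i).card, Equiv.ofBijective f hb,
    fun i => ((S i).orderEmbOfFin rfl).monotone, fun i j => hf ⟨i, j⟩⟩

/-- The number of positions at which a variable stands in a context, decomposed along a
colouring of the positions. -/
theorem sum_fiber {N k : ℕ} {m : Fin k → ℕ} {n : ℕ}
    (σ : (Σ i : Fin k, Fin (m i)) ≃ Fin N) {c : Fin N → Fin k} (hc : ∀ i j, c (σ ⟨i, j⟩) = i)
    {Δ : Fin N → Fin n} (hΔ : Function.Injective Δ) (i : Fin k) (x : Fin n) :
    (∑ j, if Δ (σ ⟨i, j⟩) = x then 1 else 0) = if ∃ p, Δ p = x ∧ c p = i then 1 else 0 := by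
  split_ifs with h
  · obtain ⟨p, rfl, rfl⟩ := h
    obtain ⟨⟨i, j⟩, rfl⟩ := σ.surjective p
    rw [hc]
    simp [hΔ.eq_iff]
  · refine Finset.sum_eq_zero fun j _ => if_neg fun hj => h ⟨_, hj, hc i j⟩

/-- Splitting the positions of a context according to the subterm in which a variable occurs. -/
theorem exists_split {n N k : ℕ} {Δ : Fin N → Fin n} (hΔ : Function.Injective Δ)
    (o : Fin k → Fin n → ℕ)
    (ho : ∀ x, ∑ i, o i x = ∑ j, if Δ j = x then 1 else 0) :
    ∃ (m : Fin k → ℕ) (σ : (Σ i : Fin k, Fin (m i)) ≃ Fin N), IsShuffle σ ∧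
      ∀ i x, o i x = ∑ j, if Δ (σ ⟨i, j⟩) = x then 1 else 0 := by
  have hone : ∀ p, ∃ i, o i (Δ p) = 1 ∧ ∀ i', i' ≠ i → o i' (Δ p) = 0 := by
    intro p
    have h := ho (Δ p)
    simp only [hΔ.eq_iff, Finset.sum_ite_eq', Finset.mem_univ, if_true] at h
    have : ∃ i, o i (Δ p) ≠ 0 := by
      by_contra! h0
      simp [h0] at h
    obtain ⟨i, hi⟩ := this
    have h2 := Finset.add_sum_erase Finset.univ (fun i => o i (Δ p)) (Finset.mem_univ i)
    simp only [h] at h2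
    refine ⟨i, by omega, fun i' hi' => ?_⟩
    have h3 : ∑ x ∈ Finset.univ.erase i, o x (Δ p) = 0 := by omega
    exact Finset.sum_eq_zero_iff.1 h3 i' (by simp [hi'])
  choose c hc1 hc0 using hone
  obtain ⟨m, σ, hσ, hσc⟩ := exists_shuffle c
  refine ⟨m, σ, hσ, fun i x => ?_⟩
  rw [sum_fiber σ hσc hΔ]
  split_ifs with h
  · obtain ⟨p, rfl, rfl⟩ := h
    exact hc1 p
  · by_cases hx : ∃ p, Δ p = x
    · obtain ⟨p, rfl⟩ := hx
      exact hc0 p i fun hi => h ⟨p, rfl, hi.symm⟩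
    · have h := ho x
      rw [Finset.sum_eq_zero (s := Finset.univ) (f := fun j => if Δ j = x then 1 else 0)
        (fun j _ => if_neg fun hj => hx ⟨j, hj⟩)] at h
      exact Finset.sum_eq_zero_iff.1 h i (Finset.mem_univ i)

theorem disjointCtx_of_injective {n N k : ℕ} {m : Fin k → ℕ} {Δ : Fin N → Fin n}
    (hΔ : Function.Injective Δ) (σ : (Σ i : Fin k, Fin (m i)) ≃ Fin N) (A : Fin n → Ty R.Atom) :
    DisjointCtx (R := R) (fun i j => (Δ (σ ⟨i, j⟩), A (Δ (σ ⟨i, j⟩)))) := by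
  intro i i' hi j j' h
  have := σ.injective (hΔ h)
  exact hi (congrArg Sigma.fst this)

/-- The shuffles that a typing derivation requires exist because every variable of the context
occurs in exactly one of the immediate subterms. -/
theorem HasTy.typed {n N : ℕ} {A : Fin n → Ty R.Atom} {s : Tm R n} {b : Ty R.Atom}
    (h : HasTy A s b) {Δ : Fin N → Fin n} (hΔ : Function.Injective Δ)
    (ho : ∀ x, s.occ x = ∑ j, if Δ j = x then 1 else 0) :
    Typed (fun j => (Δ j, A (Δ j))) s b := by
  induction h generalizing N with
  | var A x =>
    have h1 : ∀ j, Δ j = x := by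
      intro j
      by_contra hj
      have h := ho (Δ j)
      rw [Finset.sum_eq_single j] at h
      · simp [Tm.occ, Ne.symm hj] at h
      · intro j' _ hj'
        exact if_neg fun h => hj' (hΔ h)
      · simp
    have h2 := ho x
    simp [Tm.occ, h1] at h2
    subst h2
    exact Typed.var x _ _ (by simp [h1])
  | list A s a _ ih =>
    obtain ⟨m, σ, hσ, h1⟩ := exists_split hΔ (fun i x => (s i).occ x) ho
    exact Typed.list (fun i j => (Δ (σ ⟨i, j⟩), A (Δ (σ ⟨i, j⟩)))) σ _ _ _
      (fun i => ih i (fun j j' h => by simpa using σ.injective (hΔ h)) (h1 i))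
      (disjointCtx_of_injective hΔ σ A) ⟨hσ, fun _ _ => rfl⟩
  | app A a b f s _ ih =>
    obtain ⟨m, σ, hσ, h1⟩ := exists_split hΔ (fun i x => (s i).occ x) ho
    exact Typed.app (fun i j => (Δ (σ ⟨i, j⟩), A (Δ (σ ⟨i, j⟩)))) σ _ _ _ _ f
      (fun i => ih i (fun j j' h => by simpa using σ.injective (hΔ h)) (h1 i))
      (disjointCtx_of_injective hΔ σ A) ⟨hσ, fun _ _ => rfl⟩
  | @sub n k A a s t b _ hb _ ihs iht =>
    obtain ⟨m, σ, hσ, h1⟩ := exists_split hΔ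
      (![fun x => s.occ (Fin.castAdd k x), fun x => t.occ x, fun _ => 0] : Fin 3 → Fin n → ℕ)
      (fun x => by rw [← ho]; simp [Fin.sum_univ_three, Tm.occ])
    have hinj : ∀ i, Function.Injective fun j => Δ (σ ⟨i, j⟩) :=
      fun i j j' h => by simpa using σ.injective (hΔ h)
    have hd := disjointCtx_of_injective (R := R) hΔ σ A
    refine Typed.sub (fun i j => (Δ (σ ⟨i, j⟩), A (Δ (σ ⟨i, j⟩)))) σ _ _ _ _ _
      (iht (hinj 1) (h1 1)) ?_ hd ⟨hσ, fun _ _ => rfl⟩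
    have := ihs (Δ := Fin.append (Fin.append (fun j => Fin.castAdd k (Δ (σ ⟨0, j⟩)))
      (fun j => Fin.natAdd n j)) (fun j => Fin.castAdd k (Δ (σ ⟨2, j⟩)))) ?_ ?_
    · convert this using 1
      funext x
      refine Fin.addCases (fun x => Fin.addCases (fun x => ?_) (fun x => ?_) x)
        (fun x => ?_) x <;> simp [bindCtx]
    · intro x y
      have hd' : ∀ j j', Δ (σ ⟨0, j⟩) ≠ Δ (σ ⟨2, j'⟩) := hd 0 2 (by decide)
      have hd2 : ∀ j j', Δ (σ ⟨2, j'⟩) ≠ Δ (σ ⟨0, j⟩) := fun j j' => (hd' j j').symm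
      refine Fin.addCases (fun x => Fin.addCases (fun x => ?_) (fun x => ?_) x) (fun x => ?_) x <;>
      refine Fin.addCases (fun y => Fin.addCases (fun y => ?_) (fun y => ?_) y)
        (fun y => ?_) y <;> simp [hd', hd2] <;>
        first | exact fun h => hinj 0 h | exact fun h => hinj 2 h
    · have h2 : ∀ x, ∑ j, (if Δ (σ ⟨2, j⟩) = x then 1 else 0) = 0 := fun x => (h1 2 x).symm
      have h0 : ∀ x, s.occ (Fin.castAdd k x) = ∑ j, (if Δ (σ ⟨0, j⟩) = x then 1 else 0) := h1 0
      refine Fin.addCases (fun x => ?_) (fun j => ?_)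
      · rw [h0, Fin.sum_univ_add, Fin.sum_univ_add]
        simpa using h2 x
      · rw [hb, Fin.sum_univ_add, Fin.sum_univ_add]
        simp

/-- Shuffles disappear from the typing judgments: `s` is typed in the context of all variables of
the scope exactly if it is typed with respect to the environment and every variable occurs once. -/
theorem typed_iff {n : ℕ} {a : Fin n → Ty R.Atom} {s : Tm R n} {b : Ty R.Atom} :
    Typed (fun i => (i, a i)) s b ↔ HasTy a s b ∧ ∀ x, s.occ x = 1 := by
  constructor
  · intro h
    have := h.hasTy (A := a) fun _ => rfl
    exact ⟨this.1, fun x => by simpa using this.2 x⟩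
  · rintro ⟨h, ho⟩
    exact h.typed (Δ := id) Function.injective_id (by simpa using ho)

/-- A term in which no variable occurs twice has a typing judgment in the list of the variables
that do occur. -/
theorem HasTy.exists_typed {n : ℕ} {A : Fin n → Ty R.Atom} {s : Tm R n} {b : Ty R.Atom}
    (h : HasTy A s b) (ho : ∀ x, s.occ x ≤ 1) : ∃ (N : ℕ) (γ : Ctx R n N), Typed γ s b := by
  let S : Finset (Fin n) := Finset.univ.filter fun x => s.occ x = 1
  refine ⟨_, _, h.typed (Δ := S.orderEmbOfFin rfl) (S.orderEmbOfFin rfl).injective fun x => ?_⟩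
  by_cases hx : s.occ x = 1
  · have : x ∈ Set.range (S.orderEmbOfFin rfl) := by
      rw [Finset.range_orderEmbOfFin]; simpa [S] using hx
    obtain ⟨j, rfl⟩ := this
    simp [hx]
  · have h0 : s.occ x = 0 := by have := ho x; omega
    rw [h0]
    refine (Finset.sum_eq_zero fun j _ => if_neg fun hj => hx ?_).symm
    have := S.orderEmbOfFin_mem rfl j
    rw [hj] at this
    simpa [S] using this

end TypedHasTy

/-! ### Conversions are chains of reduction steps -/

section ConvStep

variable {R : Signature.{u, v}}

/-- Two terms of the same type are joined if they are connected by reduction steps, in both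
directions, between terms of that type. -/
inductive Joined {n : ℕ} (A : Fin n → Ty R.Atom) (b : Ty R.Atom) : Tm R n → Tm R n → Prop
  | step {s s' : Tm R n} : HasTy A s b → HasTy A s' b → Step s s' → Joined A b s s'
  | refl {s : Tm R n} : HasTy A s b → Joined A b s s
  | symm {s s' : Tm R n} : Joined A b s s' → Joined A b s' s
  | trans {s s' s'' : Tm R n} : Joined A b s s' → Joined A b s' s'' → Joined A b s s''

theorem Joined.conv {n : ℕ} {A : Fin n → Ty R.Atom} {b : Ty R.Atom} {s s' : Tm R n}
    (h : Joined A b s s') : Conv A b s s' := by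
  induction h with
  | step hs hs' h => exact h.conv hs hs'
  | refl h => exact Conv.refl h
  | symm _ ih => exact ih.symm
  | trans _ _ ih ih' => exact ih.trans ih'

theorem Step.list {n k : ℕ} {s s' : Tm R n} (h : Step s s') (r : Fin k → Tm R n) (i : Fin k) :
    Step (Tm.list (Function.update r i s)) (Tm.list (Function.update r i s')) := by
  cases h with
  | beta C s s' h => exact Step.beta (HoleCtx.list r i C) s s' h
  | eta E s s' hE h => exact Step.eta (HoleCtx.list r i E) s s' hE h
  | struct D C a s t => exact Step.struct (HoleCtx.list r i D) C a s t

theorem Step.app {n k : ℕ} {a : Fin k → Ty R.Atom} {b : Ty R.Atom} {s s' : Tm R n}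
    (h : Step s s') (f : R.Hom a b) (r : Fin k → Tm R n) (i : Fin k) :
    Step (Tm.app f (Function.update r i s)) (Tm.app f (Function.update r i s')) := by
  cases h with
  | beta C s s' h => exact Step.beta (HoleCtx.app f r i C) s s' h
  | eta E s s' hE h => exact Step.eta (HoleCtx.app f r i E) s s' hE h
  | struct D C a s t => exact Step.struct (HoleCtx.app f r i D) C a s t

theorem Step.subL {n k : ℕ} {a : Fin k → Ty R.Atom} {s s' : Tm R (n + k)}
    (h : Step s s') (t : Tm R n) : Step (Tm.sub a s t) (Tm.sub a s' t) := by
  cases h with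
  | beta C s s' h => exact Step.beta (HoleCtx.subL a C t) s s' h
  | eta E s s' hE h => exact Step.eta (HoleCtx.subL a E t) s s' hE h
  | struct D C _ s u => exact Step.struct (HoleCtx.subL a D t) C _ s u

theorem Joined.list_update {n k : ℕ} {A : Fin n → Ty R.Atom} {c : Fin k → Ty R.Atom}
    {r : Fin k → Tm R n} {i : Fin k} {s s' : Tm R n} (h : Joined A (c i) s s')
    (hr : ∀ j, HasTy A (Function.update r i s j) (c j)) :
    Joined A (Ty.tensor c) (Tm.list (Function.update r i s))
      (Tm.list (Function.update r i s')) := by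
  have hr' : ∀ u, HasTy A u (c i) → ∀ j, HasTy A (Function.update r i u j) (c j) :=
    fun u hu => HasTy.update hr hu
  clear hr
  induction h with
  | step hs hs' h =>
    exact Joined.step (HasTy.list _ _ _ (hr' _ hs)) (HasTy.list _ _ _ (hr' _ hs')) (h.list r i)
  | refl h => exact Joined.refl (HasTy.list _ _ _ (hr' _ h))
  | symm _ ih => exact ih.symm
  | trans _ _ ih ih' => exact ih.trans ih'

theorem Joined.app_update {n k : ℕ} {A : Fin n → Ty R.Atom} {c : Fin k → Ty R.Atom}
    {b : Ty R.Atom} (f : R.Hom c b) {r : Fin k → Tm R n} {i : Fin k} {s s' : Tm R n}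
    (h : Joined A (c i) s s') (hr : ∀ j, HasTy A (Function.update r i s j) (c j)) :
    Joined A b (Tm.app f (Function.update r i s)) (Tm.app f (Function.update r i s')) := by
  have hr' : ∀ u, HasTy A u (c i) → ∀ j, HasTy A (Function.update r i u j) (c j) :=
    fun u hu => HasTy.update hr hu
  clear hr
  induction h with
  | step hs hs' h =>
    exact Joined.step (HasTy.app _ _ _ _ _ (hr' _ hs)) (HasTy.app _ _ _ _ _ (hr' _ hs'))
      (h.app f r i)
  | refl h => exact Joined.refl (HasTy.app _ _ _ _ _ (hr' _ h))
  | symm _ ih => exact ih.symm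
  | trans _ _ ih ih' => exact ih.trans ih'

/-- A relation between tuples that allows to change one entry at a time allows to change all. -/
theorem rel_of_update {n k : ℕ} {A : Fin n → Ty R.Atom} {c : Fin k → Ty R.Atom} {b : Ty R.Atom}
    (F : (Fin k → Tm R n) → Tm R n) {s s' : Fin k → Tm R n}
    (hs : ∀ i, HasTy A (s i) (c i)) (hs' : ∀ i, HasTy A (s' i) (c i))
    (hF : ∀ r : Fin k → Tm R n, (∀ i, HasTy A (r i) (c i)) → HasTy A (F r) b)
    (h : ∀ (r : Fin k → Tm R n) (i : Fin k), (∀ j, HasTy A (Function.update r i (s i) j) (c j)) →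
      Joined A b (F (Function.update r i (s i))) (F (Function.update r i (s' i)))) :
    Joined A b (F s) (F s') := by
  have key : ∀ S : Finset (Fin k), Joined A b (F s) (F (S.piecewise s' s)) := by
    intro S
    induction S using Finset.induction_on with
    | empty => simpa using Joined.refl (hF s hs)
    | insert i S hi ih =>
      rw [Finset.piecewise_insert]
      refine ih.trans ?_
      have e : S.piecewise s' s = Function.update (S.piecewise s' s) i (s i) := by
        rw [eq_comm, Function.update_eq_self_iff]
        simp [hi]
      conv_lhs => rw [e]
      refine h _ i ?_
      rw [← e]
      intro j
      by_cases hj : j ∈ S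
      · simpa [hj] using hs' j
      · simpa [hj] using hs j
  simpa using key Finset.univ

theorem Joined.list {n k : ℕ} {A : Fin n → Ty R.Atom} {c : Fin k → Ty R.Atom}
    {s s' : Fin k → Tm R n} (h : ∀ i, Joined A (c i) (s i) (s' i)) :
    Joined A (Ty.tensor c) (Tm.list s) (Tm.list s') :=
  rel_of_update Tm.list (fun i => (h i).conv.left) (fun i => (h i).conv.right)
    (fun _ => HasTy.list _ _ _) fun _ i hr => (h i).list_update hr

theorem Joined.app {n k : ℕ} {A : Fin n → Ty R.Atom} {c : Fin k → Ty R.Atom} {b : Ty R.Atom}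
    (f : R.Hom c b) {s s' : Fin k → Tm R n} (h : ∀ i, Joined A (c i) (s i) (s' i)) :
    Joined A b (Tm.app f s) (Tm.app f s') :=
  rel_of_update (Tm.app f) (fun i => (h i).conv.left) (fun i => (h i).conv.right)
    (fun _ => HasTy.app _ _ _ f _) fun _ i hr => (h i).app_update f hr

theorem Joined.subL {n k : ℕ} {A : Fin n → Ty R.Atom} {a : Fin k → Ty R.Atom} {b : Ty R.Atom}
    {s s' : Tm R (n + k)} {t : Tm R n} (h : Joined (Fin.append A a) b s s')
    (ho : ∀ j, s.occ (Fin.natAdd n j) = 1) (ht : HasTy A t (Ty.tensor a)) :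
    Joined A b (Tm.sub a s t) (Tm.sub a s' t) := by
  induction h with
  | step hs hs' h =>
    exact Joined.step (HasTy.sub _ _ _ _ _ hs ho ht)
      (HasTy.sub _ _ _ _ _ hs' (by rwa [← (h.conv hs hs').occ_eq]) ht) (h.subL t)
  | refl h => exact Joined.refl (HasTy.sub _ _ _ _ _ h ho ht)
  | symm h ih => exact (ih (by rwa [h.conv.occ_eq])).symm
  | trans h _ ih ih' => exact (ih ho).trans (ih' (by rwa [← h.conv.occ_eq]))

/-- Steps in the right-hand side of an explicit substitution are steps of the whole term, except for
an `η`-step at the root of the right-hand side. -/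
theorem Joined.subR {n k : ℕ} {A : Fin n → Ty R.Atom} {a : Fin k → Ty R.Atom} {b : Ty R.Atom}
    {q : Tm R (n + k)} {t t' : Tm R n} (hs : HasTy (Fin.append A a) q b)
    (ho : ∀ j, q.occ (Fin.natAdd n j) = 1) (h : Joined A (Ty.tensor a) t t') :
    Joined A b (Tm.sub a q t) (Tm.sub a q t') := by
  induction h with
  | step ht ht' h =>
    have h1 := HasTy.sub _ _ _ _ _ hs ho ht
    have h2 := HasTy.sub _ _ _ _ _ hs ho ht'
    cases h with
    | beta C s s' h => exact Joined.step h1 h2 (Step.beta (HoleCtx.subR a q C) _ _ h)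
    | struct D C _ s t => exact Joined.step h1 h2 (Step.struct (HoleCtx.subR a q D) C _ _ _)
    | eta E s s' hE h =>
      by_cases hh : E.IsHole
      · -- The `η`-step that is excluded as a rule is a `β`-step in the other direction.
        cases E with
        | hole =>
          cases h with
          | mk γ a' _ _ _ =>
            simp only [HoleCtx.plug] at ht ht' h1 h2 ⊢
            cases ht' with
            | sub _ _ _ _ _ hl _ ht1 =>
              cases ht.unique ht1
              refine (Joined.step h2 h1 ?_).symm
              have := Step.beta HoleCtx.hole _ _ (BetaRoot.mk a q (HoleCtx.subL a HoleCtx.hole s)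
                (fun j => Tm.var (Fin.natAdd _ j)) trivial)
              simp only [HoleCtx.plug] at this
              convert this using 2
              conv_lhs => rw [← Tm.subst_var q]
              congr 1
              apply funext_append <;> simp [HoleCtx.inc]
        | list => exact hh.elim
        | subL => exact hh.elim
        | subR => exact hh.elim
        | app => exact hh.elim
      · exact Joined.step h1 h2 (Step.eta (HoleCtx.subR a q E) _ _ ⟨hE, hh⟩ h)
  | refl h => exact Joined.refl (HasTy.sub _ _ _ _ _ hs ho h)
  | symm h ih => exact ih.symm
  | trans h _ ih ih' => exact ih.trans ih'

/-- The term in the hole of a typed term is typed, and can be replaced by a joined one. For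
`η`-steps this includes the holes that the reduction excludes, by `Joined.subR`. -/
theorem HasTy.joined_plug {n m : ℕ} (C : HoleCtx R n m) {A : Fin n → Ty R.Atom} {b : Ty R.Atom}
    {s : Tm R m} (h : HasTy A (C.plug s) b) :
    ∃ (B : Fin m → Ty R.Atom) (b' : Ty R.Atom), (∀ x, B (C.inc x) = A x) ∧ HasTy B s b' ∧
      ∀ s', Joined B b' s s' → Joined A b (C.plug s) (C.plug s') := by
  induction C generalizing b with
  | hole => exact ⟨A, b, fun _ => rfl, h, fun _ h => h⟩
  | list r i C ih =>
    cases h with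
    | list _ _ a h =>
      have hi := h i
      rw [Function.update_self] at hi
      obtain ⟨B, b', hB, hs, hc⟩ := ih hi
      exact ⟨B, b', hB, hs, fun s' hs' => (hc s' hs').list_update h⟩
  | app f r i C ih =>
    cases h with
    | app _ a _ _ _ h =>
      have hi := h i
      rw [Function.update_self] at hi
      obtain ⟨B, b', hB, hs, hc⟩ := ih hi
      exact ⟨B, b', hB, hs, fun s' hs' => (hc s' hs').app_update f h⟩
  | subL a C t ih =>
    cases h with
    | sub _ _ _ _ _ h ho ht =>
      obtain ⟨B, b', hB, hs, hc⟩ := ih h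
      exact ⟨B, b', fun x => (hB (Fin.castAdd _ x)).trans (Fin.append_left _ _ x), hs,
        fun s' hs' => (hc s' hs').subL ho ht⟩
  | subR a r C ih =>
    cases h with
    | sub _ _ _ _ _ h ho ht =>
      obtain ⟨B, b', hB, hs, hc⟩ := ih ht
      exact ⟨B, b', hB, hs, fun s' hs' => Joined.subR h ho (hc s' hs')⟩

theorem HasTy.of_substCtx {n m : ℕ} {L : HoleCtx R n m} (hL : L.IsSubstCtx)
    {A : Fin n → Ty R.Atom} {b : Ty R.Atom} {s : Tm R m} (h : HasTy A (L.plug s) b) :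
    ∃ B : Fin m → Ty R.Atom, HasTy B s b := by
  induction L generalizing b with
  | hole => exact ⟨A, h⟩
  | list => exact hL.elim
  | app => exact hL.elim
  | subR => exact hL.elim
  | subL a L t ih =>
    cases h with
    | sub _ _ _ _ _ h ho ht => exact ih hL h

/-- The `η`-rule without its side conditions. For a term `L⟨t₁, …, tₘ⟩`, where it is not a step, it
holds by a `β`-step in the other direction. -/
theorem Joined.eta {n k : ℕ} {A : Fin n → Ty R.Atom} {a : Fin k → Ty R.Atom} {t : Tm R n}
    (ht : HasTy A t (Ty.tensor a)) (ho : ∀ x, t.occ x ≤ 1) :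
    Joined A (Ty.tensor a) t (Tm.sub a (Tm.list fun j => Tm.var (Fin.natAdd n j)) t) := by
  have h2 := (Conv.eta ht).right
  by_cases hL : IsLT t
  · obtain ⟨m, l, L, u, hL, rfl⟩ := hL
    obtain ⟨B, hB⟩ := HasTy.of_substCtx hL ht
    cases hB with
    | list _ _ _ hu =>
      refine (Joined.step h2 ht ?_).symm
      have := Step.beta HoleCtx.hole _ _
        (BetaRoot.mk a (Tm.list fun j => Tm.var (Fin.natAdd n j)) L u hL)
      simpa [HoleCtx.plug, Tm.subst] using this
  · obtain ⟨N, γ, hγ⟩ := ht.exists_typed ho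
    exact Joined.step ht h2 (Step.eta HoleCtx.hole _ _ trivial (EtaRoot.mk γ a t hγ hL))

theorem HoleCtx.inc_injective {n m : ℕ} (C : HoleCtx R n m) : Function.Injective C.inc := by
  induction C with
  | hole => exact fun _ _ h => h
  | list r i C ih => exact ih
  | app f r i C ih => exact ih
  | subL a C t ih => exact ih.comp (Fin.castAdd_injective _ _)
  | subR a r C ih => exact ih

theorem exists_unique_of_sum_eq_one {k : ℕ} {o : Fin k → ℕ} (h : ∑ i, o i = 1) :
    ∃ i, o i = 1 ∧ ∀ j, j ≠ i → o j = 0 := by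
  have : ∃ i, o i ≠ 0 := by
    by_contra! h0
    simp [h0] at h
  obtain ⟨i, hi⟩ := this
  have h2 := Finset.add_sum_erase Finset.univ o (Finset.mem_univ i)
  refine ⟨i, by omega, fun j hj => ?_⟩
  have h3 : ∑ x ∈ Finset.univ.erase i, o x = 0 := by omega
  exact Finset.sum_eq_zero_iff.1 h3 j (by simp [hj])

/-- If the variable `z` occurs exactly once in `s`, then substituting for `z` amounts to filling
the hole of a context. -/
theorem exists_plug {n' n k : ℕ} (s : Tm R n') (z : Fin n') (hz : s.occ z = 1)
    (θ : Fin n' → Tm R n) (θ' : Fin n' → Tm R (n + k))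
    (h : ∀ y, y ≠ z → θ' y = (θ y).rename (Fin.castAdd k)) :
    ∃ (m : ℕ) (C : HoleCtx R n m), s.subst θ = C.plug ((θ z).rename C.inc) ∧
      s.subst θ' = C.plugFresh k ((θ' z).rename (liftRen k C.inc)) := by
  have away : ∀ s : Tm R n', s.occ z = 0 → s.subst θ' = (s.subst θ).rename (Fin.castAdd k) := by
    intro s hs
    rw [Tm.rename_subst]
    exact s.subst_congr fun y hy => h y fun e => hy (e ▸ hs)
  induction s generalizing n with
  | var i =>
    have : i = z := by by_contra hi; simp [Tm.occ, hi] at hz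
    subst this
    refine ⟨n, HoleCtx.hole, (Tm.rename_id _).symm, ?_⟩
    have : liftRen k (HoleCtx.hole (R := R) (n := n)).inc = fun x => x := by
      apply funext_append <;> simp [HoleCtx.inc]
    simp only [this, Tm.rename_id, HoleCtx.plugFresh, Tm.subst]
  | list s ih =>
    obtain ⟨i, hi, hj⟩ := exists_unique_of_sum_eq_one hz
    obtain ⟨m, C, h1, h2⟩ := ih i z hi θ θ' h away
    refine ⟨m, HoleCtx.list (fun j => (s j).subst θ) i C, ?_, ?_⟩
    · have e : (HoleCtx.list (fun j => (s j).subst θ) i C).inc = C.inc := rfl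
      simp only [Tm.subst, HoleCtx.plug, e, ← h1]
      rw [Function.update_eq_self]
    · have e : (HoleCtx.list (fun j => (s j).subst θ) i C).inc = C.inc := rfl
      simp only [Tm.subst, HoleCtx.plugFresh, e, ← h2]
      congr 1
      funext j
      by_cases hji : j = i
      · subst hji; simp
      · simp [hji, away _ (hj j hji)]
  | app f s ih =>
    obtain ⟨i, hi, hj⟩ := exists_unique_of_sum_eq_one hz
    obtain ⟨m, C, h1, h2⟩ := ih i z hi θ θ' h away
    refine ⟨m, HoleCtx.app f (fun j => (s j).subst θ) i C, ?_, ?_⟩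
    · have e : (HoleCtx.app f (fun j => (s j).subst θ) i C).inc = C.inc := rfl
      simp only [Tm.subst, HoleCtx.plug, e, ← h1]
      rw [Function.update_eq_self]
    · have e : (HoleCtx.app f (fun j => (s j).subst θ) i C).inc = C.inc := rfl
      simp only [Tm.subst, HoleCtx.plugFresh, e, ← h2]
      congr 1
      funext j
      by_cases hji : j = i
      · subst hji; simp
      · simp [hji, away _ (hj j hji)]
  | @sub n' l a s t ihs iht =>
    simp only [Tm.occ] at hz
    by_cases ht : t.occ z = 1
    · have hs : s.occ (Fin.castAdd l z) = 0 := by omega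
      obtain ⟨m, C, h1, h2⟩ := iht z ht θ θ' h away
      refine ⟨m, HoleCtx.subR a (s.subst (Tm.liftSubst l θ)) C, ?_, ?_⟩
      · simp only [Tm.subst, HoleCtx.plug]
        congr 1
      · simp only [Tm.subst, HoleCtx.plugFresh]
        congr 1
        rw [Tm.rename_subst]
        refine s.subst_congr (Fin.addCases (fun y hy => ?_) fun j _ => ?_)
        · rw [Tm.liftSubst_castAdd, h y (fun e => hy (e ▸ hs)), Tm.liftSubst_castAdd,
            Tm.rename_rename, Tm.rename_rename]
          congr 1
          funext x
          simp
        · simp [Tm.rename]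
    · have ht0 : t.occ z = 0 := by omega
      have hs : s.occ (Fin.castAdd l z) = 1 := by omega
      have hθ'' : ∀ y, y ≠ Fin.castAdd l z →
          (Tm.liftSubst l θ' y).rename (HoleCtx.exchange n k l) =
            (Tm.liftSubst l θ y).rename (Fin.castAdd k) := by
        refine Fin.addCases (fun y hy => ?_) (fun j _ => ?_)
        · rw [Tm.liftSubst_castAdd, h y (fun e => hy (e ▸ rfl)), Tm.liftSubst_castAdd,
            Tm.rename_rename, Tm.rename_rename, Tm.rename_rename]
          congr 1
          funext x
          simp
        · simp [Tm.rename]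
      obtain ⟨m, C, h1, h2⟩ := ihs (Fin.castAdd l z) hs (Tm.liftSubst l θ)
        (fun y => (Tm.liftSubst l θ' y).rename (HoleCtx.exchange n k l)) hθ'' (fun s hs => by
          rw [Tm.rename_subst]
          exact s.subst_congr fun y hy => hθ'' y fun e => hy (e ▸ hs))
      refine ⟨m, HoleCtx.subL a C (t.subst θ), ?_, ?_⟩
      · simp only [Tm.subst, HoleCtx.plug, h1]
        rw [Tm.liftSubst_castAdd, Tm.rename_rename]
        rfl
      · simp only [Tm.subst, HoleCtx.plugFresh]
        congr 1
        · have e : (θ' z).rename (liftRen k (HoleCtx.subL a C (t.subst θ)).inc) =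
              ((Tm.liftSubst l θ' (Fin.castAdd l z)).rename (HoleCtx.exchange n k l)).rename
                (liftRen k C.inc) := by
            rw [Tm.liftSubst_castAdd, Tm.rename_rename, Tm.rename_rename]
            congr 1
            apply funext_append <;> simp [HoleCtx.inc]
          rw [e, ← h2, Tm.rename_subst]
          congr 1
          funext x
          rw [Tm.rename_rename]
          conv_lhs => rw [← Tm.rename_id (Tm.liftSubst l θ' x)]
          congr 1
          funext y
          exact (exchange_exchange y).symm
        · exact away _ ht0

/-- The rule `expand` is derivable: substituting for a variable that occurs exactly once is filling
the hole of a context `C`, in which `η` is applied at the hole and the explicit substitution is then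
moved outwards through `C` by the structural rule. -/
theorem Joined.expand {n k : ℕ} {A : Fin n → Ty R.Atom} {a : Fin k → Ty R.Atom} {b : Ty R.Atom}
    {s : Tm R (n + 1)} {t : Tm R n}
    (hs : HasTy (Fin.append A fun _ : Fin 1 => Ty.tensor a) s b)
    (ho : s.occ (Fin.natAdd n 0) = 1) (ht : HasTy A t (Ty.tensor a)) (hto : ∀ x, t.occ x ≤ 1) :
    Joined A b (s.subst (Fin.append Tm.var fun _ => t)) (Tm.sub a (s.subst (unpack n k)) t) := by
  obtain ⟨m, C, h1, h2⟩ := exists_plug s (Fin.natAdd n 0) ho (Fin.append Tm.var fun _ => t)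
    (unpack n k) (Fin.addCases (by simp [Tm.rename]) fun j hj => by
      rw [Subsingleton.elim j 0] at hj; exact absurd rfl hj)
  have hc := Conv.expand hs ho ht
  rw [h1, h2] at hc ⊢
  simp only [Fin.append_right, unpack_natAdd, Tm.rename, liftRen_natAdd] at hc ⊢
  obtain ⟨B, b', hB, hs', hj⟩ := HasTy.joined_plug C hc.left
  have hti : ∀ x, (t.rename C.inc).occ x ≤ 1 := by
    intro x
    by_cases hx : ∃ y, C.inc y = x
    · obtain ⟨y, rfl⟩ := hx
      rw [Tm.occ_rename_of_injective _ C.inc_injective]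
      exact hto y
    · rw [Tm.occ_rename_of_notMem _ fun y hy => hx ⟨y, hy⟩]
      exact Nat.zero_le 1
  cases hs'.unique (ht.rename C.inc hB)
  have h3 := hj _ (Joined.eta hs' hti)
  exact h3.trans (Joined.step h3.conv.right hc.right
    (Step.struct HoleCtx.hole C a (Tm.list fun j => Tm.var (Fin.natAdd m j)) t))

theorem Conv.joined {n : ℕ} {A : Fin n → Ty R.Atom} {b : Ty R.Atom} {s s' : Tm R n}
    (h : Conv A b s s') (ho : ∀ x, s.occ x ≤ 1) : Joined A b s s' := by
  induction h with
  | refl h => exact Joined.refl h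
  | symm h ih => exact (ih (by rwa [h.occ_eq])).symm
  | trans h _ ih ih' => exact (ih ho).trans (ih' (by rwa [← h.occ_eq]))
  | list _ ih =>
    exact Joined.list fun i => ih i fun x =>
      (Finset.single_le_sum (fun _ _ => Nat.zero_le _) (Finset.mem_univ i)).trans (ho x)
  | app f _ ih =>
    exact Joined.app f fun i => ih i fun x =>
      (Finset.single_le_sum (fun _ _ => Nat.zero_le _) (Finset.mem_univ i)).trans (ho x)
  | sub hs hb ht ihs iht =>
    simp only [Tm.occ] at ho
    have h1 := ihs (Fin.addCases (fun x => (Nat.le_add_right _ _).trans (ho x))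
      fun j => (hb j).le)
    have h2 := iht fun x => (Nat.le_add_left _ _).trans (ho x)
    exact (h1.subL hb ht.left).trans
      (Joined.subR hs.right (by rwa [← hs.occ_eq]) h2)
  | beta hs hb ht =>
    have hc := Conv.beta hs hb ht
    exact Joined.step hc.left hc.right
      (Step.beta HoleCtx.hole _ _ (BetaRoot.mk _ _ HoleCtx.hole _ trivial))
  | expand hs hb ht =>
    refine Joined.expand hs hb ht fun x => le_trans ?_ (ho x)
    simp [Tm.occ_subst_append_var, hb]

theorem Conv.cls_eq {n : ℕ} {a : Fin n → Ty R.Atom} {b : Ty R.Atom} {s s' : Tm R n}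
    (h : Conv a b s s') (hs : Typed (fun i => (i, a i)) s b)
    (hs' : Typed (fun i => (i, a i)) s' b) : cls s hs = cls s' hs' := by
  have hj := h.joined fun x => ((typed_iff.1 hs).2 x).le
  clear h
  induction hj with
  | step _ _ h => exact Quot.sound h
  | refl => rfl
  | symm _ ih => exact (ih hs' hs).symm
  | trans h _ ih ih' =>
    have := typed_iff.2 ⟨h.conv.right, by rw [← h.conv.occ_eq]; exact (typed_iff.1 hs).2⟩
    exact (ih hs this).trans (ih' this hs')

/-- Classes of terms coincide exactly if the terms are convertible. -/
theorem cls_eq_iff {n : ℕ} {a : Fin n → Ty R.Atom} {b : Ty R.Atom} {s s' : Tm R n}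
    (hs : Typed (fun i => (i, a i)) s b) (hs' : Typed (fun i => (i, a i)) s' b) :
    cls s hs = cls s' hs' ↔ Conv a b s s' := by
  refine ⟨fun h => ?_, fun h => h.cls_eq hs hs'⟩
  have := Quot.eqvGen_exact h
  have key : ∀ p q : Terms R a b, Relation.EqvGen (fun s s' : Terms R a b => Step s.1 s'.1) p q →
      Conv a b p.1 q.1 := by
    intro p q h
    induction h with
    | rel p q h => exact h.conv (typed_iff.1 p.2).1 (typed_iff.1 q.2).1
    | refl p => exact Conv.refl (typed_iff.1 p.2).1
    | symm _ _ _ ih => exact ih.symm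
    | trans _ _ _ _ _ ih ih' => exact ih.trans ih'
  exact key _ _ this

end ConvStep

/-! ### Concatenation of lists -/

section Concat

theorem concat_mk {α : Type*} {n : ℕ} {m : Fin n → ℕ} (γ : (i : Fin n) → Fin (m i) → α)
    (x : (i : Fin n) × Fin (m i)) : concat γ (finSigmaFinEquiv x) = γ x.1 x.2 := by
  change (fun x : (i : Fin n) × Fin (m i) => γ x.1 x.2)
    (finSigmaFinEquiv.symm (finSigmaFinEquiv x)) = _
  rw [Equiv.symm_apply_apply]

theorem ofFn_concat {α : Type*} {n : ℕ} {m : Fin n → ℕ} (γ : (i : Fin n) → Fin (m i) → α) :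
    List.ofFn (concat γ) = (List.ofFn fun i => List.ofFn (γ i)).flatten := by
  induction n with
  | zero => simp
  | succ n ih =>
    rw [List.ofFn_succ', List.concat_eq_append, List.flatten_append, ← ih,
      List.ofFn_congr (Fin.sum_univ_castSucc m) (concat γ), List.ofFn_add]
    simp only [List.flatten_cons, List.flatten_nil, List.append_nil]
    congr 2
    · funext p
      obtain ⟨⟨i, j⟩, rfl⟩ := finSigmaFinEquiv.surjective p
      rw [concat_mk]
      have : Fin.cast (Fin.sum_univ_castSucc m).symm
          (Fin.castAdd (m (Fin.last n)) (finSigmaFinEquiv ⟨i, j⟩)) =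
          finSigmaFinEquiv ⟨i.castSucc, j⟩ := by
        apply Fin.ext
        simp [finSigmaFinEquiv_apply]
      refine (congrArg (concat γ) this).trans ?_
      rw [concat_mk]
    · funext j
      have : Fin.cast (Fin.sum_univ_castSucc m).symm
          (Fin.natAdd (∑ i : Fin n, m i.castSucc) j) = finSigmaFinEquiv ⟨Fin.last n, j⟩ := by
        apply Fin.ext
        simp [finSigmaFinEquiv_apply]
        rfl
      rw [this, concat_mk]

theorem sigma_concat_assoc {α : Type*} {n : ℕ} {m : Fin n → ℕ} {l : (i : Fin n) → Fin (m i) → ℕ}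
    (γ : (i : Fin n) → (j : Fin (m i)) → Fin (l i j) → α) :
    (⟨_, concat fun p : Fin (∑ i, m i) =>
        γ (finSigmaFinEquiv.symm p).1 (finSigmaFinEquiv.symm p).2⟩ : (N : ℕ) × (Fin N → α)) =
      ⟨_, concat fun i => concat (γ i)⟩ := by
  rw [← List.ofFn_inj']
  simp only [ofFn_concat]
  have : (fun p : Fin (∑ i, m i) =>
      List.ofFn (γ (finSigmaFinEquiv.symm p).1 (finSigmaFinEquiv.symm p).2)) =
      concat fun i j => List.ofFn (γ i j) := rfl
  rw [this, ofFn_concat, List.flatten_flatten, List.map_ofFn]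
  rfl

theorem sigma_concat_singleton {α : Type*} {n : ℕ} (γ : Fin n → α) :
    (⟨_, concat fun i (_ : Fin 1) => γ i⟩ : (N : ℕ) × (Fin N → α)) = ⟨n, γ⟩ := by
  rw [← List.ofFn_inj', ofFn_concat]
  have : (List.ofFn fun i => List.ofFn fun _ : Fin 1 => γ i) =
      (List.ofFn γ).map fun x => [x] := by
    rw [List.map_ofFn]
    congr 1
  rw [this, ← List.flatMap_def, List.flatMap_singleton']

theorem sigma_concat_one {α : Type*} {n : ℕ} (γ : Fin n → α) :
    (⟨_, concat fun _ : Fin 1 => γ⟩ : (N : ℕ) × (Fin N → α)) = ⟨n, γ⟩ := by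
  rw [← List.ofFn_inj', ofFn_concat]
  simp

theorem exists_cast_of_sigma_eq {α : Type*} {N N' : ℕ} {γ : Fin N → α} {γ' : Fin N' → α}
    (h : (⟨N, γ⟩ : (N : ℕ) × (Fin N → α)) = ⟨N', γ'⟩) :
    ∃ e : N = N', ∀ p, γ p = γ' (Fin.cast e p) := by
  cases h
  exact ⟨rfl, fun _ => rfl⟩

theorem concat_blockEquiv {α : Type*} {n n' : ℕ} {m : Fin n → ℕ} {m' : Fin n' → ℕ}
    (γ : (i : Fin n) → Fin (m i) → α) (σ : Fin n' ≃ Fin n)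
    (τ : (i : Fin n') → Fin (m' i) ≃ Fin (m (σ i))) :
    concat γ ∘ blockEquiv σ τ = concat fun i => γ (σ i) ∘ τ i := by
  funext p
  obtain ⟨⟨i, j⟩, rfl⟩ := finSigmaFinEquiv.surjective p
  simp only [Function.comp, blockEquiv, Equiv.trans_apply, Equiv.symm_apply_apply]
  rw [concat_mk, concat_mk]
  rfl

/-- The two ways of numbering the positions of a twice concatenated list agree. -/
theorem exists_cast_assoc {n : ℕ} {m : Fin n → ℕ} (l : (i : Fin n) → Fin (m i) → ℕ) :
    ∃ e : (∑ p : Fin (∑ i, m i), l (finSigmaFinEquiv.symm p).1 (finSigmaFinEquiv.symm p).2) =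
        ∑ i, ∑ j, l i j,
      ∀ (p : Fin (∑ i, m i)) q, Fin.cast e (finSigmaFinEquiv ⟨p, q⟩) =
        finSigmaFinEquiv ⟨(finSigmaFinEquiv.symm p).1,
          finSigmaFinEquiv ⟨(finSigmaFinEquiv.symm p).2, q⟩⟩ := by
  obtain ⟨e, he⟩ := exists_cast_of_sigma_eq (sigma_concat_assoc (l := l)
    fun i j q => (⟨i, j, q⟩ : (i : Fin n) × (j : Fin (m i)) × Fin (l i j)))
  refine ⟨e, fun p q => ?_⟩
  have hinj : Function.Injective (concat fun i => concat fun j (q : Fin (l i j)) =>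
      (⟨i, j, q⟩ : (i : Fin n) × (j : Fin (m i)) × Fin (l i j))) := by
    apply Function.LeftInverse.injective
      (g := fun x => finSigmaFinEquiv ⟨x.1, finSigmaFinEquiv ⟨x.2.1, x.2.2⟩⟩)
    intro p
    obtain ⟨⟨i, p⟩, rfl⟩ := finSigmaFinEquiv.surjective p
    obtain ⟨⟨j, p⟩, rfl⟩ := finSigmaFinEquiv.surjective p
    have h : concat (fun i => concat fun j (q : Fin (l i j)) =>
        (⟨i, j, q⟩ : (i : Fin n) × (j : Fin (m i)) × Fin (l i j)))
        (finSigmaFinEquiv ⟨i, finSigmaFinEquiv ⟨j, p⟩⟩) = ⟨i, j, p⟩ := by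
      rw [concat_mk, concat_mk]
    rw [h]
  apply hinj
  rw [← he]
  simp only [concat_mk]

end Concat

/-! ### The multicategory of terms -/

section Free

variable {R : Signature.{u, v}}

theorem exists_rep {n : ℕ} {a : Fin n → Ty R.Atom} {b : Ty R.Atom} (f : (freeGraph R).Hom a b) :
    ∃ s : Terms R a b, f = cls s.1 s.2 := by
  obtain ⟨s, rfl⟩ := Quot.exists_rep f
  exact ⟨s, rfl⟩

theorem Terms.hasTy {n : ℕ} {a : Fin n → Ty R.Atom} {b : Ty R.Atom} (s : Terms R a b) :
    HasTy a s.1 b := (typed_iff.1 s.2).1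

theorem Terms.occ {n : ℕ} {a : Fin n → Ty R.Atom} {b : Ty R.Atom} (s : Terms R a b)
    (x : Fin n) : s.1.occ x = 1 := (typed_iff.1 s.2).2 x

theorem arr_cls_eq {n n' : ℕ} (e : n = n') {a : Fin n → Ty R.Atom} {a' : Fin n' → Ty R.Atom}
    {b : Ty R.Atom} {s : Tm R n} {s' : Tm R n'} (hs : Typed (fun i => (i, a i)) s b)
    (hs' : Typed (fun i => (i, a' i)) s' b) (ha : ∀ i, a i = a' (Fin.cast e i))
    (h : s.rename (Fin.cast e) = s') :
    (freeGraph R).arr (cls s hs) = (freeGraph R).arr (cls s' hs') := by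
  subst e
  obtain rfl : a = a' := funext ha
  have : s.rename (Fin.cast rfl) = s := Tm.rename_id s
  rw [this] at h
  subst h
  rfl

/-- A multiarrow that coincides, together with its source and target, with the class of a term `s`
is the class of `s` with its variables renumbered along the equality of arities. -/
theorem arr_eq_cls {m k : ℕ} {γ : Fin m → Ty R.Atom} {a : Ty R.Atom}
    {f : (freeGraph R).Hom γ a} {c : Fin k → Ty R.Atom} {b : Ty R.Atom} {s : Tm R k}
    {hs : Typed (fun i => (i, c i)) s b}
    (h : (freeGraph R).arr f = (freeGraph R).arr (cls s hs)) :
    ∃ e : k = m, a = b ∧ (∀ j, γ (Fin.cast e j) = c j) ∧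
      ∃ t : Terms R γ a, f = cls t.1 t.2 ∧ t.1 = s.rename (Fin.cast e) := by
  have key : ∀ (x y : (freeGraph R).Arr), x = y → ∃ e : y.arity = x.arity, x.tgt = y.tgt ∧
      (∀ j, x.src (Fin.cast e j) = y.src j) ∧
      ∀ s : Terms R y.src y.tgt, y.hom = cls s.1 s.2 → ∃ t : Terms R x.src x.tgt,
        x.hom = cls t.1 t.2 ∧ t.1 = s.1.rename (Fin.cast e) := by
    rintro x y rfl
    exact ⟨rfl, rfl, fun _ => rfl, fun s hs => ⟨s, hs, (Tm.rename_id _).symm⟩⟩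
  obtain ⟨e, h1, h2, h3⟩ := key _ _ h
  exact ⟨e, h1, h2, h3 ⟨s, hs⟩ rfl⟩

/-! #### Composition -/

theorem typed_comp {n : ℕ} {a : Fin n → Ty R.Atom} {b : Ty R.Atom} {m : Fin n → ℕ}
    {γ : (i : Fin n) → Fin (m i) → Ty R.Atom} (s : Terms R a b)
    (t : (i : Fin n) → Terms R (γ i) (a i)) :
    Typed (fun p => (p, concat γ p))
      (s.1.subst fun i => (t i).1.rename fun j => finSigmaFinEquiv ⟨i, j⟩) b := by
  rw [typed_iff]
  refine ⟨s.hasTy.subst fun i => (t i).hasTy.rename _ fun j => concat_mk γ ⟨i, j⟩, fun p => ?_⟩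
  obtain ⟨⟨i, j⟩, rfl⟩ := finSigmaFinEquiv.surjective p
  rw [Tm.occ_subst, Finset.sum_eq_single i]
  · rw [Tm.occ_rename_of_injective (ρ := fun j => finSigmaFinEquiv ⟨i, j⟩), s.occ, (t i).occ]
    intro j j' h
    simpa using h
  · intro i' _ hi'
    rw [Tm.occ_rename_of_notMem, mul_zero]
    intro j' h
    have := finSigmaFinEquiv.injective h
    exact hi' (congrArg Sigma.fst this)
  · simp

/-- Composition of classes of terms: simultaneous substitution. -/
noncomputable def freeComp {n : ℕ} {a : Fin n → Ty R.Atom} {b : Ty R.Atom} {m : Fin n → ℕ}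
    {γ : (i : Fin n) → Fin (m i) → Ty R.Atom} (f : (freeGraph R).Hom a b)
    (g : (i : Fin n) → (freeGraph R).Hom (γ i) (a i)) : (freeGraph R).Hom (concat γ) b :=
  cls _ (typed_comp (Quot.out f) fun i => Quot.out (g i))

theorem conv_out {n : ℕ} {a : Fin n → Ty R.Atom} {b : Ty R.Atom} (s : Terms R a b) :
    Conv a b (Quot.out (cls s.1 s.2)).1 s.1 :=
  (cls_eq_iff (Quot.out (cls s.1 s.2)).2 s.2).1 (Quot.out_eq (cls s.1 s.2))

theorem freeComp_cls {n : ℕ} {a : Fin n → Ty R.Atom} {b : Ty R.Atom} {m : Fin n → ℕ}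
    {γ : (i : Fin n) → Fin (m i) → Ty R.Atom} (s : Terms R a b)
    (t : (i : Fin n) → Terms R (γ i) (a i)) :
    freeComp (cls s.1 s.2) (fun i => cls (t i).1 (t i).2) = cls _ (typed_comp s t) :=
  Conv.cls_eq ((conv_out s).subst_conv fun i =>
    (conv_out (t i)).rename _ fun j => concat_mk γ ⟨i, j⟩) _ _

/-! #### Permutations -/

theorem typed_act {m n : ℕ} {a : Fin n → Ty R.Atom} {b : Ty R.Atom} (σ : Fin m ≃ Fin n)
    (s : Terms R a b) : Typed (fun i => (i, (a ∘ σ) i)) (s.1.rename σ.symm) b := by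
  rw [typed_iff]
  refine ⟨s.hasTy.rename _ (by simp), fun x => ?_⟩
  rw [← σ.symm_apply_apply x, Tm.occ_rename_of_injective _ σ.symm.injective, s.occ]

/-- The action of permutations on classes of terms. -/
noncomputable def freeAct {m n : ℕ} {a : Fin n → Ty R.Atom} {b : Ty R.Atom} (σ : Fin m ≃ Fin n)
    (f : (freeGraph R).Hom a b) : (freeGraph R).Hom (a ∘ σ) b :=
  cls _ (typed_act σ (Quot.out f))

theorem freeAct_cls {m n : ℕ} {a : Fin n → Ty R.Atom} {b : Ty R.Atom} (σ : Fin m ≃ Fin n)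
    (s : Terms R a b) : freeAct σ (cls s.1 s.2) = cls _ (typed_act σ s) :=
  Conv.cls_eq ((conv_out s).rename σ.symm (B := a ∘ σ)
    fun x => congrArg a (σ.apply_symm_apply x)) _ _

/-- The multicategory structure on classes of terms. -/
noncomputable def freeMulticat (R : Signature.{u, v}) : MulticatStr (freeGraph R) where
  id a := cls (Tm.var 0) (typed_var a)
  comp f g := freeComp f g
  id_comp := by
    intro n a b f
    obtain ⟨s, rfl⟩ := exists_rep f
    have h := freeComp_cls (γ := fun _ : Fin 1 => a) ⟨Tm.var 0, typed_var b⟩ fun _ => s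
    refine (congrArg _ h).trans ?_
    obtain ⟨e, he⟩ := exists_cast_of_sigma_eq (sigma_concat_one a)
    refine arr_cls_eq e _ _ he ?_
    simp only [Tm.subst, Tm.rename_rename]
    conv_rhs => rw [← Tm.rename_id s.1]
    congr 1
    funext j
    apply Fin.ext
    simp [finSigmaFinEquiv_apply]
  comp_id := by
    intro n a b f
    obtain ⟨s, rfl⟩ := exists_rep f
    have h := freeComp_cls (γ := fun i (_ : Fin 1) => a i) s
      fun i => ⟨Tm.var 0, typed_var (a i)⟩
    refine (congrArg _ h).trans ?_
    obtain ⟨e, he⟩ := exists_cast_of_sigma_eq (sigma_concat_singleton (fun i : Fin n => i))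
    refine arr_cls_eq e _ _ (fun p => ?_) ?_
    · exact congrArg a (he p)
    · simp only [Tm.rename, Tm.rename_subst]
      conv_rhs => rw [← Tm.subst_var s.1]
      congr 1
      funext i
      rw [← he, concat_mk]
  assoc := by
    intro n a b m γ l δ f g h
    obtain ⟨s, rfl⟩ := exists_rep f
    choose t ht using fun i => exists_rep (g i)
    obtain rfl : g = _ := funext ht
    choose r hr using fun i j => exists_rep (h i j)
    obtain rfl : h = _ := funext fun i => funext (hr i)
    have h1 := freeComp_cls s t
    have h2 := freeComp_cls ⟨_, typed_comp s t⟩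
      (γ := fun p => δ (finSigmaFinEquiv.symm p).1 (finSigmaFinEquiv.symm p).2)
      fun p => r (finSigmaFinEquiv.symm p).1 (finSigmaFinEquiv.symm p).2
    have h3 := fun i => freeComp_cls (t i) (r i)
    have h4 := freeComp_cls s (γ := fun i => concat (δ i)) fun i => ⟨_, typed_comp (t i) (r i)⟩
    simp only [h1, h3]
    refine (congrArg _ h2).trans (Eq.trans ?_ (congrArg _ h4).symm)
    obtain ⟨e, he⟩ := exists_cast_assoc l
    refine arr_cls_eq e _ _ (fun p => ?_) ?_
    · obtain ⟨⟨p, q⟩, rfl⟩ := finSigmaFinEquiv.surjective p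
      rw [he]
      simp only [concat_mk]
      rfl
    · simp only [Tm.subst_subst, Tm.rename_subst]
      congr 1
      funext i
      rw [Tm.subst_rename]
      congr 1
      funext j
      rw [Tm.rename_rename, Tm.rename_rename]
      have key : ∀ x : (i : Fin n) × Fin (m i),
          (r (finSigmaFinEquiv.symm (finSigmaFinEquiv x)).1
            (finSigmaFinEquiv.symm (finSigmaFinEquiv x)).2).1.rename
            (Fin.cast e ∘ fun q => finSigmaFinEquiv ⟨finSigmaFinEquiv x, q⟩) =
          (r x.1 x.2).1.rename
            ((fun q => finSigmaFinEquiv ⟨x.1, q⟩) ∘ fun q => finSigmaFinEquiv ⟨x.2, q⟩) := by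
        intro x
        obtain ⟨p, rfl⟩ := finSigmaFinEquiv.symm.surjective x
        rw [Equiv.apply_symm_apply]
        congr 1
        funext q
        exact he p q
      exact key ⟨i, j⟩

/-- The symmetric structure on classes of terms. -/
noncomputable def freeSym (R : Signature.{u, v}) : SymStr (freeMulticat R) where
  act σ f := freeAct σ f
  act_refl := by
    intro n a b f
    obtain ⟨s, rfl⟩ := exists_rep f
    refine (freeAct_cls _ s).trans ?_
    congr 1
    exact Tm.rename_id _
  act_act := by
    intro l m n a b σ τ f
    obtain ⟨s, rfl⟩ := exists_rep f
    refine ((congrArg _ (freeAct_cls σ s)).trans (freeAct_cls τ ⟨_, typed_act σ s⟩)).trans ?_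
    refine Eq.trans ?_ (freeAct_cls (τ.trans σ) s).symm
    congr 1
    exact Tm.rename_rename _ _ _
  act_comp := by
    intro n n' a b m m' γ f g σ τ
    obtain ⟨s, rfl⟩ := exists_rep f
    choose t ht using fun i => exists_rep (g i)
    obtain rfl : g = _ := funext ht
    have h1 := freeAct_cls σ s
    have h2 := fun i => freeAct_cls (τ i) (t (σ i))
    have h3 := freeComp_cls ⟨_, typed_act σ s⟩ (γ := fun i => γ (σ i) ∘ τ i)
      fun i => ⟨_, typed_act (τ i) (t (σ i))⟩
    have h4 := freeComp_cls s t
    have h5 := freeAct_cls (blockEquiv σ τ) ⟨_, typed_comp s t⟩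
    simp only [freeMulticat, h1, h2, h4]
    refine (congrArg _ h3).trans (Eq.trans ?_ (congrArg _ h5).symm)
    refine arr_cls_eq rfl _ _ (fun p => ?_) ?_
    · rw [concat_blockEquiv]; rfl
    · have e : ∀ s : Tm R (∑ i, m' i), s.rename (Fin.cast rfl) = s := Tm.rename_id
      rw [e, Tm.subst_rename, Tm.rename_subst]
      congr 1
      funext x
      obtain ⟨i, rfl⟩ := σ.surjective x
      rw [σ.symm_apply_apply, Tm.rename_rename, Tm.rename_rename]
      congr 1
      funext j
      rw [Function.comp, Function.comp, Equiv.eq_symm_apply]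
      simp only [blockEquiv, Equiv.trans_apply, Equiv.symm_apply_apply]
      change finSigmaFinEquiv (⟨σ i, τ i ((τ i).symm j)⟩ : (i : Fin n) × Fin (m i)) = _
      rw [Equiv.apply_symm_apply]

/-! #### Representability -/

/-- Composition with `re` is injective by `expand`, which recovers a term `s` linear in `z` from its
value `s'` at `z = ⟨x₁, …, xₖ⟩` as `s'[x⃗ := z]`, and surjective by `beta`. -/
theorem freeComp_bijective {n : ℕ} (a : Fin n → Ty R.Atom) (b : Ty R.Atom) (p : Fin n) {k : ℕ}
    (c : Fin k → Ty R.Atom) {m : Fin n → ℕ} {γ : (i : Fin n) → Fin (m i) → Ty R.Atom}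
    (g : (i : Fin n) → (freeGraph R).Hom (γ i) (a i))
    (hp : (freeGraph R).arr (g p) =
      (freeGraph R).arr (cls (Tm.list Tm.var) (typed_list_var c)))
    (hi : ∀ i, i ≠ p →
      (freeGraph R).arr (g i) = (freeGraph R).arr (cls (Tm.var 0) (typed_var (a i)))) :
    Function.Bijective (fun f : (freeGraph R).Hom a b => freeComp f g) := by
  obtain ⟨ep, hap, hγp, tp, hgp, htp⟩ := arr_eq_cls hp
  have hrep : ∀ i, ∃ t : Terms R (γ i) (a i), g i = cls t.1 t.2 ∧
      (i ≠ p → ∃ e : 1 = m i, (∀ j, γ i j = a i) ∧ t.1 = Tm.var (Fin.cast e 0)) ∧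
      (∀ h : i = p, t.1 = Tm.list fun j => Tm.var (Fin.cast (ep.trans (by rw [h])) j)) := by
    intro i
    by_cases h : i = p
    · subst h
      exact ⟨tp, hgp, fun h => absurd rfl h, fun _ => htp⟩
    · obtain ⟨e, -, h1, t, ht, ht'⟩ := arr_eq_cls (hi i h)
      refine ⟨t, ht, fun _ => ⟨e, fun j => ?_, ht'⟩, fun h' => absurd h' h⟩
      rw [← h1 (Fin.cast e.symm j)]
      rfl
  choose t htg htv htl using hrep
  obtain rfl : g = _ := funext htg
  have htl := htl p rfl
  have hm : ∀ i, i ≠ p → m i = 1 := fun i h => (htv i h).1.symm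
  -- `β` renames the variables of the concatenated list to the old variables and the new ones.
  set β : Fin (∑ i, m i) → Fin (n + k) := concat fun i j =>
    if h : i = p then Fin.natAdd n (Fin.cast (by rw [h, ep]) j) else Fin.castAdd k i with hβ
  have hβp : ∀ j, β (finSigmaFinEquiv ⟨p, Fin.cast ep j⟩) = Fin.natAdd n j := by
    intro j; rw [hβ, concat_mk]; simp
  have hβi : ∀ i j, i ≠ p → β (finSigmaFinEquiv ⟨i, j⟩) = Fin.castAdd k i := by
    intro i j h; rw [hβ, concat_mk]; simp [h]
  have cases_q : ∀ q : Fin (∑ i, m i), (∃ j, q = finSigmaFinEquiv ⟨p, Fin.cast ep j⟩) ∨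
      ∃ i, ∃ h : i ≠ p, q = finSigmaFinEquiv ⟨i, Fin.cast (hm i h).symm 0⟩ := by
    intro q
    obtain ⟨⟨i, j⟩, rfl⟩ := finSigmaFinEquiv.surjective q
    by_cases h : i = p
    · subst h
      exact Or.inl ⟨Fin.cast ep.symm j, rfl⟩
    · refine Or.inr ⟨i, h, ?_⟩
      congr 2
      apply Fin.ext
      have := hm i h
      have := j.2
      simp
      omega
  have hβinj : Function.Injective β := by
    intro q q' h
    obtain ⟨j, rfl⟩ | ⟨i, hi, rfl⟩ := cases_q q <;>
    obtain ⟨j', rfl⟩ | ⟨i', hi', rfl⟩ := cases_q q'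
    · rw [hβp, hβp] at h
      rw [(Fin.natAdd_injective _ _) h]
    · rw [hβp, hβi _ _ hi'] at h
      exact absurd h (natAdd_ne_castAdd _ _)
    · rw [hβp, hβi _ _ hi] at h
      exact absurd h (castAdd_ne_natAdd _ _)
    · rw [hβi _ _ hi, hβi _ _ hi'] at h
      obtain rfl := Fin.castAdd_injective _ _ h
      rfl
  have hβty : ∀ q, Fin.append a c (β q) = concat γ q := by
    intro q
    obtain ⟨j, rfl⟩ | ⟨i, hi, rfl⟩ := cases_q q
    · rw [hβp, Fin.append_right, concat_mk, hγp]
    · rw [hβi _ _ hi, Fin.append_left, concat_mk]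
      exact ((htv i hi).2.1 _).symm
  set θ : Fin n → Tm R (∑ i, m i) := fun i => (t i).1.rename fun j => finSigmaFinEquiv ⟨i, j⟩
    with hθ
  have hθp : θ p = Tm.list fun j => Tm.var (finSigmaFinEquiv ⟨p, Fin.cast ep j⟩) := by
    rw [hθ]
    simp only [htl, Tm.rename]
  have hθi : ∀ i, ∀ h : i ≠ p, θ i = Tm.var (finSigmaFinEquiv ⟨i, Fin.cast (hm i h).symm 0⟩) := by
    intro i h
    rw [hθ]
    simp only [(htv i h).2.2, Tm.rename]
  set ρ : Fin n → Fin (n + 1) := fun i => if i = p then Fin.natAdd n 0 else Fin.castAdd 1 i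
    with hρ
  have hθβ : ∀ i, (θ i).rename β = unpack n k (ρ i) := by
    intro i
    by_cases h : i = p
    · subst h
      rw [hθp]
      simp [Tm.rename, hβp, hρ]
    · rw [hθi i h]
      simp [Tm.rename, hβi _ _ h, hρ, h]
  have hρo : ∀ s : Terms R a b, (s.1.rename ρ).occ (Fin.natAdd n 0) = 1 := by
    intro s
    rw [Tm.occ_rename, Finset.sum_eq_single p]
    · simp [hρ, s.occ]
    · intro i _ hi
      simp [hρ, hi]
    · simp
  have hρty : ∀ i, Fin.append a (fun _ : Fin 1 => Ty.tensor c) (ρ i) = a i := by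
    intro i
    by_cases h : i = p
    · subst h; simp [hρ, hap]
    · simp [hρ, h]
  have hvar : HasTy a (Tm.var p) (Ty.tensor c) := HasTy.var' hap
  have key : ∀ s : Terms R a b,
      Conv a b s.1 (Tm.sub c ((s.1.subst θ).rename β) (Tm.var p)) := by
    intro s
    have h := Conv.expand (s.hasTy.rename ρ hρty) (hρo s) hvar
    convert h using 1
    · rw [Tm.subst_rename]
      conv_lhs => rw [← Tm.subst_var s.1]
      congr 1
      funext i
      by_cases h : i = p
      · subst h; simp [hρ]
      · simp [hρ, h]
    · rw [Tm.rename_subst, Tm.subst_rename]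
      simp only [hθβ]
  have hocc : ∀ s : Terms R a b, ∀ j, ((s.1.subst θ).rename β).occ (Fin.natAdd n j) = 1 := by
    intro s j
    rw [← hβp, Tm.occ_rename_of_injective _ hβinj]
    exact (typed_iff.1 (typed_comp s t)).2 _
  constructor
  · intro f f' h
    obtain ⟨s, rfl⟩ := exists_rep f
    obtain ⟨s', rfl⟩ := exists_rep f'
    have h : cls _ (typed_comp s t) = cls _ (typed_comp s' t) :=
      (freeComp_cls s t).symm.trans (h.trans (freeComp_cls s' t))
    rw [cls_eq_iff] at h
    have h2 := h.rename β hβty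
    exact Conv.cls_eq (((key s).trans (Conv.sub h2 (hocc s) (Conv.refl hvar))).trans
      (key s').symm) _ _
  · intro f
    obtain ⟨r, rfl⟩ := exists_rep f
    have hr := r.hasTy.rename β hβty
    have hro : ∀ j, (r.1.rename β).occ (Fin.natAdd n j) = 1 := by
      intro j
      rw [← hβp, Tm.occ_rename_of_injective _ hβinj, r.occ]
    have hs : Typed (fun i => (i, a i)) (Tm.sub c (r.1.rename β) (Tm.var p)) b := by
      rw [typed_iff]
      refine ⟨HasTy.sub _ _ _ _ _ hr hro hvar, fun x => ?_⟩
      simp only [Tm.occ]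
      by_cases h : p = x
      · subst h
        rw [if_pos rfl, Tm.occ_rename_of_notMem]
        intro q h
        obtain ⟨j, rfl⟩ | ⟨i, hi, rfl⟩ := cases_q q
        · rw [hβp] at h
          exact natAdd_ne_castAdd _ _ h
        · rw [hβi _ _ hi] at h
          exact hi (Fin.castAdd_injective _ _ h)
      · have h' : x ≠ p := fun e => h e.symm
        rw [if_neg h, ← hβi x (Fin.cast (hm x h').symm 0) h',
          Tm.occ_rename_of_injective _ hβinj, r.occ]
    refine ⟨cls _ hs, (freeComp_cls ⟨_, hs⟩ t).trans ?_⟩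
    refine Conv.cls_eq ?_ _ _
    change Conv (concat γ) b (Tm.sub c ((r.1.rename β).subst (Tm.liftSubst k θ)) (θ p)) r.1
    have hθty : ∀ i, HasTy (concat γ) (θ i) (a i) :=
      fun i => (t i).hasTy.rename _ fun j => concat_mk γ ⟨i, j⟩
    rw [hθp]
    have := Conv.beta (hr.subst (HasTy.liftSubst hθty c))
      (t := fun j => Tm.var (finSigmaFinEquiv ⟨p, Fin.cast ep j⟩)) (by simpa using hro)
      (fun j => HasTy.var' (by rw [concat_mk, hγp]))
    refine Eq.mp (congrArg _ ?_) this
    rw [Tm.subst_liftSubst_append, Tm.subst_rename]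
    conv_rhs => rw [← Tm.subst_var r.1]
    congr 1
    funext q
    obtain ⟨j, rfl⟩ | ⟨i, hi, rfl⟩ := cases_q q
    · rw [hβp]; simp
    · rw [hβi _ _ hi]; simp [hθi i hi]

/-- The symmetric representable multicategory of terms modulo convertibility. -/
noncomputable def freeStr (R : Signature.{u, v}) : SymRepStr (freeGraph R) where
  toMulticatStr := freeMulticat R
  sym := freeSym R
  rep :=
    { tensor := fun c => Ty.tensor c
      re := fun c => cls (Tm.list Tm.var) (typed_list_var c)
      bijective := fun a b p _ c _ _ g hp hi => freeComp_bijective a b p c g hp hi }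

end Free

/-! ### Multiarrows with named inputs -/

section Named

variable {H : Multigraph.{w, z}}

/-- A multiarrow whose inputs are labelled by names in `V`; `B` gives the node of every name.
Names may be repeated. -/
structure Named {V : Type} (B : V → H.Node) (b : H.Node) where
  arity : ℕ
  names : Fin arity → V
  hom : H.Hom (B ∘ names) b

namespace Named

variable {V W X : Type} {A : V → H.Node} {B : W → H.Node} {C : X → H.Node} {b : H.Node}

theorem ext_arr {x y : Named B b}
    (hn : (⟨x.arity, x.names⟩ : (N : ℕ) × (Fin N → W)) = ⟨y.arity, y.names⟩)
    (hh : H.arr x.hom = H.arr y.hom) : x = y := by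
  obtain ⟨n, l, f⟩ := x
  obtain ⟨n', l', f'⟩ := y
  cases hn
  congr 1
  simpa [Multigraph.arr] using hh

variable (T : SymRepStr H)

/-- Permuting the inputs. -/
def act (x : Named B b) {m : ℕ} (σ : Fin m ≃ Fin x.arity) : Named B b :=
  ⟨m, x.names ∘ σ, T.sym.act σ x.hom⟩

/-- The identity with input named `v`. -/
def pure (B : W → H.Node) (v : W) : Named B (B v) := ⟨1, fun _ => v, T.id (B v)⟩

/-- Composition along names. -/
def bind (x : Named A b) (y : (v : V) → Named B (A v)) : Named B b :=
  ⟨_, concat fun i => (y (x.names i)).names,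
    T.comp (γ := fun i => B ∘ (y (x.names i)).names) x.hom fun i => (y (x.names i)).hom⟩

theorem act_refl (x : Named B b) : x.act T (Equiv.refl _) = x := by
  obtain ⟨n, l, f⟩ := x
  simp only [act]
  congr 1
  exact T.sym.act_refl f

theorem act_act (x : Named B b) {m l : ℕ} (σ : Fin m ≃ Fin x.arity) (τ : Fin l ≃ Fin m) :
    (x.act T σ).act T τ = x.act T (τ.trans σ) := by
  simp only [act]
  congr 1
  exact T.sym.act_act σ τ x.hom

theorem act_bind_act (x : Named A b) {n : ℕ} (σ : Fin n ≃ Fin x.arity)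
    (y : (v : V) → Named B (A v)) {m : V → ℕ} (τ : (v : V) → Fin (m v) ≃ Fin (y v).arity) :
    (x.act T σ).bind T (fun v => (y v).act T (τ v)) =
      (x.bind T y).act T (blockEquiv σ fun i => τ (x.names (σ i))) := by
  refine ext_arr ?_ ?_
  · exact congrArg (Sigma.mk _)
      (concat_blockEquiv (fun i => (y (x.names i)).names) σ fun i => τ (x.names (σ i))).symm
  · exact T.sym.act_comp (γ := fun i => B ∘ (y (x.names i)).names) x.hom
      (fun i => (y (x.names i)).hom) σ fun i => τ (x.names (σ i))

theorem bind_pure (x : Named B b) : x.bind T (pure T B) = x :=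
  ext_arr (sigma_concat_singleton x.names) (T.comp_id x.hom)

theorem pure_bind (v : V) (y : (v : V) → Named B (A v)) : (pure T A v).bind T y = y v :=
  ext_arr (sigma_concat_one (y v).names) (T.id_comp (y v).hom)

theorem bind_bind (x : Named A b) (y : (v : V) → Named B (A v)) (z : (w : W) → Named C (B w)) :
    (x.bind T y).bind T z = x.bind T fun v => (y v).bind T z :=
  ext_arr (sigma_concat_assoc fun i j => (z ((y (x.names i)).names j)).names)
    (T.assoc (γ := fun i => B ∘ (y (x.names i)).names)
      (δ := fun i j => C ∘ (z ((y (x.names i)).names j)).names) x.hom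
      (fun i => (y (x.names i)).hom) fun i j => (z ((y (x.names i)).names j)).hom)

/-- How often a name labels an input. -/
def cnt [DecidableEq W] (x : Named B b) (v : W) : ℕ := ∑ i, if x.names i = v then 1 else 0

theorem cnt_act [DecidableEq W] (x : Named B b) {m : ℕ} (σ : Fin m ≃ Fin x.arity) (v : W) :
    (x.act T σ).cnt v = x.cnt v :=
  Equiv.sum_comp σ fun i => if x.names i = v then 1 else 0

theorem sum_concat [DecidableEq W] {n : ℕ} {m : Fin n → ℕ} (l : (i : Fin n) → Fin (m i) → W)
    (v : W) : (∑ p, if concat l p = v then 1 else 0) = ∑ i, ∑ j, if l i j = v then 1 else 0 := by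
  rw [← Equiv.sum_comp finSigmaFinEquiv, Fintype.sum_sigma]
  simp [concat_mk]

theorem cnt_bind [DecidableEq V] [Fintype V] [DecidableEq W] (x : Named A b)
    (y : (v : V) → Named B (A v)) (w : W) :
    (x.bind T y).cnt w = ∑ v, x.cnt v * (y v).cnt w := by
  refine (sum_concat (fun i => (y (x.names i)).names) w).trans ?_
  simp only [cnt, Finset.sum_mul]
  rw [Finset.sum_comm]
  refine Finset.sum_congr rfl fun i _ => ?_
  rw [Finset.sum_eq_single (x.names i)]
  · simp
  · intro v _ hv
    simp [hv.symm]
  · simp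

/-- Being equal up to a permutation of the inputs. -/
def setoid (B : W → H.Node) (b : H.Node) : Setoid (Named B b) where
  r x y := ∃ (m : ℕ) (σ : Fin m ≃ Fin x.arity), y = x.act T σ
  iseqv :=
    { refl := fun x => ⟨_, Equiv.refl _, (act_refl T x).symm⟩
      symm := by
        rintro x _ ⟨m, σ, rfl⟩
        refine ⟨_, σ.symm, ?_⟩
        have := act_act T x σ σ.symm
        rw [Equiv.symm_trans_self, act_refl] at this
        exact this.symm
      trans := by
        rintro x _ _ ⟨m, σ, rfl⟩ ⟨l, τ, rfl⟩
        exact ⟨_, τ.trans σ, act_act T x σ τ⟩ }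

end Named

/-- Multiarrows with named inputs, up to permutations of the inputs. -/
def NArr (T : SymRepStr H) {W : Type} (B : W → H.Node) (b : H.Node) :=
  Quotient (Named.setoid T B b)

namespace NArr

variable {T : SymRepStr H} {V W X : Type} {A : V → H.Node} {B : W → H.Node} {C : X → H.Node}
  {b : H.Node}

/-- The class of a named multiarrow. -/
def mk (T : SymRepStr H) (x : Named B b) : NArr T B b := Quotient.mk _ x

theorem exists_rep (Φ : NArr T B b) : ∃ x : Named B b, Φ = mk T x := by
  obtain ⟨x, rfl⟩ := Quotient.exists_rep Φ
  exact ⟨x, rfl⟩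

theorem mk_act (x : Named B b) {m : ℕ} (σ : Fin m ≃ Fin x.arity) : mk T (x.act T σ) = mk T x :=
  (Quotient.sound (s := Named.setoid T B b) ⟨m, σ, rfl⟩).symm

theorem mk_eq_iff {x y : Named B b} :
    mk T x = mk T y ↔ ∃ (m : ℕ) (σ : Fin m ≃ Fin x.arity), y = x.act T σ :=
  ⟨fun h => Quotient.exact (s := Named.setoid T B b) h, fun h => Quotient.sound h⟩

/-- The identity with input named `v`. -/
def pure (T : SymRepStr H) (B : W → H.Node) (v : W) : NArr T B (B v) := mk T (Named.pure T B v)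

/-- Composition along names. -/
noncomputable def bind (Φ : NArr T A b) (Θ : (v : V) → NArr T B (A v)) : NArr T B b :=
  mk T ((Quotient.out Φ).bind T fun v => Quotient.out (Θ v))

theorem mk_bind (x : Named A b) (y : (v : V) → Named B (A v)) :
    (mk T x).bind (fun v => mk T (y v)) = mk T (x.bind T y) := by
  obtain ⟨n, σ, hσ⟩ := mk_eq_iff.1 (Quotient.out_eq (mk T x)).symm
  have h := fun v => mk_eq_iff.1 (Quotient.out_eq (mk T (y v))).symm
  choose m τ hτ using h
  rw [bind, hσ]
  simp only [hτ]
  rw [Named.act_bind_act]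
  exact mk_act (x.bind T y) _

@[simp] theorem bind_pure (Φ : NArr T B b) : Φ.bind (pure T B) = Φ := by
  obtain ⟨x, rfl⟩ := Φ.exists_rep
  exact (mk_bind x _).trans (congrArg _ (Named.bind_pure T x))

@[simp] theorem pure_bind (v : V) (Θ : (v : V) → NArr T B (A v)) :
    (pure T A v).bind Θ = Θ v := by
  choose y hy using fun v => (Θ v).exists_rep
  obtain rfl : Θ = _ := funext hy
  exact (mk_bind _ y).trans (congrArg _ (Named.pure_bind T v y))

theorem bind_bind (Φ : NArr T A b) (Θ : (v : V) → NArr T B (A v))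
    (Ξ : (w : W) → NArr T C (B w)) :
    (Φ.bind Θ).bind Ξ = Φ.bind fun v => (Θ v).bind Ξ := by
  obtain ⟨x, rfl⟩ := Φ.exists_rep
  choose y hy using fun v => (Θ v).exists_rep
  obtain rfl : Θ = _ := funext hy
  choose z hz using fun v => (Ξ v).exists_rep
  obtain rfl : Ξ = _ := funext hz
  simp only [mk_bind, Named.bind_bind]

/-- How often a name labels an input. -/
def cnt [DecidableEq W] (Φ : NArr T B b) (v : W) : ℕ :=
  Quotient.lift (s := Named.setoid T B b) (fun x => x.cnt v)
    (by rintro x _ ⟨m, σ, rfl⟩; exact (Named.cnt_act T x σ v).symm) Φ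

theorem cnt_mk [DecidableEq W] (x : Named B b) (v : W) :
    (mk T x).cnt v = ∑ i, if x.names i = v then 1 else 0 := rfl

theorem cnt_pure [DecidableEq W] (v w : W) :
    (pure T B v).cnt w = if v = w then 1 else 0 :=
  Fin.sum_univ_one fun _ => if v = w then 1 else 0

theorem cnt_bind [DecidableEq V] [Fintype V] [DecidableEq W] (Φ : NArr T A b)
    (Θ : (v : V) → NArr T B (A v)) (w : W) :
    (Φ.bind Θ).cnt w = ∑ v, Φ.cnt v * (Θ v).cnt w := by
  obtain ⟨x, rfl⟩ := Φ.exists_rep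
  choose y hy using fun v => (Θ v).exists_rep
  obtain rfl : Θ = _ := funext hy
  rw [mk_bind]
  exact Named.cnt_bind T x y w

/-- A named multiarrow can be written with its inputs in any prescribed order. -/
theorem exists_eq_mk [DecidableEq W] (Φ : NArr T B b) {N : ℕ} (l : Fin N → W)
    (h : ∀ v, Φ.cnt v = ∑ i, if l i = v then 1 else 0) :
    ∃ f : H.Hom (B ∘ l) b, Φ = mk T ⟨N, l, f⟩ := by
  obtain ⟨x, rfl⟩ := Φ.exists_rep
  have e : ∀ v, Nonempty ({i // l i = v} ≃ {i // x.names i = v}) := by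
    intro v
    refine ⟨Fintype.equivOfCardEq ?_⟩
    rw [Fintype.card_subtype, Fintype.card_subtype, Finset.card_filter, Finset.card_filter]
    exact (h v).symm
  obtain ⟨σ, rfl⟩ : ∃ σ : Fin N ≃ Fin x.arity, l = x.names ∘ σ :=
    ⟨Equiv.ofFiberEquiv fun v => (e v).some,
      funext fun i => (Equiv.ofFiberEquiv_map (fun v => (e v).some) i).symm⟩
  exact ⟨T.sym.act σ x.hom, (mk_act x σ).symm⟩

theorem mk_injective {N : ℕ} {l : Fin N → W} (hl : Function.Injective l)
    {f f' : H.Hom (B ∘ l) b} (h : mk T ⟨N, l, f⟩ = mk T ⟨N, l, f'⟩) : f = f' := by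
  obtain ⟨m, σ, h⟩ := mk_eq_iff.1 h
  have hN : N = m := congrArg Named.arity h
  subst hN
  simp only [Named.act, Named.mk.injEq, heq_eq_eq, true_and] at h
  obtain ⟨h1, h2⟩ := h
  have : σ = Equiv.refl _ := by
    ext i
    rw [← hl (congrFun h1 i)]
    rfl
  subst this
  exact ((eq_of_heq h2).trans (T.sym.act_refl f)).symm

theorem injective_of_sum_le_one [DecidableEq W] {N : ℕ} {l : Fin N → W}
    (h : ∀ v, (∑ i, if l i = v then 1 else 0) ≤ 1) : Function.Injective l := by
  intro i j hij
  by_contra hne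
  have h1 := h (l i)
  rw [← Finset.card_filter] at h1
  have := Finset.card_le_one.1 h1 i (by simp) j (by simp [hij])
  exact hne this

/-- The composite of a multiarrow with named multiarrows. -/
noncomputable def op {k : ℕ} {a : Fin k → H.Node} (φ : H.Hom a b)
    (Φ : (j : Fin k) → NArr T B (a j)) : NArr T B b :=
  (mk T (⟨k, fun j => j, φ⟩ : Named a b)).bind Φ

theorem op_bind {k : ℕ} {a : Fin k → H.Node} (φ : H.Hom a b)
    (Φ : (j : Fin k) → NArr T A (a j)) (Θ : (v : V) → NArr T B (A v)) :
    (op φ Φ).bind Θ = op φ fun j => (Φ j).bind Θ :=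
  bind_bind _ _ _

theorem cnt_op [DecidableEq W] {k : ℕ} {a : Fin k → H.Node} (φ : H.Hom a b)
    (Φ : (j : Fin k) → NArr T B (a j)) (w : W) : (op φ Φ).cnt w = ∑ j, (Φ j).cnt w := by
  rw [op, cnt_bind]
  simp [cnt_mk]

end NArr

end Named

/-! ### Interpretation of terms -/

section Interpretation

variable {R : Signature.{u, v}} {H : Multigraph.{w, z}} {T : SymRepStr H}

/-- The map on types underlying a map of signatures. -/
def SignatureMap.ob (i : SignatureMap R T) : Ty R.Atom → H.Node := i.obj

/-- The map on multiarrows underlying a map of signatures. -/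
def SignatureMap.arrow (i : SignatureMap R T) {n : ℕ} {a : Fin n → Ty R.Atom} {b : Ty R.Atom}
    (f : R.Hom a b) : H.Hom (i.ob ∘ a) (i.ob b) := i.map f

/-- The possible values of terms of type `c` in the environment `A`. -/
abbrev Val (i : SignatureMap R T) {n : ℕ} (A : Fin n → Ty R.Atom) (c : Ty R.Atom) :=
  NArr T (fun x => i.ob (A x)) (i.ob c)

namespace Val

variable {i : SignatureMap R T} {n m l k : ℕ} {A : Fin n → Ty R.Atom} {B : Fin m → Ty R.Atom}
  {C : Fin l → Ty R.Atom} {a : Fin k → Ty R.Atom} {c c' c'' : Ty R.Atom}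

/-- Transport along an equality of types. -/
def cast (h : c = c') (Φ : Val i A c) : Val i A c' := h ▸ Φ

@[simp] theorem cast_rfl (h : c = c) (Φ : Val i A c) : cast h Φ = Φ := rfl

@[simp] theorem cast_cast (h : c = c') (h' : c' = c'') (Φ : Val i A c) :
    cast h' (cast h Φ) = cast (h.trans h') Φ := by
  subst h; subst h'; rfl

theorem cast_bind (h : c = c') (Φ : Val i A c) (Θ : (x : Fin n) → Val i B (A x)) :
    NArr.bind (cast h Φ) Θ = cast h (NArr.bind Φ Θ) := by
  subst h; rfl

@[simp] theorem cnt_cast (h : c = c') (Φ : Val i A c) (x : Fin n) :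
    NArr.cnt (cast h Φ) x = NArr.cnt Φ x := by
  subst h; rfl

/-- The value of a variable. -/
def var (i : SignatureMap R T) (A : Fin n → Ty R.Atom) (x : Fin n) : Val i A (A x) :=
  NArr.pure T (fun x => i.ob (A x)) x

theorem var_bind (x : Fin n) (Θ : (x : Fin n) → Val i B (A x)) :
    NArr.bind (var i A x) Θ = Θ x := NArr.pure_bind _ _

theorem cnt_var (x y : Fin n) : NArr.cnt (var i A x) y = if x = y then 1 else 0 :=
  NArr.cnt_pure x y

theorem cast_var_congr {x y : Fin n} (hxy : x = y) (h : A x = c) (h' : A y = c) :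
    cast h (var i A x) = cast h' (var i A y) := by
  subst hxy; rfl

/-- Concatenation of two families of values. -/
def fam (f : (x : Fin n) → Val i B (A x)) (g : (j : Fin k) → Val i B (a j)) :
    (x : Fin (n + k)) → Val i B (Fin.append A a x) :=
  Fin.addCases (fun x => cast (Fin.append_left A a x).symm (f x))
    fun j => cast (Fin.append_right A a j).symm (g j)

@[simp] theorem fam_castAdd (f : (x : Fin n) → Val i B (A x)) (g : (j : Fin k) → Val i B (a j))
    (x : Fin n) : fam f g (Fin.castAdd k x) = cast (Fin.append_left A a x).symm (f x) := by
  simp [fam]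

@[simp] theorem fam_natAdd (f : (x : Fin n) → Val i B (A x)) (g : (j : Fin k) → Val i B (a j))
    (j : Fin k) : fam f g (Fin.natAdd n j) = cast (Fin.append_right A a j).symm (g j) := by
  simp [fam]

/-- The old variables, below a binder. -/
def old (i : SignatureMap R T) (A : Fin n → Ty R.Atom) (a : Fin k → Ty R.Atom) (x : Fin n) :
    Val i (Fin.append A a) (A x) :=
  cast (Fin.append_left A a x) (var i (Fin.append A a) (Fin.castAdd k x))

/-- The variables of a binder. -/
def new (i : SignatureMap R T) (A : Fin n → Ty R.Atom) (a : Fin k → Ty R.Atom) (j : Fin k) :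
    Val i (Fin.append A a) (a j) :=
  cast (Fin.append_right A a j) (var i (Fin.append A a) (Fin.natAdd n j))

@[simp] theorem old_bind_fam (f : (x : Fin n) → Val i B (A x))
    (g : (j : Fin k) → Val i B (a j)) (x : Fin n) :
    NArr.bind (old i A a x) (fam f g) = f x := by
  rw [old, cast_bind, var_bind, fam_castAdd, cast_cast, cast_rfl]

@[simp] theorem new_bind_fam (f : (x : Fin n) → Val i B (A x))
    (g : (j : Fin k) → Val i B (a j)) (j : Fin k) :
    NArr.bind (new i A a j) (fam f g) = g j := by
  rw [new, cast_bind, var_bind, fam_natAdd, cast_cast, cast_rfl]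

theorem fam_bind (f : (x : Fin n) → Val i B (A x)) (g : (j : Fin k) → Val i B (a j))
    (Θ : (x : Fin m) → Val i C (B x)) (x : Fin (n + k)) :
    NArr.bind (fam f g x) Θ = fam (fun x => NArr.bind (f x) Θ) (fun j => NArr.bind (g j) Θ) x := by
  refine Fin.addCases (fun x => ?_) (fun j => ?_) x
  · rw [fam_castAdd, fam_castAdd, cast_bind]
  · rw [fam_natAdd, fam_natAdd, cast_bind]

theorem bind_fam (Φ : Val i (Fin.append A a) c) (f : (x : Fin n) → Val i B (A x))
    (g : (j : Fin k) → Val i B (a j)) (Θ : (x : Fin m) → Val i C (B x)) :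
    NArr.bind (NArr.bind Φ (fam f g)) Θ =
      NArr.bind Φ (fam (fun x => NArr.bind (f x) Θ) fun j => NArr.bind (g j) Θ) := by
  rw [NArr.bind_bind]
  congr 1
  funext x
  exact fam_bind f g Θ x

/-- Extension of a family of values under a binder. -/
noncomputable def lift (Θ : (x : Fin n) → Val i B (A x)) (a : Fin k → Ty R.Atom) :
    (x : Fin (n + k)) → Val i (Fin.append B a) (Fin.append A a x) :=
  fam (fun x => NArr.bind (Θ x) (old i B a)) (new i B a)

/-- The multiarrow `re` between interpretations of types. -/
def re (i : SignatureMap R T) (a : Fin k → Ty R.Atom) :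
    H.Hom (i.ob ∘ a) (i.ob (Ty.tensor a)) :=
  have h : T.rep.tensor (i.ob ∘ a) = i.ob (Ty.tensor a) := (i.obj_tensor a).symm
  h ▸ T.rep.re (i.ob ∘ a)

theorem arr_re (a : Fin k → Ty R.Atom) : H.arr (re i a) = H.arr (T.rep.re (i.ob ∘ a)) := by
  have : ∀ (x y : H.Node) (h : x = y) (f : H.Hom (i.ob ∘ a) x), H.arr (h ▸ f) = H.arr f := by
    rintro x _ rfl f; rfl
  exact this _ _ _ _

/-- The value of a list. -/
noncomputable def list {a : Fin k → Ty R.Atom} (Φ : (j : Fin k) → Val i A (a j)) :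
    Val i A (Ty.tensor a) := NArr.op (re i a) Φ

theorem list_bind (Φ : (j : Fin k) → Val i A (a j)) (Θ : (x : Fin n) → Val i B (A x)) :
    NArr.bind (list Φ) Θ = list fun j => NArr.bind (Φ j) Θ := NArr.op_bind _ _ _

/-- The family of values that replaces the last variable by the list of `k` new variables. -/
noncomputable def unpack (i : SignatureMap R T) (A : Fin n → Ty R.Atom) (a : Fin k → Ty R.Atom) :
    (x : Fin (n + 1)) → Val i (Fin.append A a) (Fin.append A (fun _ : Fin 1 => Ty.tensor a) x) :=
  fam (old i A a) fun _ => list (new i A a)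

theorem unpack_bind (Φ : Val i (Fin.append A fun _ : Fin 1 => Ty.tensor a) c)
    (f : (x : Fin n) → Val i B (A x)) (g : (j : Fin k) → Val i B (a j)) :
    NArr.bind (NArr.bind Φ (unpack i A a)) (fam f g) =
      NArr.bind Φ (fam f fun _ => list g) := by
  rw [unpack, bind_fam]
  simp only [old_bind_fam, list_bind, new_bind_fam]

theorem cnt_bind_fam (Φ : Val i (Fin.append A a) c) (f : (x : Fin n) → Val i B (A x))
    (g : (j : Fin k) → Val i B (a j)) (y : Fin m) :
    NArr.cnt (NArr.bind Φ (fam f g)) y =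
      ∑ x, NArr.cnt Φ (Fin.castAdd k x) * NArr.cnt (f x) y +
      ∑ j, NArr.cnt Φ (Fin.natAdd n j) * NArr.cnt (g j) y := by
  rw [NArr.cnt_bind, Fin.sum_univ_add]
  simp

theorem cnt_old (x : Fin n) (y : Fin (n + k)) :
    NArr.cnt (old i A a x) y = if Fin.castAdd k x = y then 1 else 0 := by
  rw [old, cnt_cast, cnt_var]

theorem cnt_new (j : Fin k) (y : Fin (n + k)) :
    NArr.cnt (new i A a j) y = if Fin.natAdd n j = y then 1 else 0 := by
  rw [new, cnt_cast, cnt_var]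

theorem cnt_unpack_castAdd (Φ : Val i (Fin.append A fun _ : Fin 1 => Ty.tensor a) c)
    (x : Fin n) : NArr.cnt (NArr.bind Φ (unpack i A a)) (Fin.castAdd k x) =
      NArr.cnt Φ (Fin.castAdd 1 x) := by
  rw [unpack, cnt_bind_fam]
  simp [cnt_old, list, NArr.cnt_op, cnt_new]

theorem cnt_unpack_natAdd (Φ : Val i (Fin.append A fun _ : Fin 1 => Ty.tensor a) c)
    (j : Fin k) : NArr.cnt (NArr.bind Φ (unpack i A a)) (Fin.natAdd n j) =
      NArr.cnt Φ (Fin.natAdd n 0) := by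
  rw [unpack, cnt_bind_fam]
  simp [cnt_old, list, NArr.cnt_op, cnt_new]

/-- Representatives of the family `unpack` by identities and by `re`. -/
theorem exists_unpack (i : SignatureMap R T) (A : Fin n → Ty R.Atom) (a : Fin k → Ty R.Atom) :
    ∃ U : (x : Fin (n + 1)) → Named (fun x => i.ob (Fin.append A a x))
        (i.ob (Fin.append A (fun _ : Fin 1 => Ty.tensor a) x)),
      (unpack i A a = fun x => NArr.mk T (U x)) ∧
      (∀ x, x ≠ Fin.natAdd n 0 → H.arr (U x).hom =
        H.arr (T.id (i.ob (Fin.append A (fun _ : Fin 1 => Ty.tensor a) x)))) ∧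
      H.arr (U (Fin.natAdd n 0)).hom = H.arr (T.rep.re (i.ob ∘ a)) := by
  have key : ∀ x, ∃ u : Named (fun x => i.ob (Fin.append A a x))
        (i.ob (Fin.append A (fun _ : Fin 1 => Ty.tensor a) x)),
      unpack i A a x = NArr.mk T u ∧ (x ≠ Fin.natAdd n 0 → H.arr u.hom =
        H.arr (T.id (i.ob (Fin.append A (fun _ : Fin 1 => Ty.tensor a) x)))) ∧
      (x = Fin.natAdd n 0 → H.arr u.hom = H.arr (T.rep.re (i.ob ∘ a))) := by
    have hcast : ∀ {m : ℕ} {B : Fin m → Ty R.Atom} {c c' : Ty R.Atom} (h : c = c')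
        (x : Named (fun x => i.ob (B x)) (i.ob c)), ∃ u : Named (fun x => i.ob (B x)) (i.ob c'),
        cast h (NArr.mk T x : Val i B c) = NArr.mk T u ∧ H.arr u.hom = H.arr x.hom := by
      rintro m B c _ rfl x
      exact ⟨x, rfl, rfl⟩
    refine Fin.addCases (fun x => ?_) (fun j => ?_)
    · obtain ⟨u, hu, hu'⟩ := hcast (B := Fin.append A a) ((Fin.append_left A a x).trans
        (Fin.append_left A (fun _ : Fin 1 => Ty.tensor a) x).symm)
        (Named.pure T (fun x => i.ob (Fin.append A a x)) (Fin.castAdd k x))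
      refine ⟨u, ?_, fun _ => ?_, fun h => absurd h (castAdd_ne_natAdd _ _)⟩
      · rw [← hu, unpack, fam_castAdd, old, cast_cast]
        rfl
      · rw [hu']
        change H.arr (T.id (i.ob (Fin.append A a _))) = _
        rw [Fin.append_left, Fin.append_left]
    · obtain rfl : j = 0 := Subsingleton.elim _ _
      have hx : ∃ x : Named (fun x => i.ob (Fin.append A a x)) (i.ob (Ty.tensor a)),
          list (new i A a) = NArr.mk T x ∧ H.arr x.hom = H.arr (T.rep.re (i.ob ∘ a)) := by
        choose y hy hy' using fun j => hcast (B := Fin.append A a) (Fin.append_right A a j)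
          (Named.pure T (fun x => i.ob (Fin.append A a x)) (Fin.natAdd n j))
        refine ⟨_, (congrArg (NArr.op (re i a)) (funext hy)).trans (NArr.mk_bind _ y), ?_⟩
        have hy2 : ∀ j, H.arr (y j).hom = H.arr (T.id (i.ob (a j))) := by
          intro j
          rw [hy' j]
          change H.arr (T.id (i.ob (Fin.append A a _))) = _
          rw [Fin.append_right]
        have hcomp : ∀ (b : H.Node) (f : H.Hom (i.ob ∘ a) b) (m : Fin k → ℕ)
            (γ : (j : Fin k) → Fin (m j) → H.Node) (g : (j : Fin k) → H.Hom (γ j) (i.ob (a j)))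
            (_ : ∀ j, H.arr (g j) = H.arr (T.id (i.ob (a j)))),
            H.arr (T.comp f g) = H.arr f := by
          intro b f m γ g hg
          obtain rfl : m = fun _ => 1 := funext fun j => congrArg Multigraph.Arr.arity (hg j)
          have hγ : γ = fun j _ => i.ob (a j) := by
            funext j
            have := hg j
            simp only [Multigraph.arr, Multigraph.Arr.mk.injEq, heq_eq_eq, true_and] at this
            exact this.1
          subst hγ
          obtain rfl : g = fun j => T.id (i.ob (a j)) := by
            funext j
            simpa [Multigraph.arr] using hg j
          exact T.comp_id f
        exact (hcomp _ (re i a) _ _ _ hy2).trans (arr_re a)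
      obtain ⟨x, hx, hx'⟩ := hx
      obtain ⟨u, hu, hu'⟩ := hcast (Fin.append_right A (fun _ : Fin 1 => Ty.tensor a) 0).symm x
      refine ⟨u, ?_, fun h => absurd rfl h, fun _ => hu'.trans hx'⟩
      rw [← hu, ← hx, unpack, fam_natAdd]
  choose U h1 h2 h3 using key
  exact ⟨U, funext h1, h2, h3 _ rfl⟩

theorem exists_unique_position {N : ℕ} {W : Type} [DecidableEq W] {l : Fin N → W} {w : W}
    (h : (∑ j, if l j = w then 1 else 0) = 1) : ∃ p, l p = w ∧ ∀ j, j ≠ p → l j ≠ w := by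
  obtain ⟨p, hp, hj⟩ := exists_unique_of_sum_eq_one h
  refine ⟨p, ?_, fun j hjp hl => ?_⟩
  · by_contra hp'; simp [hp'] at hp
  · have := hj j hjp
    simp [hl] at this

/-- The universal property of `re`, at the position at which the last variable is an input. -/
theorem bijective_comp_unpack {U : (x : Fin (n + 1)) → Named (fun x => i.ob (Fin.append A a x))
      (i.ob (Fin.append A (fun _ : Fin 1 => Ty.tensor a) x))}
    (h1 : ∀ x, x ≠ Fin.natAdd n 0 → H.arr (U x).hom =
      H.arr (T.id (i.ob (Fin.append A (fun _ : Fin 1 => Ty.tensor a) x))))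
    (h2 : H.arr (U (Fin.natAdd n 0)).hom = H.arr (T.rep.re (i.ob ∘ a)))
    {N : ℕ} (l : Fin N → Fin (n + 1))
    (hl : (∑ j, if l j = Fin.natAdd n 0 then 1 else 0) = 1) (b : H.Node) :
    Function.Bijective
      (fun f : H.Hom ((fun x => i.ob (Fin.append A (fun _ : Fin 1 => Ty.tensor a) x)) ∘ l) b =>
        T.comp (γ := fun j => (fun x => i.ob (Fin.append A a x)) ∘ (U (l j)).names) f
          fun j => (U (l j)).hom) := by
  obtain ⟨p, hp, hj⟩ := exists_unique_position hl
  refine T.rep.bijective _ b p (i.ob ∘ a) (fun j => (U (l j)).hom) ?_ fun j hjp => ?_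
  · have : ∀ x, x = Fin.natAdd n 0 → H.arr (U x).hom = H.arr (T.rep.re (i.ob ∘ a)) := by
      rintro _ rfl; exact h2
    exact this _ hp
  · exact h1 _ (hj j hjp)

/-- A value that is linear in the last variable is determined by its value at a list of new
variables. -/
theorem unpack_injective {Ψ Ψ' : Val i (Fin.append A fun _ : Fin 1 => Ty.tensor a) c}
    (h0 : NArr.cnt Ψ (Fin.natAdd n 0) = 1) (h0' : NArr.cnt Ψ' (Fin.natAdd n 0) = 1)
    (h1 : ∀ x, NArr.cnt Ψ (Fin.castAdd 1 x) ≤ 1)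
    (h : NArr.bind Ψ (unpack i A a) = NArr.bind Ψ' (unpack i A a)) : Ψ = Ψ' := by
  obtain ⟨U, hU, hU1, hU2⟩ := exists_unpack i A a
  obtain ⟨⟨N, l, f⟩, rfl⟩ := Ψ.exists_rep
  have hcnt : ∀ x, NArr.cnt Ψ' x = ∑ j, if l j = x then 1 else 0 := by
    refine Fin.addCases (fun x => ?_) (fun j => ?_)
    · rw [← cnt_unpack_castAdd, ← h, cnt_unpack_castAdd]
      rfl
    · obtain rfl : j = 0 := Subsingleton.elim _ _
      exact h0'.trans h0.symm
  obtain ⟨f', rfl⟩ := NArr.exists_eq_mk Ψ' l hcnt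
  have hle : ∀ y, NArr.cnt (NArr.bind (NArr.mk T ⟨N, l, f⟩) (unpack i A a)) y ≤ 1 := by
    refine Fin.addCases (fun x => ?_) (fun j => ?_)
    · rw [cnt_unpack_castAdd]; exact h1 x
    · rw [cnt_unpack_natAdd]; exact h0.le
  rw [hU, NArr.mk_bind, NArr.mk_bind] at h
  rw [hU, NArr.mk_bind] at hle
  have h2 := NArr.mk_injective (NArr.injective_of_sum_le_one hle) h
  exact congrArg (fun g => NArr.mk T ⟨N, l, g⟩) ((bijective_comp_unpack hU1 hU2 l h0 _).1 h2)

/-- A value that is linear in the new variables arises from a value that is linear in one variable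
of tensor type. -/
theorem unpack_surjective (Φ : Val i (Fin.append A a) c)
    (h : ∀ j, NArr.cnt Φ (Fin.natAdd n j) = 1) :
    ∃ Ψ : Val i (Fin.append A fun _ : Fin 1 => Ty.tensor a) c,
      NArr.cnt Ψ (Fin.natAdd n 0) = 1 ∧ NArr.bind Ψ (unpack i A a) = Φ := by
  obtain ⟨U, hU, hU1, hU2⟩ := exists_unpack i A a
  -- A list in which the last variable occurs once and the others as often as they do in `Φ`.
  let o : Fin (n + 1) → ℕ := Fin.append (fun x => NArr.cnt Φ (Fin.castAdd k x)) fun _ => 1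
  let l : Fin (∑ x, o x) → Fin (n + 1) := concat fun x (_ : Fin (o x)) => x
  have hl : ∀ x, (∑ j, if l j = x then 1 else 0) = o x := by
    intro x
    refine (Named.sum_concat _ _).trans ?_
    simp
  have hl0 : (∑ j, if l j = Fin.natAdd n 0 then 1 else 0) = 1 := by
    rw [hl]; simp [o]
  have hUcnt : ∀ x y, (∑ j, if (U x).names j = y then 1 else 0) = NArr.cnt (unpack i A a x) y := by
    intro x y; rw [hU]; rfl
  obtain ⟨f, hf⟩ := NArr.exists_eq_mk Φ (concat fun j => (U (l j)).names) (by
    intro y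
    rw [Named.sum_concat]
    simp only [hUcnt]
    have : ∀ g : Fin (n + 1) → ℕ, ∑ j, g (l j) = ∑ x, o x * g x := by
      intro g
      simp only [← hl, Finset.sum_mul]
      rw [Finset.sum_comm]
      simp
    rw [this fun x => NArr.cnt (unpack i A a x) y, Fin.sum_univ_add]
    simp only [o, Fin.append_left, Fin.append_right, unpack, fam_castAdd, fam_natAdd, cnt_cast,
      cnt_old, list, NArr.cnt_op, cnt_new]
    revert y
    refine Fin.addCases (fun x => ?_) (fun j => ?_)
    · simp
    · simp [h])
  obtain ⟨g, rfl⟩ := (bijective_comp_unpack hU1 hU2 l hl0 _).2 f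
  refine ⟨NArr.mk T ⟨_, l, g⟩, hl0, ?_⟩
  rw [hU, NArr.mk_bind]
  exact hf.symm

end Val

/-- The interpretation of terms. An explicit substitution is interpreted through the value `Ψ`,
linear in the last variable, from which the value of the body arises by putting the list of the
bound variables for the last variable. -/
inductive Interp (i : SignatureMap R T) : {n : ℕ} → (A : Fin n → Ty R.Atom) → Tm R n →
    (b : Ty R.Atom) → Val i A b → Prop
  | var {n : ℕ} (A : Fin n → Ty R.Atom) (x : Fin n) : Interp i A (Tm.var x) (A x) (Val.var i A x)
  | list {n k : ℕ} (A : Fin n → Ty R.Atom) (s : Fin k → Tm R n) (a : Fin k → Ty R.Atom)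
      (Φ : (j : Fin k) → Val i A (a j)) : (∀ j, Interp i A (s j) (a j) (Φ j)) →
      Interp i A (Tm.list s) (Ty.tensor a) (Val.list Φ)
  | app {n k : ℕ} (A : Fin n → Ty R.Atom) (a : Fin k → Ty R.Atom) (b : Ty R.Atom)
      (f : R.Hom a b) (s : Fin k → Tm R n) (Φ : (j : Fin k) → Val i A (a j)) :
      (∀ j, Interp i A (s j) (a j) (Φ j)) →
      Interp i A (Tm.app f s) b (NArr.op (i.arrow f) Φ)
  | sub {n k : ℕ} (A : Fin n → Ty R.Atom) (a : Fin k → Ty R.Atom) (s : Tm R (n + k))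
      (t : Tm R n) (b : Ty R.Atom)
      (Ψ : Val i (Fin.append A fun _ : Fin 1 => Ty.tensor a) b) (Φ : Val i A (Ty.tensor a)) :
      NArr.cnt Ψ (Fin.natAdd n 0) = 1 →
      Interp i (Fin.append A a) s b (NArr.bind Ψ (Val.unpack i A a)) →
      Interp i A t (Ty.tensor a) Φ →
      Interp i A (Tm.sub a s t) b (NArr.bind Ψ (Val.fam (Val.var i A) fun _ => Φ))

namespace Interp

variable {i : SignatureMap R T}

theorem var' {n : ℕ} {A : Fin n → Ty R.Atom} {x : Fin n} {b : Ty R.Atom} (h : A x = b) :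
    Interp i A (Tm.var x) b (Val.cast h (Val.var i A x)) := by
  subst h; exact Interp.var A x

theorem cast {n : ℕ} {A : Fin n → Ty R.Atom} {s : Tm R n} {b b' : Ty R.Atom} {Φ : Val i A b}
    (h : Interp i A s b Φ) (hb : b = b') : Interp i A s b' (Val.cast hb Φ) := by
  subst hb; exact h

theorem cnt_eq {n : ℕ} {A : Fin n → Ty R.Atom} {s : Tm R n} {b : Ty R.Atom} {Φ : Val i A b}
    (h : Interp i A s b Φ) (x : Fin n) : NArr.cnt Φ x = s.occ x := by
  induction h with
  | var A y => exact Val.cnt_var y x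
  | list A s a Φ _ ih => exact (NArr.cnt_op _ _ _).trans (Finset.sum_congr rfl fun j _ => ih j x)
  | app A a b f s Φ _ ih =>
    exact (NArr.cnt_op _ _ _).trans (Finset.sum_congr rfl fun j _ => ih j x)
  | sub A a s t b Ψ Φ h0 _ _ ihs iht =>
    rw [Val.cnt_bind_fam]
    simp only [Tm.occ, ← ihs, ← iht, Val.cnt_unpack_castAdd]
    simp [Val.cnt_var, h0]

theorem exists_of_hasTy (i : SignatureMap R T) {n : ℕ} {A : Fin n → Ty R.Atom} {s : Tm R n}
    {b : Ty R.Atom} (h : HasTy A s b) : ∃ Φ, Interp i A s b Φ := by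
  induction h with
  | var A x => exact ⟨_, Interp.var A x⟩
  | list A s a _ ih =>
    choose Φ hΦ using ih
    exact ⟨_, Interp.list A s a Φ hΦ⟩
  | app A a b f s _ ih =>
    choose Φ hΦ using ih
    exact ⟨_, Interp.app A a b f s Φ hΦ⟩
  | sub A a s t b _ ho _ ihs iht =>
    obtain ⟨Φs, hs⟩ := ihs
    obtain ⟨Φt, ht⟩ := iht
    obtain ⟨Ψ, h0, rfl⟩ := Val.unpack_surjective Φs fun j => by rw [hs.cnt_eq, ho]
    exact ⟨_, Interp.sub A a s t b Ψ Φt h0 hs ht⟩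

/-- A term in which every free variable occurs at most once has at most one value. -/
theorem unique {n : ℕ} {A : Fin n → Ty R.Atom} {s : Tm R n} {b : Ty R.Atom} {Φ Φ' : Val i A b}
    (h : Interp i A s b Φ) (h' : Interp i A s b Φ') (ho : ∀ x, s.occ x ≤ 1) : Φ = Φ' := by
  induction h with
  | var A x => cases h'; rfl
  | list A s a Φ _ ih =>
    cases h' with
    | list _ _ _ Φ' h' =>
      congr 1
      funext j
      exact ih j (h' j) fun x =>
        (Finset.single_le_sum (fun _ _ => Nat.zero_le _) (Finset.mem_univ j)).trans (ho x)
  | app A a b f s Φ _ ih =>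
    cases h' with
    | app _ _ _ _ _ Φ' h' =>
      congr 1
      funext j
      exact ih j (h' j) fun x =>
        (Finset.single_le_sum (fun _ _ => Nat.zero_le _) (Finset.mem_univ j)).trans (ho x)
  | sub A a s t b Ψ Φ h0 hs _ ihs iht =>
    cases h' with
    | sub _ _ _ _ _ Ψ' Φ' h0' hs' ht' =>
      simp only [Tm.occ] at ho
      have ho1 : ∀ x, s.occ (Fin.castAdd _ x) ≤ 1 :=
        fun x => (Nat.le_add_right _ _).trans (ho x)
      obtain rfl := iht ht' fun x => (Nat.le_add_left _ _).trans (ho x)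
      have h1 := ihs hs' (Fin.addCases ho1 fun j => by
        rw [← hs.cnt_eq, Val.cnt_unpack_natAdd]; exact h0.le)
      obtain rfl := Val.unpack_injective h0 h0' (fun x => by
        rw [← Val.cnt_unpack_castAdd, hs.cnt_eq]; exact ho1 x) h1
      rfl

/-- The substitution lemma for a class `Q` of interpreted substitutions that is closed under
extension below binders. -/
theorem subst_of (Q : ∀ {n m : ℕ} (A : Fin n → Ty R.Atom) (B : Fin m → Ty R.Atom)
      (_ : Fin n → Tm R m) (_ : (x : Fin n) → Val i B (A x)), Prop)
    (hQ : ∀ {n m : ℕ} {A : Fin n → Ty R.Atom} {B : Fin m → Ty R.Atom} {θ : Fin n → Tm R m}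
      {Θ : (x : Fin n) → Val i B (A x)}, Q A B θ Θ → ∀ x, Interp i B (θ x) (A x) (Θ x))
    (hlift : ∀ {n m k : ℕ} {A : Fin n → Ty R.Atom} {B : Fin m → Ty R.Atom} {θ : Fin n → Tm R m}
      {Θ : (x : Fin n) → Val i B (A x)} (a : Fin k → Ty R.Atom), Q A B θ Θ →
      Q (Fin.append A a) (Fin.append B a) (Tm.liftSubst k θ) (Val.lift Θ a))
    {n m : ℕ} {A : Fin n → Ty R.Atom} {s : Tm R n} {b : Ty R.Atom} {Φ : Val i A b}
    (h : Interp i A s b Φ) {B : Fin m → Ty R.Atom} {θ : Fin n → Tm R m}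
    {Θ : (x : Fin n) → Val i B (A x)} (hθ : Q A B θ Θ) :
    Interp i B (s.subst θ) b (NArr.bind Φ Θ) := by
  induction h generalizing m with
  | var A x => rw [Val.var_bind]; exact hQ hθ x
  | list A s a Φ _ ih =>
    rw [Val.list_bind]
    exact Interp.list _ _ _ _ fun j => ih j hθ
  | app A a b f s Φ _ ih =>
    rw [NArr.op_bind]
    exact Interp.app _ _ _ _ _ _ fun j => ih j hθ
  | sub A a s t b Ψ Φ h0 _ _ ihs iht =>
    have hs := ihs (hlift a hθ)
    rw [Val.lift, Val.unpack_bind] at hs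
    have h1 : NArr.bind (NArr.bind Ψ (Val.lift Θ fun _ : Fin 1 => Ty.tensor a))
        (Val.unpack i B a) =
        NArr.bind Ψ (Val.fam (fun x => NArr.bind (Θ x) (Val.old i B a))
          fun _ => Val.list (Val.new i B a)) := by
      rw [Val.lift, Val.bind_fam]
      simp only [NArr.bind_bind, Val.unpack, Val.new_bind_fam,
        Val.old_bind_fam]
    have h2 : NArr.bind (NArr.bind Ψ (Val.fam (Val.var i A) fun _ => Φ)) Θ =
        NArr.bind (NArr.bind Ψ (Val.lift Θ fun _ : Fin 1 => Ty.tensor a))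
          (Val.fam (Val.var i B) fun _ => NArr.bind Φ Θ) := by
      rw [Val.lift, Val.bind_fam, Val.bind_fam]
      simp only [NArr.bind_bind, Val.new_bind_fam, Val.old_bind_fam,
        Val.var_bind]
      congr 2
      funext x
      exact (NArr.bind_pure (Θ x)).symm
    rw [h2]
    refine Interp.sub _ _ _ _ _ _ _ ?_ ?_ (iht hθ)
    · rw [Val.lift, Val.cnt_bind_fam]
      have : ∀ x, NArr.cnt (NArr.bind (Θ x) (Val.old i B fun _ : Fin 1 => Ty.tensor a))
          (Fin.natAdd _ 0) = 0 := by
        intro x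
        rw [NArr.cnt_bind]
        simp [Val.cnt_old]
      simp [this, Val.cnt_new, h0]
    · rw [h1]; exact hs

theorem rename {n m : ℕ} {A : Fin n → Ty R.Atom} {s : Tm R n} {b : Ty R.Atom} {Φ : Val i A b}
    (h : Interp i A s b Φ) {B : Fin m → Ty R.Atom} (ρ : Fin n → Fin m)
    (hB : ∀ x, B (ρ x) = A x) :
    Interp i B (s.rename ρ) b (NArr.bind Φ fun x => Val.cast (hB x) (Val.var i B (ρ x))) := by
  rw [Tm.rename_eq_subst]
  refine subst_of (fun {n m} A B θ Θ => ∃ (ρ : Fin n → Fin m) (hB : ∀ x, B (ρ x) = A x),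
    (θ = fun x => Tm.var (ρ x)) ∧ Θ = fun x => Val.cast (hB x) (Val.var i B (ρ x)))
    ?_ ?_ h ⟨ρ, hB, rfl, rfl⟩
  · rintro n m A B θ Θ ⟨ρ, hB, rfl, rfl⟩ x
    exact Interp.var' (hB x)
  · rintro n m k A B θ Θ a ⟨ρ, hB, rfl, rfl⟩
    refine ⟨liftRen k ρ, Fin.addCases (by simp [hB]) (by simp), ?_, ?_⟩
    · apply funext_append <;> simp [Tm.rename]
    · funext x
      refine Fin.addCases (fun x => ?_) (fun j => ?_) x
      · rw [Val.lift, Val.fam_castAdd, Val.cast_bind, Val.var_bind, Val.old,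
          Val.cast_cast, Val.cast_cast]
        exact Val.cast_var_congr (liftRen_castAdd ρ x).symm _ _
      · rw [Val.lift, Val.fam_natAdd, Val.new, Val.cast_cast]
        exact Val.cast_var_congr (liftRen_natAdd ρ j).symm _ _

/-- The substitution lemma. -/
theorem subst {n m : ℕ} {A : Fin n → Ty R.Atom} {s : Tm R n} {b : Ty R.Atom} {Φ : Val i A b}
    (h : Interp i A s b Φ) {B : Fin m → Ty R.Atom} {θ : Fin n → Tm R m}
    {Θ : (x : Fin n) → Val i B (A x)} (hθ : ∀ x, Interp i B (θ x) (A x) (Θ x)) :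
    Interp i B (s.subst θ) b (NArr.bind Φ Θ) := by
  refine subst_of (fun {n m} A B θ Θ => ∀ x, Interp i B (θ x) (A x) (Θ x)) (fun h => h) ?_ h hθ
  intro n m k A B θ Θ a h
  refine Fin.addCases (fun x => ?_) (fun j => ?_)
  · rw [Val.lift, Val.fam_castAdd, Tm.liftSubst_castAdd]
    exact ((h x).rename (Fin.castAdd k) fun y => Fin.append_left _ _ y).cast _
  · rw [Val.lift, Val.fam_natAdd, Tm.liftSubst_natAdd]
    exact (Interp.var' (Fin.append_right _ _ _)).cast _

theorem append {n m k : ℕ} {A : Fin n → Ty R.Atom} {a : Fin k → Ty R.Atom}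
    {B : Fin m → Ty R.Atom} {θ : Fin n → Tm R m} {t : Fin k → Tm R m}
    {f : (x : Fin n) → Val i B (A x)} {g : (j : Fin k) → Val i B (a j)}
    (hθ : ∀ x, Interp i B (θ x) (A x) (f x)) (ht : ∀ j, Interp i B (t j) (a j) (g j)) :
    ∀ x, Interp i B (Fin.append θ t x) (Fin.append A a x) (Val.fam f g x) := by
  refine Fin.addCases (fun x => ?_) (fun j => ?_)
  · rw [Val.fam_castAdd, Fin.append_left]; exact (hθ x).cast _
  · rw [Val.fam_natAdd, Fin.append_right]; exact (ht j).cast _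

/-- Soundness: convertible terms have a common value. -/
theorem of_conv {n : ℕ} {A : Fin n → Ty R.Atom} {b : Ty R.Atom} {s s' : Tm R n}
    (h : Conv A b s s') (ho : ∀ x, s.occ x ≤ 1) :
    ∃ Φ, Interp i A s b Φ ∧ Interp i A s' b Φ := by
  induction h with
  | refl h =>
    obtain ⟨Φ, hΦ⟩ := exists_of_hasTy i h
    exact ⟨Φ, hΦ, hΦ⟩
  | symm h ih =>
    obtain ⟨Φ, h1, h2⟩ := ih (by rwa [h.occ_eq])
    exact ⟨Φ, h2, h1⟩
  | trans h _ ih ih' =>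
    have ho' := ho
    rw [h.occ_eq] at ho'
    obtain ⟨Φ, h1, h2⟩ := ih ho
    obtain ⟨Φ', h1', h2'⟩ := ih' ho'
    obtain rfl := h2.unique h1' ho'
    exact ⟨Φ, h1, h2'⟩
  | list _ ih =>
    have := fun j => ih j fun x =>
      (Finset.single_le_sum (fun _ _ => Nat.zero_le _) (Finset.mem_univ j)).trans (ho x)
    choose Φ h1 h2 using this
    exact ⟨_, Interp.list _ _ _ Φ h1, Interp.list _ _ _ Φ h2⟩
  | app f _ ih =>
    have := fun j => ih j fun x =>
      (Finset.single_le_sum (fun _ _ => Nat.zero_le _) (Finset.mem_univ j)).trans (ho x)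
    choose Φ h1 h2 using this
    exact ⟨_, Interp.app _ _ _ f _ Φ h1, Interp.app _ _ _ f _ Φ h2⟩
  | sub hs hb _ ihs iht =>
    simp only [Tm.occ] at ho
    obtain ⟨Φs, h1, h1'⟩ := ihs (Fin.addCases
      (fun x => (Nat.le_add_right _ _).trans (ho x)) fun j => (hb j).le)
    obtain ⟨Φt, h2, h2'⟩ := iht fun x => (Nat.le_add_left _ _).trans (ho x)
    obtain ⟨Ψ, h0, rfl⟩ := Val.unpack_surjective Φs fun j => by rw [h1.cnt_eq, hb]
    exact ⟨_, Interp.sub _ _ _ _ _ Ψ Φt h0 h1 h2, Interp.sub _ _ _ _ _ Ψ Φt h0 h1' h2'⟩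
  | beta hs hb ht =>
    choose Φt ht using fun j => exists_of_hasTy i (ht j)
    obtain ⟨Φs, hs⟩ := exists_of_hasTy i hs
    obtain ⟨Ψ, h0, rfl⟩ := Val.unpack_surjective Φs fun j => by rw [hs.cnt_eq, hb]
    refine ⟨_, Interp.sub _ _ _ _ _ Ψ _ h0 hs (Interp.list _ _ _ Φt ht), ?_⟩
    rw [← Val.unpack_bind]
    exact hs.subst (append (Interp.var _) ht)
  | @expand n k A a b s t hs hb ht =>
    obtain ⟨Φt, ht⟩ := exists_of_hasTy i ht
    obtain ⟨Ψ, hs⟩ := exists_of_hasTy i hs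
    refine ⟨_, hs.subst (append (Interp.var _) fun _ => ht), Interp.sub _ _ _ _ _ Ψ Φt ?_ ?_ ht⟩
    · rw [hs.cnt_eq, hb]
    · refine hs.subst (append (fun x => ?_) fun _ => Interp.list _ _ _ _ fun j => ?_)
      · exact Interp.var' _
      · exact Interp.var' _

theorem of_conv_left {n : ℕ} {A : Fin n → Ty R.Atom} {b : Ty R.Atom} {s s' : Tm R n}
    {Φ : Val i A b} (h : Conv A b s s') (ho : ∀ x, s.occ x ≤ 1) (hs : Interp i A s b Φ) :
    Interp i A s' b Φ := by
  obtain ⟨Φ', h1, h2⟩ := of_conv (i := i) h ho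
  rwa [hs.unique h1 ho]

end Interp

end Interpretation

/-! ### The functor induced by a map of signatures -/

section Functor

variable {R : Signature.{u, v}} {H : Multigraph.{w, z}} {T : SymRepStr H}

theorem arr_comp_congr (T : SymRepStr H) {n : ℕ} {a : Fin n → H.Node} {b : H.Node} {m : Fin n → ℕ}
    {γ γ' : (i : Fin n) → Fin (m i) → H.Node} (f : H.Hom a b) {g : (i : Fin n) → H.Hom (γ i) (a i)}
    {g' : (i : Fin n) → H.Hom (γ' i) (a i)} (h : ∀ i, H.arr (g i) = H.arr (g' i)) :
    H.arr (T.comp f g) = H.arr (T.comp f g') := by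
  obtain rfl : γ = γ' := by
    funext i
    have := h i
    simp only [Multigraph.arr, Multigraph.Arr.mk.injEq, heq_eq_eq, true_and] at this
    exact this.1
  obtain rfl : g = g' := by
    funext i
    simpa [Multigraph.arr] using h i
  rfl

theorem arr_act_congr (T : SymRepStr H) {m n : ℕ} {a a' : Fin n → H.Node} {b : H.Node}
    (σ : Fin m ≃ Fin n) {f : H.Hom a b} {f' : H.Hom a' b} (h : H.arr f = H.arr f') :
    H.arr (T.sym.act σ f) = H.arr (T.sym.act σ f') := by
  simp only [Multigraph.arr, Multigraph.Arr.mk.injEq, heq_eq_eq, true_and] at h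
  obtain ⟨rfl, h⟩ := h
  obtain rfl := eq_of_heq h
  rfl

namespace Val

variable {i : SignatureMap R T} {n : ℕ} {A : Fin n → Ty R.Atom} {b : Ty R.Atom}

/-- A multiarrow as a value, the inputs being named by their positions. -/
def ofHom {A : Fin n → Ty R.Atom} (φ : H.Hom (i.ob ∘ A) (i.ob b)) : Val i A b :=
  NArr.mk T ⟨n, fun x => x, φ⟩

theorem ofHom_injective {φ φ' : H.Hom (i.ob ∘ A) (i.ob b)} (h : ofHom φ = ofHom φ') : φ = φ' :=
  NArr.mk_injective (fun _ _ h => h) h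

theorem rename_ofHom {m : ℕ} {B : Fin m → Ty R.Atom} (φ : H.Hom (i.ob ∘ A) (i.ob b))
    (ρ : Fin n → Fin m) (hB : ∀ x, B (ρ x) = A x) :
    ∃ φ' : H.Hom (fun x => i.ob (B (ρ x))) (i.ob b), H.arr φ' = H.arr φ ∧
      NArr.bind (ofHom φ) (fun x => cast (hB x) (var i B (ρ x))) =
        NArr.mk T (⟨n, ρ, φ'⟩ : Named (fun x => i.ob (B x)) (i.ob b)) := by
  obtain rfl : A = fun x => B (ρ x) := funext fun x => (hB x).symm
  refine ⟨φ, rfl, ?_⟩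
  refine (NArr.mk_bind (B := fun x => i.ob (B x)) _
    fun x => Named.pure T (fun x => i.ob (B x)) (ρ x)).trans (congrArg _ ?_)
  exact Named.ext_arr (sigma_concat_singleton ρ) (T.comp_id φ)

end Val

namespace Interp

variable {i : SignatureMap R T}

theorem comp {n : ℕ} {a : Fin n → Ty R.Atom} {b : Ty R.Atom} {m : Fin n → ℕ}
    {γ : (j : Fin n) → Fin (m j) → Ty R.Atom} {s : Tm R n} {t : (j : Fin n) → Tm R (m j)}
    {φ : H.Hom (i.ob ∘ a) (i.ob b)} {ψ : (j : Fin n) → H.Hom (i.ob ∘ γ j) (i.ob (a j))}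
    (hs : Interp i a s b (Val.ofHom φ)) (ht : ∀ j, Interp i (γ j) (t j) (a j) (Val.ofHom (ψ j))) :
    Interp i (concat γ) (s.subst fun j => (t j).rename fun p => finSigmaFinEquiv ⟨j, p⟩) b
      (Val.ofHom (T.comp (γ := fun j => i.ob ∘ γ j) φ ψ)) := by
  have h := fun j => Val.rename_ofHom (B := concat γ) (ψ j) (fun p => finSigmaFinEquiv ⟨j, p⟩)
    fun p => concat_mk γ ⟨j, p⟩
  choose ψ' h1 h2 using h
  have h3 := hs.subst (B := concat γ) (θ := fun j => (t j).rename fun p => finSigmaFinEquiv ⟨j, p⟩)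
    fun j => (ht j).rename (B := concat γ) (fun p => finSigmaFinEquiv ⟨j, p⟩)
      fun p => concat_mk γ ⟨j, p⟩
  simp only [h2] at h3
  convert h3 using 1
  refine Eq.trans (congrArg (NArr.mk T) ?_) (NArr.mk_bind (B := fun x => i.ob (concat γ x)) _
    fun j => ⟨m j, fun p => finSigmaFinEquiv ⟨j, p⟩, ψ' j⟩).symm
  refine Named.ext_arr (congrArg (Sigma.mk _) ?_) ?_
  · funext p
    exact (finSigmaFinEquiv.apply_symm_apply p).symm
  · exact arr_comp_congr T φ fun j => (h1 j).symm

theorem act {m n : ℕ} {a : Fin n → Ty R.Atom} {b : Ty R.Atom} (σ : Fin m ≃ Fin n) {s : Tm R n}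
    {φ : H.Hom (i.ob ∘ a) (i.ob b)} (hs : Interp i a s b (Val.ofHom φ)) :
    Interp i (a ∘ σ) (s.rename σ.symm) b (Val.ofHom (T.sym.act σ φ)) := by
  have hB : ∀ x, (a ∘ σ) (σ.symm x) = a x := fun x => congrArg a (σ.apply_symm_apply x)
  obtain ⟨φ', h1, h2⟩ := Val.rename_ofHom (B := a ∘ σ) φ σ.symm hB
  have h3 := hs.rename (B := a ∘ σ) σ.symm hB
  rw [h2] at h3
  convert h3 using 1
  refine Eq.trans (congrArg (NArr.mk T) ?_)
    (NArr.mk_act (B := fun x => i.ob ((a ∘ σ) x)) ⟨n, σ.symm, φ'⟩ σ)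
  refine Named.ext_arr (congrArg (Sigma.mk _) ?_) ?_
  · funext p
    exact (σ.symm_apply_apply p).symm
  · exact arr_act_congr T σ h1.symm

/-- The value of a typed term is a multiarrow, which depends only on the class of the term. -/
theorem exists_hom (i : SignatureMap R T) {n : ℕ} {a : Fin n → Ty R.Atom} {b : Ty R.Atom}
    (f : (freeGraph R).Hom a b) : ∃ φ : H.Hom (i.ob ∘ a) (i.ob b),
      ∀ s : Terms R a b, f = cls s.1 s.2 → Interp i a s.1 b (Val.ofHom φ) := by
  obtain ⟨s, rfl⟩ := exists_rep f
  obtain ⟨Φ, hΦ⟩ := exists_of_hasTy i s.hasTy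
  obtain ⟨φ, rfl⟩ := NArr.exists_eq_mk Φ (fun x => x) fun x => by
    rw [hΦ.cnt_eq, s.occ]; simp
  exact ⟨φ, fun s' h => of_conv_left ((cls_eq_iff _ _).1 h) (fun x => (s.occ x).le) hΦ⟩

end Interp

/-- The multiarrow that interprets a class of terms. -/
noncomputable def freeMap (i : SignatureMap R T) {n : ℕ} {a : Fin n → Ty R.Atom} {b : Ty R.Atom}
    (f : (freeGraph R).Hom a b) : H.Hom (i.ob ∘ a) (i.ob b) :=
  (Interp.exists_hom i f).choose

theorem interp_freeMap (i : SignatureMap R T) {n : ℕ} {a : Fin n → Ty R.Atom} {b : Ty R.Atom}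
    (s : Terms R a b) : Interp i a s.1 b (Val.ofHom (freeMap i (cls s.1 s.2))) :=
  (Interp.exists_hom i (cls s.1 s.2)).choose_spec s rfl

/-- The multiarrow that interprets a class is determined by the interpretation of any of its
terms. -/
theorem freeMap_eq (i : SignatureMap R T) {n : ℕ} {a : Fin n → Ty R.Atom} {b : Ty R.Atom}
    (s : Terms R a b) {φ : H.Hom (i.ob ∘ a) (i.ob b)} (h : Interp i a s.1 b (Val.ofHom φ)) :
    freeMap i (cls s.1 s.2) = φ :=
  Val.ofHom_injective ((interp_freeMap i s).unique h fun x => (s.occ x).le)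

/-- The functor induced by a map of signatures. -/
noncomputable def freeFunctor (i : SignatureMap R T) : SymRepFunctor (freeStr R) T where
  obj := i.obj
  map f := freeMap i f
  map_id a := by
    refine freeMap_eq i ⟨_, typed_var a⟩ ?_
    -- The names of the inputs are `fun _ => 0` on the left and `fun x => x` on the right.
    have h : Val.var i (fun _ : Fin 1 => a) 0 =
        Val.ofHom (A := fun _ : Fin 1 => a) (T.id (i.ob a)) :=
      congrArg (NArr.mk T) (Named.ext_arr
        (congrArg (Sigma.mk 1) (funext fun x : Fin 1 => (Subsingleton.elim x 0).symm)) rfl)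
    exact h ▸ Interp.var (fun _ : Fin 1 => a) 0
  map_comp := by
    intro n a b m γ f g
    obtain ⟨s, rfl⟩ := exists_rep f
    choose t ht using fun i => exists_rep (g i)
    obtain rfl : g = _ := funext ht
    refine (congrArg _ (freeComp_cls s t)).trans ?_
    exact freeMap_eq i ⟨_, typed_comp s t⟩
      (Interp.comp (interp_freeMap i s) fun j => interp_freeMap i (t j))
  map_act := by
    intro m n a b σ f
    obtain ⟨s, rfl⟩ := exists_rep f
    refine (congrArg _ (freeAct_cls σ s)).trans ?_
    exact freeMap_eq i ⟨_, typed_act σ s⟩ (Interp.act σ (interp_freeMap i s))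
  obj_tensor c := i.obj_tensor c
  map_re := by
    intro k c
    refine Eq.trans (congrArg H.arr ?_) (Val.arr_re (i := i) c)
    refine freeMap_eq i ⟨_, typed_list_var c⟩ ?_
    have h := Interp.list c Tm.var c _ fun j => Interp.var (i := i) c j
    have h' : Val.list (Val.var i c) = Val.ofHom (Val.re i c) := NArr.bind_pure _
    rwa [h'] at h

theorem freeFunctor_comp_unit (i : SignatureMap R T) :
    (freeFunctor i).toGraphHom.comp (unit R) = i.toGraphHom := by
  have : ∀ {n : ℕ} {a : Fin n → Ty R.Atom} {b : Ty R.Atom} (f : R.Hom a b),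
      freeMap i (cls (Tm.app f Tm.var) (typed_app_var f)) = i.arrow f := by
    intro n a b f
    refine freeMap_eq i ⟨_, typed_app_var f⟩ ?_
    have h := Interp.app a a b f Tm.var _ fun j => Interp.var (i := i) a j
    have h' : NArr.op (i.arrow f) (Val.var i a) = Val.ofHom (i.arrow f) := NArr.bind_pure _
    rwa [h'] at h
  obtain ⟨⟨o, m⟩, h⟩ := i
  simp only [GraphHom.comp, GraphHom.mk.injEq]
  refine ⟨rfl, heq_of_eq ?_⟩
  funext n a b f
  exact this f

end Functor

/-! ### Uniqueness of the functor -/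

section Map

variable {G : Multigraph.{u, v}} {H : Multigraph.{w, z}} {S : SymRepStr G} {T : SymRepStr H}
  (F : SymRepFunctor S T) {V W : Type} {A : V → G.Node} {B : W → G.Node} {b : G.Node}

theorem Multigraph.arr_injective {n : ℕ} {a : Fin n → G.Node} {b : G.Node} {f g : G.Hom a b}
    (h : G.arr f = G.arr g) : f = g := by
  simpa [Multigraph.arr] using h

theorem GraphHom.mk_congr {o : G.Node → H.Node}
    {m m' : {n : ℕ} → {a : Fin n → G.Node} → {b : G.Node} → G.Hom a b → H.Hom (o ∘ a) (o b)}
    (h : ∀ {n : ℕ} {a : Fin n → G.Node} {b : G.Node} (f : G.Hom a b), m f = m' f) :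
    (⟨o, m⟩ : GraphHom G H) = ⟨o, m'⟩ := by
  obtain rfl : @m = @m' := by
    funext n a b f
    exact h f
  rfl

theorem Named.eq_of_mk_eq {N : ℕ} {l l' : Fin N → W} {f : G.Hom (B ∘ l) b}
    {f' : G.Hom (B ∘ l') b} (h : (⟨N, l, f⟩ : Named B b) = ⟨N, l', f'⟩) : l = l' ∧ HEq f f' := by
  simpa using h

/-- The image of a named multiarrow under a functor. -/
def Named.map (x : Named B b) : Named (fun v => F.obj (B v)) (F.obj b) :=
  ⟨x.arity, x.names, F.map x.hom⟩

namespace NArr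

/-- The image of a named multiarrow under a functor. -/
def map (Φ : NArr S B b) : NArr T (fun v => F.obj (B v)) (F.obj b) :=
  Quotient.lift (s := Named.setoid S B b) (fun x => mk T (x.map F)) (by
    rintro x _ ⟨m, σ, rfl⟩
    refine (mk_act (x.map F) σ).symm.trans (congrArg (mk T) ?_)
    simp only [Named.map, Named.act, F.map_act]
    rfl) Φ

theorem map_mk (x : Named B b) : map F (mk S x) = mk T (x.map F) := rfl

theorem map_pure (v : W) : map F (pure S B v) = pure T (fun v => F.obj (B v)) v := by
  refine congrArg (mk T) ?_
  simp only [Named.map, Named.pure, F.map_id]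

theorem map_bind (Φ : NArr S A b) (Θ : (v : V) → NArr S B (A v)) :
    map F (Φ.bind Θ) = (map F Φ).bind fun v => map F (Θ v) := by
  obtain ⟨x, rfl⟩ := Φ.exists_rep
  choose y hy using fun v => (Θ v).exists_rep
  obtain rfl : Θ = _ := funext hy
  simp only [mk_bind, map_mk]
  refine congrArg (mk T) ?_
  exact Named.ext_arr rfl (congrArg H.arr
    (F.map_comp (γ := fun i => B ∘ (y (x.names i)).names) x.hom fun i => (y (x.names i)).hom))

theorem map_op {k : ℕ} {a : Fin k → G.Node} (φ : G.Hom a b) (Φ : (j : Fin k) → NArr S B (a j)) :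
    map F (op φ Φ) = op (F.map φ) fun j => map F (Φ j) :=
  map_bind F _ _

theorem cnt_map [DecidableEq W] (Φ : NArr S B b) (v : W) : (map F Φ).cnt v = Φ.cnt v := by
  obtain ⟨x, rfl⟩ := Φ.exists_rep
  rfl

end NArr

end Map

section Uniqueness

variable {R : Signature.{u, v}} {H : Multigraph.{w, z}} {T : SymRepStr H}

/-- The inclusion of a signature as a map of signatures. -/
noncomputable def unitMap (R : Signature.{u, v}) : SignatureMap R (freeStr R) where
  toGraphHom := unit R
  obj_tensor _ := rfl

/-- The restriction of a functor along the inclusion of a signature. -/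
noncomputable def restrict (F : SymRepFunctor (freeStr R) T) : SignatureMap R T where
  toGraphHom := F.toGraphHom.comp (unit R)
  obj_tensor c := F.obj_tensor c

namespace Val

variable (F : SymRepFunctor (freeStr R) T) {n m k : ℕ} {A : Fin n → Ty R.Atom}
  {B : Fin m → Ty R.Atom} {a : Fin k → Ty R.Atom} {b c c' : Ty R.Atom}

/-- The image under a functor of a value in the multicategory of terms. -/
noncomputable def map (Φ : Val (unitMap R) A c) : Val (restrict F) A c := NArr.map F Φ

theorem map_cast (h : c = c') (Φ : Val (unitMap R) A c) :
    map F (cast h Φ) = cast h (map F Φ) := by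
  subst h; rfl

theorem map_var (x : Fin n) : map F (var (unitMap R) A x) = var (restrict F) A x :=
  NArr.map_pure F (B := fun x => (unitMap R).ob (A x)) x

theorem map_bind (Φ : Val (unitMap R) A c) (Θ : (x : Fin n) → Val (unitMap R) B (A x)) :
    map F (NArr.bind Φ Θ) = NArr.bind (map F Φ) fun x => map F (Θ x) :=
  NArr.map_bind F (A := fun x => (unitMap R).ob (A x)) Φ Θ

theorem map_re (a : Fin k → Ty R.Atom) : F.map (re (unitMap R) a) = re (restrict F) a :=
  Multigraph.arr_injective ((F.map_re a).trans (arr_re (i := restrict F) a).symm)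

theorem map_list (Φ : (j : Fin k) → Val (unitMap R) A (a j)) :
    map F (list Φ) = list fun j => map F (Φ j) :=
  (NArr.map_op F _ _).trans
    (congrArg (fun φ => NArr.op (a := (restrict F).ob ∘ a) φ fun j => map F (Φ j)) (map_re F a))

theorem map_fam (f : (x : Fin n) → Val (unitMap R) B (A x))
    (g : (j : Fin k) → Val (unitMap R) B (a j)) (x : Fin (n + k)) :
    map F (fam f g x) = fam (fun x => map F (f x)) (fun j => map F (g j)) x := by
  refine Fin.addCases (fun x => ?_) (fun j => ?_) x
  · rw [fam_castAdd, fam_castAdd, map_cast]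
  · rw [fam_natAdd, fam_natAdd, map_cast]

theorem map_unpack (x : Fin (n + 1)) :
    map F (unpack (unitMap R) A a x) = unpack (restrict F) A a x := by
  simp only [unpack, map_fam, map_list, old, new, map_cast, map_var]
  rfl

theorem cnt_map (Φ : Val (unitMap R) A c) (x : Fin n) : NArr.cnt (map F Φ) x = NArr.cnt Φ x :=
  NArr.cnt_map F Φ x

end Val

/-- A functor carries the interpretation of terms by their own classes to the interpretation in
its target. -/
theorem Interp.map (F : SymRepFunctor (freeStr R) T) {n : ℕ} {A : Fin n → Ty R.Atom} {s : Tm R n}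
    {b : Ty R.Atom} {Φ : Val (unitMap R) A b} (h : Interp (unitMap R) A s b Φ) :
    Interp (restrict F) A s b (Val.map F Φ) := by
  induction h with
  | var A x => rw [Val.map_var]; exact Interp.var A x
  | list A s a Φ _ ih =>
    rw [Val.map_list]
    exact Interp.list _ _ _ _ ih
  | app A a b f s Φ _ ih =>
    have h : Val.map F (NArr.op ((unitMap R).arrow f) Φ) =
        NArr.op ((restrict F).arrow f) fun j => Val.map F (Φ j) := NArr.map_op F _ _
    rw [h]
    exact Interp.app _ _ _ _ _ _ ih
  | sub A a s t b Ψ Φ h0 _ _ ihs iht =>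
    rw [Val.map_bind] at ihs ⊢
    simp only [Val.map_unpack, Val.map_fam, Val.map_var] at ihs ⊢
    exact Interp.sub _ _ _ _ _ _ _ ((Val.cnt_map F Ψ _).trans h0) ihs iht

/-- The value `Φ` in the multicategory of terms is the class of `s`. -/
def Represents {n : ℕ} {A : Fin n → Ty R.Atom} {b : Ty R.Atom} (Φ : Val (unitMap R) A b)
    (s : Tm R n) : Prop :=
  ∃ (N : ℕ) (l : Fin N → Fin n) (u : Terms R (A ∘ l) b),
    Φ = NArr.mk (freeStr R) ⟨N, l, cls u.1 u.2⟩ ∧ Conv A b (u.1.rename l) s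

namespace Represents

variable {n m k : ℕ} {A : Fin n → Ty R.Atom} {B : Fin m → Ty R.Atom} {a : Fin k → Ty R.Atom}
  {b : Ty R.Atom}

theorem conv {Φ : Val (unitMap R) A b} {s s' : Tm R n} (h : Represents Φ s)
    (h' : Represents Φ s') : Conv A b s s' := by
  obtain ⟨N, l, u, rfl, hs⟩ := h
  obtain ⟨N', l', u', hu, hs'⟩ := h'
  obtain ⟨M, σ, h⟩ := NArr.mk_eq_iff.1 hu
  obtain rfl : N' = M := congrArg Named.arity h
  obtain ⟨rfl, h⟩ := Named.eq_of_mk_eq h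
  have h1 := (eq_of_heq h).trans (freeAct_cls σ u)
  have h2 := ((cls_eq_iff u'.2 (typed_act σ u)).1 h1).rename (B := A) (l ∘ σ) fun _ => rfl
  rw [Tm.rename_rename] at h2
  have h3 : (l ∘ σ) ∘ σ.symm = l := funext fun x => congrArg l (σ.apply_symm_apply x)
  rw [h3] at h2
  exact hs.symm.trans (h2.symm.trans hs')

theorem exists_of (Φ : Val (unitMap R) A b) : ∃ s, HasTy A s b ∧ Represents Φ s := by
  obtain ⟨⟨N, l, f⟩, rfl⟩ := Φ.exists_rep
  obtain ⟨u, rfl⟩ := exists_rep (R := R) (a := A ∘ l) (b := b) f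
  have := u.hasTy.rename (B := A) l fun _ => rfl
  exact ⟨_, this, N, l, u, rfl, Conv.refl this⟩

theorem bind {Φ : Val (unitMap R) A b} {s : Tm R n} (h : Represents Φ s)
    {Θ : (x : Fin n) → Val (unitMap R) B (A x)} {θ : Fin n → Tm R m}
    (hθ : ∀ x, Represents (Θ x) (θ x)) : Represents (NArr.bind Φ Θ) (s.subst θ) := by
  obtain ⟨N, l, u, rfl, hs⟩ := h
  choose M r t h1 h2 using hθ
  obtain rfl : Θ = _ := funext h1
  refine ⟨_, concat fun j => r (l j),
    ⟨_, typed_comp u fun j => t (l j)⟩, ?_, ?_⟩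
  · refine (NArr.mk_bind (T := freeStr R) (A := fun x => (unitMap R).ob (A x)) _
      fun x => ⟨M x, r x, cls (t x).1 (t x).2⟩).trans (congrArg (NArr.mk (freeStr R)) ?_)
    exact Named.ext_arr rfl (congrArg _ (freeComp_cls u fun j => t (l j)))
  · have h3 := hs.subst_conv h2
    rw [Tm.subst_rename] at h3
    rw [Tm.rename_subst]
    have h4 : ∀ j, (concat fun j => r (l j)) ∘ (fun p => finSigmaFinEquiv ⟨j, p⟩) = r (l j) :=
      fun j => funext fun p => concat_mk (fun j => r (l j)) ⟨j, p⟩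
    simp only [Tm.rename_rename, h4]
    exact h3

theorem of_typed (s : Terms R A b) : Represents (Val.ofHom (cls s.1 s.2)) s.1 :=
  ⟨n, fun x => x, s, rfl, by rw [Tm.rename_id]; exact Conv.refl s.hasTy⟩

theorem var (x : Fin n) : Represents (Val.var (unitMap R) A x) (Tm.var x) :=
  ⟨1, fun _ => x, ⟨_, typed_var (A x)⟩, rfl, Conv.refl (HasTy.var A x)⟩

theorem cast {b' : Ty R.Atom} {Φ : Val (unitMap R) A b} {s : Tm R n} (h : Represents Φ s)
    (hb : b = b') : Represents (Val.cast hb Φ) s := by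
  subst hb; exact h

theorem fam {f : (x : Fin n) → Val (unitMap R) B (A x)} {g : (j : Fin k) → Val (unitMap R) B (a j)}
    {θ : Fin n → Tm R m} {t : Fin k → Tm R m} (hf : ∀ x, Represents (f x) (θ x))
    (hg : ∀ j, Represents (g j) (t j)) :
    ∀ x, Represents (Val.fam f g x) (Fin.append θ t x) := by
  refine Fin.addCases (fun x => ?_) (fun j => ?_)
  · rw [Val.fam_castAdd, Fin.append_left θ t]; exact (hf x).cast _
  · rw [Val.fam_natAdd, Fin.append_right θ t]; exact (hg j).cast _

theorem list {Φ : (j : Fin k) → Val (unitMap R) A (a j)} {s : Fin k → Tm R n}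
    (h : ∀ j, Represents (Φ j) (s j)) : Represents (Val.list Φ) (Tm.list s) :=
  (of_typed ⟨_, typed_list_var a⟩).bind h

theorem app {f : R.Hom a b} {Φ : (j : Fin k) → Val (unitMap R) A (a j)} {s : Fin k → Tm R n}
    (h : ∀ j, Represents (Φ j) (s j)) :
    Represents (NArr.op ((unitMap R).arrow f) Φ) (Tm.app f s) :=
  (of_typed ⟨_, typed_app_var f⟩).bind h

theorem cnt_eq {Φ : Val (unitMap R) A b} {s : Tm R n} (h : Represents Φ s) (x : Fin n) :
    NArr.cnt Φ x = s.occ x := by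
  obtain ⟨N, l, u, rfl, hs⟩ := h
  rw [← hs.occ_eq, Tm.occ_rename]
  change (∑ j, if l j = x then 1 else 0) = _
  simp [u.occ]

end Represents

/-- In the multicategory of terms, the value of a term is its class. -/
theorem Interp.represents {n : ℕ} {A : Fin n → Ty R.Atom} {s : Tm R n} {b : Ty R.Atom}
    {Φ : Val (unitMap R) A b} (h : Interp (unitMap R) A s b Φ) : Represents Φ s := by
  induction h with
  | var A x => exact Represents.var x
  | list A s a Φ _ ih => exact Represents.list ih
  | app A a b f s Φ _ ih => exact Represents.app ih
  | sub A a s t b Ψ Φ h0 _ _ ihs iht =>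
    -- If `v` is a term with class `Ψ`, then `expand` for `v` is the required conversion.
    obtain ⟨v, hv, hΨ⟩ := Represents.exists_of Ψ
    have h1 : Represents (NArr.bind Ψ (Val.unpack (unitMap R) A a)) (v.subst (unpack _ _)) := by
      refine hΨ.bind (Represents.fam (fun x => (Represents.var _).cast _) fun _ =>
        Represents.list fun j => (Represents.var _).cast _)
    have h2 : Represents (NArr.bind Ψ (Val.fam (Val.var (unitMap R) A) fun _ => Φ))
        (v.subst (Fin.append Tm.var fun _ => t)) :=
      hΨ.bind (Represents.fam Represents.var fun _ => iht)
    obtain ⟨N, l, u, hu, hc⟩ := h2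
    obtain ⟨_, _, _, _, ht⟩ := iht
    exact ⟨N, l, u, hu, hc.trans (Conv.sub_of_expand v hv (by rw [← hΨ.cnt_eq, h0]) ht.right rfl
      (h1.conv ihs))⟩

theorem interp_cls {n : ℕ} {a : Fin n → Ty R.Atom} {b : Ty R.Atom} (s : Terms R a b) :
    Interp (unitMap R) a s.1 b (Val.ofHom (cls s.1 s.2)) := by
  have h := interp_freeMap (unitMap R) s
  obtain ⟨t, ht⟩ := exists_rep (R := R) (a := a) (b := b) (freeMap (unitMap R) (cls s.1 s.2))
  have h' := h
  rw [ht] at h'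
  have h1 := (Represents.of_typed t).conv h'.represents
  rw [ht, Conv.cls_eq h1 t.2 s.2] at h
  exact h

/-- A functor is determined by its restriction to the signature: it carries the value of a term in
the multicategory of terms, which is its class, to the value of the term in its target. -/
theorem freeFunctor_unique (F : SymRepFunctor (freeStr R) T) : F = freeFunctor (restrict F) := by
  have : ∀ {n : ℕ} {a : Fin n → Ty R.Atom} {b : Ty R.Atom} (f : (freeGraph R).Hom a b),
      F.map f = freeMap (restrict F) f := by
    intro n a b f
    obtain ⟨s, rfl⟩ := exists_rep f
    exact (freeMap_eq (restrict F) s ((interp_cls s).map F)).symm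
  have h : F.toGraphHom = (freeFunctor (restrict F)).toGraphHom :=
    GraphHom.mk_congr fun f => this f
  generalize freeFunctor (restrict F) = F' at h
  obtain ⟨E, _, _, _, _, _⟩ := F
  obtain ⟨E', _, _, _, _, _⟩ := F'
  obtain rfl : E = E' := h
  rfl

end Uniqueness

end RepCalc

theorem mainTheorem5 (R : Signature.{u, v}) :
    ∃ S : SymRepStr (freeGraph R),
      -- identities are variables
      (∀ a : Ty R.Atom, S.id a = cls (Tm.var 0) (typed_var a)) ∧
      -- composition is substitution
      (∀ {n : ℕ} {a : Fin n → Ty R.Atom} {b : Ty R.Atom} {m : Fin n → ℕ}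
        {γ : (i : Fin n) → Fin (m i) → Ty R.Atom} (s : Terms R a b)
        (t : (i : Fin n) → Terms R (γ i) (a i)),
        ∃ h : Typed (fun p => (p, concat γ p))
            (s.1.subst fun i => (t i).1.rename fun j => finSigmaFinEquiv ⟨i, j⟩) b,
          S.comp (cls s.1 s.2) (fun i => cls (t i).1 (t i).2) =
            cls (s.1.subst fun i => (t i).1.rename fun j => finSigmaFinEquiv ⟨i, j⟩) h) ∧
      -- a permutation acts by permuting the typing context
      (∀ {m n : ℕ} {a : Fin n → Ty R.Atom} {b : Ty R.Atom} (σ : Fin m ≃ Fin n)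
        (s : Terms R a b),
        ∃ h : Typed (fun i => (i, (a ∘ σ) i)) (s.1.rename σ.symm) b,
          S.sym.act σ (cls s.1 s.2) = cls (s.1.rename σ.symm) h) ∧
      -- the representable structure is given by the tensor types and the lists of variables
      (∀ {k : ℕ} (c : Fin k → Ty R.Atom), S.rep.tensor c = Ty.tensor c) ∧
      (∀ {k : ℕ} (c : Fin k → Ty R.Atom),
        (freeGraph R).arr (S.rep.re c) =
          (freeGraph R).arr (cls (Tm.list Tm.var) (typed_list_var c))) ∧
      -- the universal property
      (∀ (H : Multigraph.{w, z}) (T : SymRepStr H) (i : SignatureMap R T),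
        ∃! F : SymRepFunctor S T, F.toGraphHom.comp (unit R) = i.toGraphHom) := by
  refine ⟨freeStr R, fun a => rfl, fun s t => ⟨typed_comp s t, freeComp_cls s t⟩,
    fun σ s => ⟨typed_act σ s, freeAct_cls σ s⟩, fun c => rfl, fun c => rfl, fun H T i =>
    ⟨freeFunctor i, freeFunctor_comp_unit i, fun F hF => ?_⟩⟩
  have h : restrict F = i := by
    obtain ⟨E, hE⟩ := i
    obtain rfl : F.toGraphHom.comp (unit R) = E := hF
    rfl
  rw [← h]
  exact freeFunctor_unique F
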